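/- **Conventions.** Let $G=(V,E)$ be a simple unweighted graph with $n$ vertices and $m$ edges. For $S\subseteq V$ let $\mathrm{cut}_G(S)$ be the number of edges between $S$ and $V\setminus S$, and let $\mathrm{cross}_S(v)$ be the number of edges at $v$ that cross this cut. The cut $S$ is *$\alpha$-friendly* if $1-\mathrm{cross}_S(v)/\deg(v)\ge\alpha$ for every $v\in V$ of positive degree. A *contraction* $H$ of $G$ is obtained by contracting the classes of a partition of $V$ to super-vertices, keeping parallel edges and discarding self-loops; $\mathrm{cut}_H(S)$ is the number of edges of $H$ between $S$ and $V\setminus S$, and $\infty$ if $S$ splits a super-vertex. $H$ is an *$(\alpha,w)$-friendly cut sparsifier* of $G$ if it is a contraction of $G$ and $\mathrm{cut}_H(S)=\mathrm{cut}_G(S)$ for every $\alpha$-friendly cut $S$ of $G$ with at most $w$ edges. It is *$k$-robust* if for all lists $I$ of edge insertions and $D$ of edge deletions with $|I|+|D|\le k$, the graph $(H\cup I)\setminus D$ is a $(2\alpha,w)$-friendly cut sparsifier of $(G\cup I)\setminus D$. A multigraph is a *$\psi$-expander* if $\psi\cdot\min(\mathrm{vol}(S),\mathrm{vol}(V\setminus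 S))\le\mathrm{cut}(S)$ for all sets $S$ of vertices, where $\mathrm{vol}(S)$ is the sum of the degrees in $S$ and a self-loop adds $1$ to a degree. An *$(\epsilon,\psi)$-expander decomposition* of a multigraph is a partition of its vertices into clusters such that at most an $\epsilon$-fraction of all edges runs between clusters and each cluster induces a $\psi$-expander. **Construction with slack.** Let $\alpha\in(0,1/4)$, $\beta\in(0,1)$, $w\ge 1$, $\phi>0$, put $\epsilon=0.01\,\alpha\beta$, choose $s_0$ with $\frac{\alpha\beta m}{100\phi n}\le s_0\le \frac mn$, and let $w_j=4^{-j}s_0^2$. Start with $G_0=G$. For $j=1,2,\dots$, as long as $w_j\ge w$: add $\lceil(\epsilon/\phi)^{-1}\sqrt{w_j}\,|x|\rceil$ self-loops at each super-vertex $x$ of $G_{j-1}$, where $|x|$ is the number of vertices of $G$ in $x$; take an $(\epsilon,\epsilon/\phi)$-expander decomposition of the result; in each cluster $W$ shave every $x$ with $d(x)<\tau(x)$ and any further $x$ with $\beta d(x)<\tau(x)$, where $d(x)$ is the degree of $x$ in $G_{j-1}$ and $\tau(x)=\max\{10\alpha^{-1}\sqrt{w_j}\,|x|,\ 4\alpha^{-1}|E_{j-1}(\{x\},V_{j-1}\setminus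 W)|\}$; contract the non-shaved vertices of each cluster into one vertex and discard self-loops to get $G_j$. The result is the last $G_j$. **Lemma.** There are a program $P$, a constant $C$ and an exponent $k$ such that the following holds for every simple unweighted graph $G$ on $n$ vertices with $m$ edges, all $\alpha\in(0,1/4)$, $w\ge1$, slack $\beta\in(0,1)$ and $\phi>0$, and every procedure that, given a contraction of $G$, possibly with self-loops, and $\epsilon\in(0,1)$, returns an $(\epsilon,\epsilon/\phi)$-expander decomposition of it. 1. The program $P$, which runs on a real RAM with access to the procedure and is given $n$, $m$, the list of the edges of $G$, and $\alpha,\beta,w,\phi$, outputs the super-vertices of a contraction $H$ of $G$ such that $H$ is a $\sqrt w$-robust $(\alpha,w)$-friendly cut sparsifier of $G$ with at most $C\log^k(n+2)\cdot(\beta\alpha)^{-1}n\,\phi\sqrt w$ edges. This $H$ is a possible result of the construction above. $P$ makes at most $C\log^k(n+2)$ calls to the procedure, all of them on contractions of $G$, possibly with self-loops, and with $\epsilon\in(0,1)$, and it spends time at most $C(m+1)$ outside these calls (including writing down the queries and reading the answers). 2. Every possible result $H$ of the construction above, for every admissible $s_0$, all expander decompositions and all choices that the slack permits, is a $\sqrt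 w$-robust $(\alpha,w)$-friendly cut sparsifier of $G$ with at most $C\log^k(n+2)\cdot(\beta\alpha)^{-1}n\,\phi\sqrt w$ edges, and is reached after at most $C\log^k(n+2)$ rounds. -/

import Mathlib

noncomputable section

namespace FriendlyCut

/-! ## Cuts and friendly cuts of an unweighted (simple) graph -/

section Cuts

variable {V : Type*}

/-- The unordered pair `e` has one endpoint in `S` and the other one outside `S`. -/
def Crosses (S : Set V) (e : Sym2 V) : Prop := ∃ u ∈ S, ∃ v, v ∉ S ∧ e = s(u, v)

/-- `cut_G(S)`: the number of edges between `S` and its complement. -/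
def cut (G : SimpleGraph V) (S : Set V) : ℕ := {e ∈ G.edgeSet | Crosses S e}.ncard

/-- `deg_G(v)`. -/
def deg (G : SimpleGraph V) (v : V) : ℕ := (G.neighborSet v).ncard

/-- The number of edges incident to `v` that cross the cut `S`. -/
def cross (G : SimpleGraph V) (S : Set V) (v : V) : ℕ :=
  {u ∈ G.neighborSet v | ¬ (u ∈ S ↔ v ∈ S)}.ncard

/-- Every vertex has friendliness ratio `1 - cross_S(v) / deg(v)` at least `α`.  (The ratio of an
isolated vertex is `1`, so isolated vertices are no obstruction.) -/
def IsFriendly (α : ℝ) (G : SimpleGraph V) (S : Set V) : Prop :=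
  ∀ v, α ≤ 1 - (cross G S v : ℝ) / (deg G v : ℝ)

/-! ## Contractions and friendly cut sparsifiers -/

/-- A graph on super-vertices.  The super-vertices are the classes of `part`; an edge is recorded
by its original endpoints, so parallel edges between two super-vertices stay distinct. -/
@[ext] structure Contracted (V : Type*) where
  part : Setoid V
  edges : Set (Sym2 V)

/-- The endpoints of `e` lie in different classes of `r`, so `e` does not become a self-loop when
the classes of `r` are contracted. -/
def Survives (r : Setoid V) (e : Sym2 V) : Prop := ∃ u v, e = s(u, v) ∧ ¬ r u v

/-- The contraction of `G` along the partition `r`: parallel edges are kept and self-loops are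
discarded. -/
def contract (G : SimpleGraph V) (r : Setoid V) : Contracted V where
  part := r
  edges := {e ∈ G.edgeSet | Survives r e}

open Classical in
/-- The value of the cut `S ⊆ V` in a contracted graph.  Contracting a set is the same as joining
its vertices by edges of infinite capacity, so a cut that splits a super-vertex has value `∞`. -/
def Contracted.cut (H : Contracted V) (S : Set V) : ℕ∞ :=
  if ∀ u v, H.part u v → (u ∈ S ↔ v ∈ S) then ({e ∈ H.edges | Crosses S e}.ncard : ℕ∞) else ⊤

/-- `H` is a contraction of `G` that preserves every `α`-friendly cut with at most `w` edges. -/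
def IsFriendlyCutSparsifier (α w : ℝ) (G : SimpleGraph V) (H : Contracted V) : Prop :=
  (∃ r, H = contract G r) ∧
    ∀ S : Set V, IsFriendly α G S → (FriendlyCut.cut G S : ℝ) ≤ w →
      H.cut S = (FriendlyCut.cut G S : ℕ∞)

/-- `(G ∪ I) ∖ D`. -/
def updateGraph (G : SimpleGraph V) (I D : List (Sym2 V)) : SimpleGraph V :=
  (G ⊔ SimpleGraph.fromEdgeSet {e | e ∈ I}) \ SimpleGraph.fromEdgeSet {e | e ∈ D}

/-- `(H ∪ I) ∖ D`: the super-vertices stay, and an inserted edge inside a super-vertex is a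
self-loop and is discarded. -/
def Contracted.update (H : Contracted V) (I D : List (Sym2 V)) : Contracted V where
  part := H.part
  edges := {e ∈ (H.edges ∪ {e | e ∈ I}) \ {e | e ∈ D} | Survives H.part e}

/-- `k`-robustness of the `(α, w)`-friendly cut sparsifier `H` of `G`: after at most `k` edge
insertions and deletions in total it is a `(2α, w)`-friendly cut sparsifier of the updated graph. -/
def IsRobust (k α w : ℝ) (G : SimpleGraph V) (H : Contracted V) : Prop :=
  ∀ I D : List (Sym2 V), ((I.length + D.length : ℕ) : ℝ) ≤ k →
    IsFriendlyCutSparsifier (2 * α) w (updateGraph G I D) (H.update I D)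

end Cuts

/-! ## Multigraphs and expander decompositions -/

/-- A finite multigraph on a set of natural numbers; the list `edges` may hold parallel edges and
self-loops, and the orientation of a listed pair is irrelevant. -/
structure Multigraph where
  verts : Finset ℕ
  edges : List (ℕ × ℕ)

namespace Multigraph

/-- The degree of `x`; as usual for conductance, a self-loop contributes `1`. -/
def degree (Q : Multigraph) (x : ℕ) : ℕ := Q.edges.countP fun p => p.1 = x ∨ p.2 = x

/-- The volume of `S`. -/
def vol (Q : Multigraph) (S : Finset ℕ) : ℕ := ∑ x ∈ S, Q.degree x

/-- The number of edges with exactly one endpoint in `S`. -/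
def cut (Q : Multigraph) (S : Finset ℕ) : ℕ := Q.edges.countP fun p => ¬ (p.1 ∈ S ↔ p.2 ∈ S)

/-- The induced sub-multigraph. -/
def induce (Q : Multigraph) (W : Finset ℕ) : Multigraph where
  verts := Q.verts ∩ W
  edges := Q.edges.filter fun p => p.1 ∈ W ∧ p.2 ∈ W

/-- `Q` is a `ψ`-expander: `cut(S) / min(vol S, vol (V ∖ S)) ≥ ψ` for all `S`, with the denominator
cleared. -/
def IsExpander (Q : Multigraph) (ψ : ℝ) : Prop :=
  ∀ S ⊆ Q.verts, ψ * ((min (Q.vol S) (Q.vol (Q.verts \ S)) : ℕ) : ℝ) ≤ (Q.cut S : ℝ)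

/-- The clusters `{x | c x = i}` form an `(ε, ψ)`-expander decomposition of `Q`: at most `ε |E|`
edges run between clusters, and each cluster induces a `ψ`-expander.  Clusters are numbered by
naturals below the number of vertices. -/
def IsExpanderDecomposition (Q : Multigraph) (ε ψ : ℝ) (c : ℕ → ℕ) : Prop :=
  (∀ x ∈ Q.verts, c x < Q.verts.card) ∧
  ((Q.edges.countP fun p => c p.1 ≠ c p.2 : ℕ) : ℝ) ≤ ε * Q.edges.length ∧
  ∀ i, (Q.induce (Q.verts.filter fun x => c x = i)).IsExpander ψ

/-- The degree of `x`, self-loops not counted. -/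
def properDegree (Q : Multigraph) (x : ℕ) : ℕ :=
  Q.edges.countP fun p => p.1 ≠ p.2 ∧ (p.1 = x ∨ p.2 = x)

/-- The number of edges from `x` to other clusters. -/
def outDegree (Q : Multigraph) (c : ℕ → ℕ) (x : ℕ) : ℕ :=
  Q.edges.countP fun p => c p.1 ≠ c p.2 ∧ (p.1 = x ∨ p.2 = x)

/-- `Q` is the contraction of `G` in which `v` goes to the vertex `f v`, with an arbitrary number of
self-loops at every vertex. -/
def IsContractionBy {n : ℕ} (Q : Multigraph) (G : SimpleGraph (Fin n)) (f : Fin n → ℕ) : Prop :=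
  (∀ x, x ∈ Q.verts ↔ ∃ v, f v = x) ∧
  (∀ p ∈ Q.edges, p.1 ∈ Q.verts ∧ p.2 ∈ Q.verts) ∧
  ∀ x y, x ≠ y → (Q.edges.countP fun p => s(p.1, p.2) = s(x, y)) =
    {e ∈ G.edgeSet | Sym2.map f e = s(x, y)}.ncard

/-- `Q` is a contraction of `G`, possibly with self-loops. -/
def IsContraction {n : ℕ} (Q : Multigraph) (G : SimpleGraph (Fin n)) : Prop :=
  ∃ f, Q.IsContractionBy G f

end Multigraph

/-- A procedure for expander decompositions.  The answer to a call may depend on the multigraph, on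
`ε`, and on the index of the call (so equal queries may be answered differently); it assigns a
cluster number to each vertex. -/
abbrev Procedure := ℕ → Multigraph → ℝ → ℕ → ℕ

/-- On every contraction of `G` and every `ε ∈ (0,1)` the procedure returns an
`(ε, ε/φ)`-expander decomposition. -/
def Procedure.Decomposes {n : ℕ} (O : Procedure) (G : SimpleGraph (Fin n)) (φ : ℝ) : Prop :=
  ∀ (i : ℕ) (Q : Multigraph) (ε : ℝ), Q.IsContraction G → 0 < ε → ε < 1 →
    Q.IsExpanderDecomposition ε (ε / φ) (O i Q ε)

/-! ## A real RAM with calls to a decomposition procedure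

Integer registers, integer arrays and real registers, each numbered by naturals.  Integers can only
be incremented, decremented, copied, compared and used as array indices, so within `t` steps no
integer exceeds the largest input integer by more than `t`.  Real registers support the field
operations and comparison; integers can be converted to reals but not conversely. -/

/-- Machine states; `time` counts the executed steps and `calls` lists the queries made so far. -/
structure State where
  int : ℕ → ℕ
  arr : ℕ → ℕ → ℕ
  real : ℕ → ℝ
  time : ℕ
  calls : List (Multigraph × ℝ)

/-- Basic instructions. -/
inductive Op
  | zero (r : ℕ)
  | inc (r : ℕ)
  | dec (r : ℕ)
  | copy (r r' : ℕ)
  | load (r a i : ℕ)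
  | store (a i r : ℕ)
  | rconst (x k : ℕ)
  | rcast (x r : ℕ)
  | radd (x y z : ℕ)
  | rsub (x y z : ℕ)
  | rmul (x y z : ℕ)
  | rdiv (x y z : ℕ)
  | call (rN rM aSrc aDst xEps aOut : ℕ)

/-- Tests. -/
inductive Test
  | ilt (r r' : ℕ)
  | ieq (r r' : ℕ)
  | rlt (x y : ℕ)

/-- Programs. -/
inductive Program
  | skip
  | op (o : Op)
  | seq (P P' : Program)
  | ite (b : Test) (P P' : Program)
  | loop (b : Test) (P : Program)

/-- One elapsed time step. -/
def State.tick (σ : State) : State := { σ with time := σ.time + 1 }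

/-- The multigraph with vertices `0, …, N - 1` and edges `(a i, b i)`, `i < M`. -/
def Multigraph.ofArrays (N M : ℕ) (a b : ℕ → ℕ) : Multigraph :=
  ⟨Finset.range N, (List.range M).map fun i => (a i, b i)⟩

/-- The effect of a basic instruction.  `call` sends the multigraph written down in the arrays
`aSrc, aDst` (with `int rN` vertices and `int rM` edges, self-loops listed one by one) and the
number `real xEps` to the procedure, and receives the cluster numbers in the array `aOut`. -/
def Op.apply (O : Procedure) (σ : State) : Op → State
  | .zero r => { σ with int := Function.update σ.int r 0 }
  | .inc r => { σ with int := Function.update σ.int r (σ.int r + 1) }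
  | .dec r => { σ with int := Function.update σ.int r (σ.int r - 1) }
  | .copy r r' => { σ with int := Function.update σ.int r (σ.int r') }
  | .load r a i => { σ with int := Function.update σ.int r (σ.arr a (σ.int i)) }
  | .store a i r =>
      { σ with arr := Function.update σ.arr a (Function.update (σ.arr a) (σ.int i) (σ.int r)) }
  | .rconst x k => { σ with real := Function.update σ.real x (k : ℝ) }
  | .rcast x r => { σ with real := Function.update σ.real x (σ.int r : ℝ) }
  | .radd x y z => { σ with real := Function.update σ.real x (σ.real y + σ.real z) }
  | .rsub x y z => { σ with real := Function.update σ.real x (σ.real y - σ.real z) }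
  | .rmul x y z => { σ with real := Function.update σ.real x (σ.real y * σ.real z) }
  | .rdiv x y z => { σ with real := Function.update σ.real x (σ.real y / σ.real z) }
  | .call rN rM aSrc aDst xEps aOut =>
      let Q := Multigraph.ofArrays (σ.int rN) (σ.int rM) (σ.arr aSrc) (σ.arr aDst)
      let answer := O σ.calls.length Q (σ.real xEps)
      { σ with
        arr := Function.update σ.arr aOut
          (fun v => if v < σ.int rN then answer v else σ.arr aOut v)
        calls := σ.calls ++ [(Q, σ.real xEps)] }

/-- The outcome of a test. -/
def Test.holds (σ : State) : Test → Prop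
  | .ilt r r' => σ.int r < σ.int r'
  | .ieq r r' => σ.int r = σ.int r'
  | .rlt x y => σ.real x < σ.real y

/-- `Exec O P σ σ'`: with the procedure `O`, the program `P` started in `σ` halts in `σ'`.  Each
basic instruction (a call included) and each test takes one time step. -/
inductive Exec (O : Procedure) : Program → State → State → Prop
  | skip (σ : State) : Exec O .skip σ σ
  | op (o : Op) (σ : State) : Exec O (.op o) σ (o.apply O σ).tick
  | seq {P P' : Program} {σ σ₁ σ₂ : State} :
      Exec O P σ σ₁ → Exec O P' σ₁ σ₂ → Exec O (.seq P P') σ σ₂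
  | iteTrue {b : Test} {P P' : Program} {σ σ' : State} :
      b.holds σ → Exec O P σ.tick σ' → Exec O (.ite b P P') σ σ'
  | iteFalse {b : Test} {P P' : Program} {σ σ' : State} :
      ¬ b.holds σ → Exec O P' σ.tick σ' → Exec O (.ite b P P') σ σ'
  | loopTrue {b : Test} {P : Program} {σ σ₁ σ₂ : State} :
      b.holds σ → Exec O P σ.tick σ₁ → Exec O (.loop b P) σ₁ σ₂ → Exec O (.loop b P) σ σ₂
  | loopFalse {b : Test} {P : Program} {σ : State} :
      ¬ b.holds σ → Exec O (.loop b P) σ σ.tick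

/-- The list `l` names every edge of `G` exactly once. -/
def Lists {n : ℕ} (l : List (ℕ × ℕ)) (G : SimpleGraph (Fin n)) : Prop :=
  (l.map fun p => s(p.1, p.2)).Nodup ∧
    ∀ e : Sym2 ℕ, e ∈ l.map (fun p => s(p.1, p.2)) ↔ e ∈ Sym2.map Fin.val '' G.edgeSet

/-- The input: `n` and the number of edges in the integer registers `0, 1`, the endpoints of the
edges in the arrays `0, 1`, and `α, β, w, φ` in the real registers `0, 1, 2, 3`; all other memory
is `0`. -/
def input (n : ℕ) (l : List (ℕ × ℕ)) (α β w φ : ℝ) : State where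
  int r := if r = 0 then n else if r = 1 then l.length else 0
  arr a i := if a = 0 then (l.getD i (0, 0)).1 else if a = 1 then (l.getD i (0, 0)).2 else 0
  real x := if x = 0 then α else if x = 1 then β else if x = 2 then w else if x = 3 then φ else 0
  time := 0
  calls := []

/-- The output, in array `2`: the vertices with the same non-zero entry form a super-vertex, and a
vertex with entry `0` is not contracted. -/
def output (n : ℕ) (σ : State) : Setoid (Fin n) where
  r u v := u = v ∨ (σ.arr 2 u ≠ 0 ∧ σ.arr 2 u = σ.arr 2 v)
  iseqv :=
    { refl := fun _ => Or.inl rfl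
      symm := by
        rintro u v (h | ⟨h, h'⟩)
        · exact Or.inl h.symm
        · exact Or.inr ⟨h' ▸ h, h'.symm⟩
      trans := by
        rintro u v x (rfl | ⟨h, h'⟩) (rfl | ⟨k, k'⟩)
        · exact Or.inl rfl
        · exact Or.inr ⟨k, k'⟩
        · exact Or.inr ⟨h, h'⟩
        · exact Or.inr ⟨h, h'.trans k'⟩ }

/-! ## The iterative construction with slack

Super-vertices are described by a labelling `f` of the vertices: `f u = f v` means that `u` and `v`
lie in the same super-vertex. -/

/-- The threshold below which a super-vertex `x` of the contraction `Q` (given by `f` and clustered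
by `c`) is shaved: `max (10 α⁻¹ s |x|) (4 α⁻¹ |E({x}, V ∖ W)|)`, with `W` the cluster of `x`. -/
def threshold {n : ℕ} (α s : ℝ) (f : Fin n → ℕ) (Q : Multigraph) (c : ℕ → ℕ) (x : ℕ) : ℝ :=
  max (10 * α⁻¹ * s * ({v | f v = x}.ncard : ℝ)) (4 * α⁻¹ * (Q.outDegree c x : ℝ))

/-- One round with `ε = 0.01 α β` and `s = √w_j`, leading from `f` to `f'`.  The current contraction
receives `(ε/φ)⁻¹ s` self-loops per original vertex (rounded up at each super-vertex) and is
decomposed by `c`; `kept` are the super-vertices that are not shaved.  A super-vertex whose degree is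
below the threshold has to be shaved, and one whose degree is below `β⁻¹` times the threshold may be
shaved or not.  The kept super-vertices of each cluster are contracted. -/
def Round {n : ℕ} (G : SimpleGraph (Fin n)) (α β φ s : ℝ) (f f' : Fin n → ℕ) : Prop :=
  ∃ (Q : Multigraph) (c : ℕ → ℕ) (kept : Set ℕ),
    Q.IsContractionBy G f ∧
    (∀ x ∈ Q.verts, (Q.edges.countP fun p => p.1 = x ∧ p.2 = x) =
      ⌈(0.01 * (α * β) / φ)⁻¹ * s * ({v | f v = x}.ncard : ℝ)⌉₊) ∧
    Q.IsExpanderDecomposition (0.01 * (α * β)) (0.01 * (α * β) / φ) c ∧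
    (∀ x ∈ Q.verts, (Q.properDegree x : ℝ) < threshold α s f Q c x → x ∉ kept) ∧
    (∀ x ∈ Q.verts, x ∉ kept → β * (Q.properDegree x : ℝ) < threshold α s f Q c x) ∧
    ∀ u v, f' u = f' v ↔ (f u = f v ∨ (f u ∈ kept ∧ f v ∈ kept ∧ c (f u) = c (f v)))

/-- `Rounds G α β φ w s₀ t f`: starting from the uncontracted graph, `t` rounds can lead to `f`.
Round `j` uses `√w_j = s₀ / 2 ^ j` and is carried out only if `w_j ≥ w`. -/
inductive Rounds {n : ℕ} (G : SimpleGraph (Fin n)) (α β φ w s₀ : ℝ) : ℕ → (Fin n → ℕ) → Prop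
  | start : Rounds G α β φ w s₀ 0 Fin.val
  | next {t : ℕ} {f f' : Fin n → ℕ} :
      Rounds G α β φ w s₀ t f → w ≤ (s₀ / 2 ^ (t + 1)) ^ 2 →
      Round G α β φ (s₀ / 2 ^ (t + 1)) f f' → Rounds G α β φ w s₀ (t + 1) f'

/-- `f` is a possible result, after `t` rounds, of the complete iterative construction with slack
`β`, run while `w_j ≥ w`.  The initial value `s₀` may be `m / n` or smaller, down to
`α β m / (100 φ n)`. -/
def IsConstructed {n : ℕ} (G : SimpleGraph (Fin n)) (α β φ w : ℝ) (t : ℕ) (f : Fin n → ℕ) : Prop :=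
  ∃ s₀ : ℝ, α * β * (G.edgeSet.ncard : ℝ) / (100 * φ * n) ≤ s₀ ∧
    s₀ ≤ (G.edgeSet.ncard : ℝ) / n ∧
    Rounds G α β φ w s₀ t f ∧ (s₀ / 2 ^ (t + 1)) ^ 2 < w

end FriendlyCut

end

noncomputable section
open scoped Classical
namespace FriendlyCut

/-! ### Edge counts of a contraction, expressed through the original graph -/

section Counting

variable {n : ℕ} {G : SimpleGraph (Fin n)}

/-! Write `s` for the current `√w_j`, `d(x)` for the degree of a super-vertex, `out(x)` for its
number of edges leaving its cluster, and `ψ = ε/φ`. The argument has three independent parts.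

Preservation (`Round.preserves`). Let `S` be a cut of at most `2 s²` edges that splits no current
super-vertex. Inside a cluster, expansion bounds the volume of the smaller side by `2 s²/ψ`. Each
original vertex brings about `s/ψ` self-loops of volume, so that side holds at most `2 s` original
vertices. A vertex there has at most `2 s` neighbours in its own side and cluster, because `G` is
simple; all its other edges cross `S` or leave the cluster. Friendliness forbids nearly all edges
from crossing, so a super-vertex on the small side has degree below its threshold and is shaved.
Hence the kept super-vertices of a cluster lie on one side, and merging them does not split `S`.
Updates cost nothing extra: a cut that is friendly in the updated graph is friendly in `G` up to an
additive `2 s` on every vertex set (`nearlyFriendly_of_updateGraph`), and its size in `G` is at most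
`w + √w ≤ 2 s²`. Since updating commutes with contracting (`contract_update`), robustness and the
sparsifier property are the same statement about the partition.

Size (`Round.survivors_le`). An edge that survives a round runs between clusters or touches a shaved
super-vertex. The decomposition bounds the first kind; the thresholds, summed over the shaved
super-vertices, bound the second by `10 s n` plus a multiple of the first, up to the factor
`1/(αβ)`. So the number of edges drops to a small fraction plus a term linear in `φ s n / (αβ)`, and
this keeps it proportional to `φ s n / (αβ)` while `s` is halved. The estimate needs `φ ≥ 1`, which
the mere existence of the procedure forces as soon as `G` has an edge (`one_le_of_decomposes`). When
the construction stops, `s` is within a factor 2 of `√w`. Since `s ≥ 1` in every round and initially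
`s₀ ≤ m/n ≤ n`, the number of rounds is logarithmic.

Time (`LoopHead.step`). The program takes the smallest admissible `s₀`. With it, both the surviving
edges and the self-loops of a round number `O(m/2^j)`, as does `n` whenever the round is carried
out, so linear-time rounds add up to `O(m)`. The program shaves exactly the super-vertices that must
be shaved, hence its output is one of the possible results and inherits the first two parts. -/

theorem Multigraph.IsContractionBy.countP_eq {Q : Multigraph} {f : Fin n → ℕ}
    (h : Q.IsContractionBy G f) (p : Sym2 ℕ → Prop) (hp : ∀ x, ¬ p s(x, x)) :
    (Q.edges.countP fun q => p s(q.1, q.2)) = {e ∈ G.edgeSet | p (Sym2.map f e)}.ncard := by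
  -- A contraction fixes multiplicities only off the diagonal; this suffices because `p` rejects
  -- diagonal pairs.
  have key : (Multiset.map (fun q : ℕ × ℕ => s(q.1, q.2)) (Q.edges : Multiset (ℕ × ℕ))).filter p =
      (G.edgeFinset.val.map (Sym2.map f)).filter p := by
    ext a
    by_cases ha : p a
    · rw [Multiset.count_filter_of_pos ha, Multiset.count_filter_of_pos ha]
      induction a with
      | _ x y =>
        have hxy : x ≠ y := by rintro rfl; exact hp _ ha
        have := h.2.2 x y hxy
        rw [Multiset.count_map, Multiset.count_map]
        have e1 : (Multiset.filter (fun q : ℕ × ℕ => s(x, y) = s(q.1, q.2))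
            (Q.edges : Multiset (ℕ × ℕ))).card = Q.edges.countP fun q => s(q.1, q.2) = s(x, y) := by
          rw [← Multiset.countP_eq_card_filter, Multiset.coe_countP]
          exact List.countP_congr fun q _ => by rw [decide_eq_true_eq, decide_eq_true_eq, eq_comm]
        rw [e1, this, ← Finset.filter_val, Finset.card_val, ← Set.ncard_coe_finset]
        congr 1
        ext e
        simp [@eq_comm _ s(x, y)]
    · rw [Multiset.count_filter_of_neg ha, Multiset.count_filter_of_neg ha]
  have := congrArg Multiset.card key
  rw [← Multiset.countP_eq_card_filter, ← Multiset.countP_eq_card_filter, Multiset.countP_map,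
    Multiset.countP_map, ← Multiset.countP_eq_card_filter, Multiset.coe_countP] at this
  rw [this, ← Finset.filter_val, Finset.card_val, ← Set.ncard_coe_finset]
  congr 1
  ext e
  simp

/-- Since `p` rejects diagonal pairs, a counted edge has exactly one end in the class `x`. Orienting
it away from that end gives a bijection with the pairs counted on the right. -/
theorem ncard_incident_eq_sum (f : Fin n → ℕ) (p : Sym2 ℕ → Prop) (hp : ∀ x, ¬ p s(x, x)) (x : ℕ) :
    {e ∈ G.edgeSet | p (Sym2.map f e) ∧ x ∈ Sym2.map f e}.ncard =
      ∑ v with f v = x, (Finset.univ.filter fun u => G.Adj v u ∧ p s(f v, f u)).card := by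
  rw [← Finset.card_sigma]
  have : {e ∈ G.edgeSet | p (Sym2.map f e) ∧ x ∈ Sym2.map f e} =
      ↑(G.edgeFinset.filter fun e => p (Sym2.map f e) ∧ x ∈ Sym2.map f e) := by ext; simp
  rw [this, Set.ncard_coe_finset]
  symm
  refine Finset.card_bij (fun a _ => s(a.1, a.2)) ?_ ?_ ?_
  · rintro ⟨v, u⟩ h
    simp only [Finset.mem_sigma, Finset.mem_filter, Finset.mem_univ, true_and] at h
    simp only [Finset.mem_filter, SimpleGraph.mem_edgeFinset, SimpleGraph.mem_edgeSet,
      Sym2.map_mk, Sym2.mem_iff]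
    exact ⟨h.2.1, h.2.2, Or.inl h.1.symm⟩
  · rintro ⟨v, u⟩ h ⟨v', u'⟩ h' e
    simp only [Finset.mem_sigma, Finset.mem_filter, Finset.mem_univ, true_and] at h h'
    rcases Sym2.eq_iff.1 e with ⟨e1, e2⟩ | ⟨e1, e2⟩
    · simp only at e1 e2; subst e1 e2; rfl
    · simp only at e1 e2
      subst e1 e2
      exact absurd h.2.2 (by rw [h.1, h'.1]; exact hp _)
  · intro e he
    simp only [Finset.mem_filter, SimpleGraph.mem_edgeFinset] at he
    obtain ⟨h1, h2, h3⟩ := he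
    rw [Sym2.mem_map] at h3
    obtain ⟨v, hv, hx⟩ := h3
    obtain ⟨u, rfl⟩ := Sym2.mem_iff_exists.1 hv
    exact ⟨⟨v, u⟩, by simpa [hx] using ⟨h1, by simpa [hx] using h2⟩, rfl⟩

/-- The number of edges incident to `v` whose other end satisfies `p`. -/
def nbr (G : SimpleGraph (Fin n)) (p : Fin n → Prop) (v : Fin n) : ℕ :=
  (Finset.univ.filter fun u => G.Adj v u ∧ p u).card

theorem deg_eq_nbr (v : Fin n) : deg G v = nbr G (fun _ => True) v := by
  rw [deg, nbr, ← Set.ncard_coe_finset]; congr 1; ext; simp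

theorem cross_eq_nbr (S : Set (Fin n)) (v : Fin n) :
    cross G S v = nbr G (fun u => ¬ (u ∈ S ↔ v ∈ S)) v := by
  rw [cross, nbr, ← Set.ncard_coe_finset]; congr 1; ext; simp

theorem nbr_le_deg (p : Fin n → Prop) (v : Fin n) : nbr G p v ≤ deg G v := by
  rw [deg_eq_nbr]
  exact Finset.card_le_card fun u => by simp +contextual

/-- The number of edges of `G` between different classes of `f`. -/
def survivors (G : SimpleGraph (Fin n)) (f : Fin n → ℕ) : ℕ :=
  (contract G (Setoid.ker f)).edges.ncard

theorem survives_ker_iff (f : Fin n → ℕ) (e : Sym2 (Fin n)) :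
    Survives (Setoid.ker f) e ↔ ¬ (Sym2.map f e).IsDiag := by
  induction e with
  | _ u v =>
    simp only [Survives, Setoid.ker_def, Sym2.map_mk, Sym2.mk_isDiag_iff]
    constructor
    · rintro ⟨a, b, e, h⟩
      rcases Sym2.eq_iff.1 e with ⟨rfl, rfl⟩ | ⟨rfl, rfl⟩
      exacts [h, Ne.symm h]
    · exact fun h => ⟨u, v, rfl, h⟩

variable {Q : Multigraph} {f : Fin n → ℕ}

theorem Multigraph.IsContractionBy.countP_proper (h : Q.IsContractionBy G f) :
    (Q.edges.countP fun q => q.1 ≠ q.2) = survivors G f := by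
  have := h.countP_eq (fun e => ¬ e.IsDiag) (by simp)
  rw [survivors, contract]
  simp only [survives_ker_iff]
  rw [← this]
  exact List.countP_congr fun q _ => by simp

theorem Multigraph.IsContractionBy.properDegree_eq (h : Q.IsContractionBy G f) (x : ℕ) :
    Q.properDegree x = ∑ v with f v = x, nbr G (fun u => f v ≠ f u) v := by
  have := h.countP_eq (fun e => ¬ e.IsDiag ∧ x ∈ e) (by simp)
  rw [ncard_incident_eq_sum f (fun e => ¬ e.IsDiag) (by simp)] at this
  rw [Multigraph.properDegree]
  refine Eq.trans (List.countP_congr fun q _ => ?_) (this.trans ?_)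
  · simp [@eq_comm _ x]
  · exact Finset.sum_congr rfl fun v _ => by simp [nbr]

/-- The ends of the edge lie in different clusters. -/
def InterCluster (c : ℕ → ℕ) (e : Sym2 ℕ) : Prop := ¬ (Sym2.map c e).IsDiag

theorem Multigraph.IsContractionBy.outDegree_eq (h : Q.IsContractionBy G f) (c : ℕ → ℕ) (x : ℕ) :
    Q.outDegree c x = ∑ v with f v = x, nbr G (fun u => c (f v) ≠ c (f u)) v := by
  have := h.countP_eq (fun e => InterCluster c e ∧ x ∈ e) (by simp [InterCluster])
  rw [ncard_incident_eq_sum f (InterCluster c) (by simp [InterCluster])] at this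
  rw [Multigraph.outDegree]
  refine Eq.trans (List.countP_congr fun q _ => ?_) (this.trans ?_)
  · simp [@eq_comm _ x, InterCluster]
  · exact Finset.sum_congr rfl fun v _ => by simp [nbr, InterCluster]

theorem List.countP_le_add_sum {ι γ : Type*} (l : List γ) (p r : γ → Prop) (X : Finset ι)
    (t : ι → γ → Prop) (h : ∀ q ∈ l, p q → r q ∨ ∃ x ∈ X, t x q) :
    (l.countP fun q => p q) ≤ (l.countP fun q => r q) + ∑ x ∈ X, l.countP fun q => t x q := by
  induction l with
  | nil => simp
  | cons a l ih =>
    have ih := ih fun q hq => h q (List.mem_cons_of_mem _ hq)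
    simp only [List.countP_cons, Finset.sum_add_distrib]
    have : (if decide (p a) = true then 1 else 0) ≤ (if decide (r a) = true then 1 else 0) +
        ∑ x ∈ X, if decide (t x a) = true then 1 else 0 := by
      by_cases hp : p a
      · rcases h a List.mem_cons_self hp with hr | ⟨x, hx, ht⟩
        · simp [hp, hr]
        · have := Finset.single_le_sum (f := fun x => if decide (t x a) = true then 1 else 0)
            (fun _ _ => Nat.zero_le _) hx
          simp only [ht, decide_true, if_true] at this
          simp only [hp, decide_true, if_true]
          omega
      · simp [hp]
    omega

theorem List.sum_countP_le {γ : Type*} (l : List γ) (r : γ → Prop) (X : Finset ℕ)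
    (a b : γ → ℕ) :
    (∑ x ∈ X, l.countP fun q => r q ∧ (a q = x ∨ b q = x)) ≤ 2 * l.countP fun q => r q := by
  induction l with
  | nil => simp
  | cons q l ih =>
    simp only [List.countP_cons, Finset.sum_add_distrib]
    have : (∑ x ∈ X, if decide (r q ∧ (a q = x ∨ b q = x)) = true then 1 else 0) ≤
        2 * if decide (r q) = true then 1 else 0 := by
      by_cases hr : r q
      · simp only [hr, true_and, decide_eq_true_eq, if_true, Finset.sum_boole]
        calc _ ≤ ({a q, b q} : Finset ℕ).card := by
              simp only [Nat.cast_id]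
              refine Finset.card_le_card fun x => ?_
              simp only [Finset.mem_filter, Finset.mem_insert, Finset.mem_singleton]
              rintro ⟨-, rfl | rfl⟩ <;> simp
          _ ≤ 2 := Finset.card_le_two
      · simp [hr]
    omega

theorem List.sum_countP_eq {γ : Type*} (l : List γ) (r : ℕ → γ → Prop) (p : γ → Prop) (X : Finset ℕ)
    (g : γ → ℕ) (hX : ∀ q ∈ l, g q ∈ X) (hr : ∀ q ∈ l, ∀ x, r x q ↔ (p q ∧ g q = x)) :
    (∑ x ∈ X, l.countP fun q => r x q) = l.countP fun q => p q := by
  induction l with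
  | nil => simp
  | cons q l ih =>
    have ih := ih (fun q hq => hX q (List.mem_cons_of_mem _ hq))
      (fun q hq => hr q (List.mem_cons_of_mem _ hq))
    simp only [List.countP_cons, Finset.sum_add_distrib, ih]
    congr 1
    simp only [hr q List.mem_cons_self]
    by_cases hp : p q
    · simp [hp, hX q List.mem_cons_self]
    · simp [hp]

/-- The size `|x|` of a super-vertex. -/
def size (f : Fin n → ℕ) (x : ℕ) : ℕ := (Finset.univ.filter fun v => f v = x).card

theorem ncard_fiber (f : Fin n → ℕ) (x : ℕ) : {v | f v = x}.ncard = size f x := by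
  rw [size, ← Set.ncard_coe_finset]; congr 1; ext; simp

theorem Multigraph.IsContractionBy.verts_eq (h : Q.IsContractionBy G f) :
    Q.verts = Finset.univ.image f := by
  ext x; simp [h.1]

theorem Multigraph.IsContractionBy.sum_size (h : Q.IsContractionBy G f) :
    ∑ x ∈ Q.verts, size f x = n := by
  have := Finset.card_eq_sum_card_fiberwise (s := (Finset.univ : Finset (Fin n))) (t := Q.verts)
    (f := f) (fun v _ => (h.1 _).2 ⟨v, rfl⟩)
  rw [Finset.card_univ, Fintype.card_fin] at this
  exact this.symm

theorem Multigraph.IsContractionBy.card_verts_le (h : Q.IsContractionBy G f) :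
    Q.verts.card ≤ n := by
  rw [h.verts_eq]
  exact Finset.card_image_le.trans (by simp)

theorem Multigraph.IsContractionBy.length_edges (h : Q.IsContractionBy G f) :
    Q.edges.length = survivors G f + ∑ x ∈ Q.verts, Q.edges.countP fun p => p.1 = x ∧ p.2 = x := by
  rw [← h.countP_proper, List.length_eq_countP_add_countP (fun q : ℕ × ℕ => decide (q.1 ≠ q.2))]
  congr 1
  have := List.sum_countP_eq Q.edges (fun x q => q.1 = x ∧ q.2 = x) (fun q => q.1 = q.2) Q.verts
    (fun q => q.1) (fun q hq => (h.2.1 q hq).1)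
    (by rintro q - x; constructor <;> rintro ⟨h1, h2⟩ <;> simp_all)
  refine Eq.trans (List.countP_congr fun q _ => ?_)
    (this.symm.trans (Finset.sum_congr rfl fun x _ => List.countP_congr fun q _ => ?_)) <;> simp

end Counting

/-! ### The number of edges after one round, and why `φ ≥ 1` -/

section EdgeBound

variable {n : ℕ} {G : SimpleGraph (Fin n)}

/-- If both ends of an edge are kept and share a cluster, they are merged and the edge disappears.
So every survivor runs between clusters or can be charged to a shaved end. -/
theorem survivors_le_of_merge {Q : Multigraph} {c : ℕ → ℕ} {kept : Set ℕ} {f f' : Fin n → ℕ}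
    (h : Q.IsContractionBy G f)
    (hf : ∀ u v, f' u = f' v ↔ (f u = f v ∨ (f u ∈ kept ∧ f v ∈ kept ∧ c (f u) = c (f v)))) :
    survivors G f' ≤ (Q.edges.countP fun p => c p.1 ≠ c p.2) +
      ∑ x ∈ Q.verts with x ∉ kept, Q.properDegree x := by
  set p : Sym2 ℕ → Prop := fun e => ∃ a b, e = s(a, b) ∧ a ≠ b ∧ ¬ (a ∈ kept ∧ b ∈ kept ∧ c a = c b)
    with hp
  have h1 := h.countP_eq p (by
    rintro x ⟨a, b, e, hab, -⟩
    rcases Sym2.eq_iff.1 e with ⟨rfl, rfl⟩ | ⟨rfl, rfl⟩ <;> exact hab rfl)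
  have h2 : {e ∈ G.edgeSet | p (Sym2.map f e)}.ncard = survivors G f' := by
    rw [survivors, contract]
    congr 1
    ext e
    simp only [Set.mem_ofPred_eq, survives_ker_iff]
    refine and_congr_right fun _ => ?_
    induction e with
    | _ u v =>
      simp only [Sym2.map_mk, Sym2.mk_isDiag_iff, hf, not_or, hp]
      constructor
      · rintro ⟨a, b, e, h1, h2⟩
        rcases Sym2.eq_iff.1 e with ⟨e1, e2⟩ | ⟨e1, e2⟩
        · rw [e1, e2]; exact ⟨h1, h2⟩
        · rw [e1, e2]; exact ⟨h1.symm, fun h => h2 ⟨h.2.1, h.1, h.2.2.symm⟩⟩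
      · exact fun h => ⟨_, _, rfl, h⟩
  rw [← h2, ← h1]
  have h3 := List.countP_le_add_sum Q.edges (fun q => p s(q.1, q.2)) (fun q => c q.1 ≠ c q.2)
    (Q.verts.filter fun x => x ∉ kept) (fun x q => q.1 ≠ q.2 ∧ (q.1 = x ∨ q.2 = x)) (by
      rintro ⟨a, b⟩ hq ⟨a', b', e, hab, hk⟩
      have hv := h.2.1 _ hq
      have hab' : a ≠ b ∧ ¬ (a ∈ kept ∧ b ∈ kept ∧ c a = c b) := by
        rcases Sym2.eq_iff.1 e with ⟨rfl, rfl⟩ | ⟨rfl, rfl⟩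
        · exact ⟨hab, hk⟩
        · exact ⟨hab.symm, fun h => hk ⟨h.2.1, h.1, h.2.2.symm⟩⟩
      by_cases hc : c a = c b
      · right
        by_cases ha : a ∈ kept
        · have hb : b ∉ kept := fun hb => hab'.2 ⟨ha, hb, hc⟩
          exact ⟨b, by simp [hb, hv.2], hab'.1, Or.inr rfl⟩
        · exact ⟨a, by simp [ha, hv.1], hab'.1, Or.inl rfl⟩
      · exact Or.inl hc)
  refine h3.trans (le_of_eq ?_)
  congr 1
  · exact List.countP_congr fun q _ => by simp
  · exact Finset.sum_congr rfl fun x _ => List.countP_congr fun q _ => by simp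

theorem sum_outDegree_le (Q : Multigraph) (c : ℕ → ℕ) (X : Finset ℕ) :
    ∑ x ∈ X, Q.outDegree c x ≤ 2 * Q.edges.countP fun p => c p.1 ≠ c p.2 := by
  have := List.sum_countP_le Q.edges (fun q => c q.1 ≠ c q.2) X (fun q => q.1) (fun q => q.2)
  refine (le_of_eq ?_).trans (this.trans (le_of_eq ?_))
  · exact Finset.sum_congr rfl fun x _ => List.countP_congr fun q _ => by simp
  · congr 1; exact List.countP_congr fun q _ => by simp

theorem sum_ceil_size_le {Q : Multigraph} {f : Fin n → ℕ} (h : Q.IsContractionBy G f) {a : ℝ}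
    (ha : 0 ≤ a) : ((∑ x ∈ Q.verts, ⌈a * (size f x : ℝ)⌉₊ : ℕ) : ℝ) ≤ a * n + n := by
  push_cast
  calc ∑ x ∈ Q.verts, (⌈a * (size f x : ℝ)⌉₊ : ℝ) ≤ ∑ x ∈ Q.verts, (a * (size f x : ℝ) + 1) :=
        Finset.sum_le_sum fun x _ => (Nat.ceil_lt_add_one (by positivity)).le
    _ = a * n + Q.verts.card := by
        rw [Finset.sum_add_distrib, ← Finset.mul_sum, ← Nat.cast_sum, h.sum_size]; simp
    _ ≤ _ := by gcongr; exact_mod_cast h.card_verts_le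

/-- Let `I` be the number of inter-cluster edges. Summing `αβ d(x) ≤ 10 s|x| + 4 out(x)` over the
shaved `x`, with `∑ out(x) ≤ 2I`, gives `αβ · survivors G f' ≤ 9 I + 10 s n`. The decomposition
gives `I ≤ ε · survivors G f + 2 φ s n`, whence `0.09 = 9 · 0.01` and `28 = 18 + 10`. -/
theorem Round.survivors_le {α β φ s : ℝ} {f f' : Fin n → ℕ} (hα : 0 < α) (hα' : α < 1 / 4)
    (hβ : 0 < β) (hβ' : β < 1) (hφ : 1 ≤ φ) (hs : 1 ≤ s) (h : Round G α β φ s f f') :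
    α * β * survivors G f' ≤ 0.09 * (α * β * survivors G f) + 28 * (φ * s * n) := by
  obtain ⟨Q, c, kept, hQ, hloop, hdec, -, hshave, hf⟩ := h
  simp only [ncard_fiber] at hloop
  have hαβ : 0 < α * β := by positivity
  have hαβ1 : α * β < 1 / 4 := by nlinarith
  set ε : ℝ := 0.01 * (α * β) with hε
  have hε0 : 0 < ε := by positivity
  set I : ℕ := Q.edges.countP fun p => c p.1 ≠ c p.2 with hI
  have hI1 := hdec.2.1
  have hlen := hQ.length_edges
  rw [Finset.sum_congr rfl hloop] at hlen
  have hL := sum_ceil_size_le hQ (a := (ε / φ)⁻¹ * s) (by positivity)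
  set L : ℕ := ∑ x ∈ Q.verts, ⌈(ε / φ)⁻¹ * s * (size f x : ℝ)⌉₊
  have hm := survivors_le_of_merge hQ hf
  rw [← hI] at hm
  set X := Q.verts.filter fun x => x ∉ kept
  have hout := sum_outDegree_le Q c X
  have hsz : ∑ x ∈ X, size f x ≤ n := by
    conv_rhs => rw [← hQ.sum_size]
    exact Finset.sum_le_sum_of_subset (Finset.filter_subset _ _)
  have hP : α * β * ((∑ x ∈ X, Q.properDegree x : ℕ) : ℝ) ≤
      10 * s * ((∑ x ∈ X, size f x : ℕ) : ℝ) + 4 * ((∑ x ∈ X, Q.outDegree c x : ℕ) : ℝ) := by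
    push_cast
    rw [Finset.mul_sum, Finset.mul_sum, Finset.mul_sum, ← Finset.sum_add_distrib]
    refine Finset.sum_le_sum fun x hx => ?_
    have hx := Finset.mem_filter.1 hx
    have h1 := hshave x hx.1 hx.2
    rw [threshold, ncard_fiber] at h1
    have h2 : β * (Q.properDegree x : ℝ) ≤
        10 * α⁻¹ * s * (size f x : ℝ) + 4 * α⁻¹ * (Q.outDegree c x : ℝ) :=
      h1.le.trans (max_le_add_of_nonneg (by positivity) (by positivity))
    calc α * β * (Q.properDegree x : ℝ) = α * (β * (Q.properDegree x : ℝ)) := by ring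
      _ ≤ α * (10 * α⁻¹ * s * (size f x : ℝ) + 4 * α⁻¹ * (Q.outDegree c x : ℝ)) := by gcongr
      _ = _ := by field_simp
  have hm' : (survivors G f' : ℝ) ≤ I + ((∑ x ∈ X, Q.properDegree x : ℕ) : ℝ) := by exact_mod_cast hm
  have hout' : ((∑ x ∈ X, Q.outDegree c x : ℕ) : ℝ) ≤ 2 * I := by exact_mod_cast hout
  have hsz' : ((∑ x ∈ X, size f x : ℕ) : ℝ) ≤ n := by exact_mod_cast hsz
  have hI2 : (I : ℝ) ≤ ε * survivors G f + 2 * (φ * s * n) := by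
    have e1 : (I : ℝ) ≤ ε * (survivors G f + L) := by
      refine hI1.trans (le_of_eq ?_)
      rw [hlen]; push_cast; ring
    have e2 : ε * L ≤ ε * ((ε / φ)⁻¹ * s * n + n) := by gcongr
    -- The self-loops count among the edges of which an `ε`-fraction may be cut; they contribute `φ
    -- s n`, and rounding up at each super-vertex contributes at most `ε n`.
    have e3 : ε * ((ε / φ)⁻¹ * s * n + n) = φ * s * n + ε * n := by
      have : φ ≠ 0 := by positivity
      field_simp
    have e4 : ε * n ≤ φ * s * n := by
      gcongr
      nlinarith
    nlinarith
  have e5 : s * n ≤ φ * s * n := by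
    have : 0 ≤ s * (n : ℝ) := by positivity
    nlinarith
  have e6 : 10 * s * ((∑ x ∈ X, size f x : ℕ) : ℝ) ≤ 10 * (s * n) := by
    rw [mul_assoc]; gcongr
  have e7 : α * β * (I : ℝ) ≤ I := by nlinarith [Nat.cast_nonneg (α := ℝ) I]
  have e8 : α * β * (survivors G f' : ℝ) ≤ α * β * (I + ((∑ x ∈ X, Q.properDegree x : ℕ) : ℝ)) := by
    gcongr
  have e9 : ε * survivors G f = 0.01 * (α * β * survivors G f) := by rw [hε]; ring
  linarith

theorem Lists.isContractionBy {l : List (ℕ × ℕ)} (hl : Lists l G) :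
    Multigraph.IsContractionBy ⟨Finset.range n, l⟩ G Fin.val := by
  refine ⟨fun x => ?_, fun p hp => ?_, fun x y _ => ?_⟩
  · simp only [Finset.mem_range]
    exact ⟨fun h => ⟨⟨x, h⟩, rfl⟩, by rintro ⟨v, rfl⟩; exact v.2⟩
  · obtain ⟨e, -, he⟩ := (hl.2 s(p.1, p.2)).1 (List.mem_map.2 ⟨p, hp, rfl⟩)
    have : ∀ x ∈ s(p.1, p.2), x < n := by
      intro x hx
      rw [← he, Sym2.mem_map] at hx
      obtain ⟨v, -, rfl⟩ := hx
      exact v.2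
    simpa using this
  · have h1 : (l.countP fun p => s(p.1, p.2) = s(x, y)) =
        (l.map fun p => s(p.1, p.2)).count s(x, y) := by
      rw [List.count, List.countP_map]
      exact List.countP_congr fun q _ => by simp
    have hinj : Function.Injective (Sym2.map (Fin.val : Fin n → ℕ)) :=
      Sym2.map.injective Fin.val_injective
    change (l.countP fun p => s(p.1, p.2) = s(x, y)) = _
    rw [h1]
    by_cases h : s(x, y) ∈ l.map fun p => s(p.1, p.2)
    · rw [List.count_eq_one_of_mem hl.1 h]
      obtain ⟨e, he, hxy⟩ := (hl.2 _).1 h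
      symm
      rw [Set.ncard_eq_one]
      refine ⟨e, Set.eq_singleton_iff_unique_mem.2 ⟨⟨he, hxy⟩, fun e' he' => ?_⟩⟩
      exact hinj (he'.2.trans hxy.symm)
    · rw [List.count_eq_zero_of_not_mem h]
      symm
      rw [Set.ncard_eq_zero]
      rw [Set.eq_empty_iff_forall_notMem]
      rintro e ⟨he, hxy⟩
      exact h ((hl.2 _).2 ⟨e, he, hxy⟩)

theorem Lists.length_eq {l : List (ℕ × ℕ)} (hl : Lists l G) : l.length = G.edgeSet.ncard := by
  have hinj : Function.Injective (Sym2.map (Fin.val : Fin n → ℕ)) :=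
      Sym2.map.injective Fin.val_injective
  rw [← Set.ncard_image_of_injective _ hinj, ← List.length_map (fun p : ℕ × ℕ => s(p.1, p.2)),
    ← List.toFinset_card_of_nodup hl.1, ← Set.ncard_coe_finset]
  congr 1
  ext e
  rw [← hl.2 e]
  simp

theorem Lists.ne {l : List (ℕ × ℕ)} (hl : Lists l G) {p : ℕ × ℕ} (hp : p ∈ l) : p.1 ≠ p.2 := by
  obtain ⟨e, he, hpe⟩ := (hl.2 s(p.1, p.2)).1 (List.mem_map.2 ⟨p, hp, rfl⟩)
  induction e with
  | _ u v =>
    have huv : u ≠ v := (G.mem_edgeSet.1 he).ne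
    rw [Sym2.map_mk] at hpe
    rcases Sym2.eq_iff.1 hpe with ⟨h1, h2⟩ | ⟨h1, h2⟩ <;> rw [← h1, ← h2]
    · exact fun h => huv (Fin.ext h)
    · exact fun h => huv (Fin.ext h.symm)

theorem exists_lists (G : SimpleGraph (Fin n)) : ∃ l, Lists l G := by
  have h1 : ∀ e : Sym2 (Fin n), s(e.out.1.val, e.out.2.val) = Sym2.map Fin.val e := fun e => by
    conv_rhs => rw [← Quot.out_eq e]
    rfl
  refine ⟨G.edgeFinset.toList.map fun e => (e.out.1.val, e.out.2.val), ?_⟩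
  have h2 : (G.edgeFinset.toList.map fun e => (e.out.1.val, e.out.2.val)).map
      (fun p => s(p.1, p.2)) = G.edgeFinset.toList.map (Sym2.map Fin.val) := by
    rw [List.map_map]
    exact List.map_congr_left fun e _ => h1 e
  refine ⟨?_, fun e => ?_⟩
  · rw [h2]
    exact (Finset.nodup_toList _).map (Sym2.map.injective Fin.val_injective)
  · rw [h2]
    simp

theorem Multigraph.cut_le_vol (Q : Multigraph) (S : Finset ℕ)
    (hQ : ∀ p ∈ Q.edges, p.1 ∈ Q.verts ∧ p.2 ∈ Q.verts) :
    Q.cut S ≤ Q.vol S ∧ Q.cut S ≤ Q.vol (Q.verts \ S) := by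
  constructor
  · have := List.countP_le_add_sum Q.edges (fun p => ¬ (p.1 ∈ S ↔ p.2 ∈ S)) (fun _ => False) S
      (fun x p => p.1 = x ∨ p.2 = x) (fun p _ h => by
        by_cases h1 : p.1 ∈ S
        · exact Or.inr ⟨_, h1, Or.inl rfl⟩
        · exact Or.inr ⟨p.2, by tauto, Or.inr rfl⟩)
    simpa [Multigraph.cut, Multigraph.vol, Multigraph.degree] using this
  · have := List.countP_le_add_sum Q.edges (fun p => ¬ (p.1 ∈ S ↔ p.2 ∈ S)) (fun _ => False)
      (Q.verts \ S) (fun x p => p.1 = x ∨ p.2 = x) (fun p hp h => by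
        by_cases h1 : p.1 ∈ S
        · exact Or.inr ⟨p.2, Finset.mem_sdiff.2 ⟨(hQ p hp).2, by tauto⟩, Or.inr rfl⟩
        · exact Or.inr ⟨p.1, Finset.mem_sdiff.2 ⟨(hQ p hp).1, h1⟩, Or.inl rfl⟩)
    simpa [Multigraph.cut, Multigraph.vol, Multigraph.degree] using this

theorem Multigraph.one_le_vol {Q : Multigraph} {S : Finset ℕ} {p : ℕ × ℕ} (hp : p ∈ Q.edges)
    {x : ℕ} (hx : x ∈ S) (hpx : p.1 = x ∨ p.2 = x) : 1 ≤ Q.vol S := by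
  have h1 : 0 < Q.degree x := List.countP_pos_iff.2 ⟨p, hp, by simpa using hpx⟩
  exact h1.trans_le (Finset.single_le_sum (f := Q.degree) (fun _ _ => Nat.zero_le _) hx)

/-- If `φ < 1`, a query on `G` itself can demand expansion above 1. No cluster can then contain an
edge, since the cut around one of its ends never exceeds the volume of either side. So all edges
would run between clusters, more than an `ε`-fraction. -/
theorem one_le_of_decomposes {φ : ℝ} {O : Procedure} (hφ : 0 < φ) (hO : O.Decomposes G φ)
    (hm : 0 < G.edgeSet.ncard) : 1 ≤ φ := by
  by_contra! hφ1
  obtain ⟨l, hl⟩ := exists_lists G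
  -- Being below 1 makes the query legal; being above `φ` makes `ε/φ > 1`.
  obtain ⟨ε, h1, h2⟩ := exists_between hφ1
  have hQ := hl.isContractionBy
  obtain ⟨-, hcut, hexp⟩ := hO 0 _ ε ⟨_, hQ⟩ (hφ.trans h1) h2
  rw [← hl.length_eq] at hm
  set Q : Multigraph := ⟨Finset.range n, l⟩
  set c := O 0 Q ε
  have hlen : (Q.edges.countP fun p => c p.1 ≠ c p.2) = Q.edges.length := by
    rw [List.countP_eq_length]
    intro p hp
    rw [decide_eq_true_eq]
    intro hc
    have hv := hQ.2.1 p hp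
    set R := Q.induce (Q.verts.filter fun x => c x = c p.1) with hR
    have hpR : p ∈ R.edges := by
      simp [hR, Multigraph.induce, hp, hv.1, hv.2, hc]
    have hRv : ∀ q ∈ R.edges, q.1 ∈ R.verts ∧ q.2 ∈ R.verts := by
      intro q hq
      simp only [hR, Multigraph.induce, List.mem_filter, decide_eq_true_eq] at hq
      simp only [hR, Multigraph.induce, Finset.mem_inter]
      exact ⟨⟨(hQ.2.1 q hq.1).1, hq.2.1⟩, ⟨(hQ.2.1 q hq.1).2, hq.2.2⟩⟩
    have h3 := hexp (c p.1) {p.1} (by simpa using (hRv p hpR).1)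
    rw [← hR] at h3
    have h4 := R.cut_le_vol {p.1} hRv
    have h5 : 1 ≤ R.vol {p.1} := Multigraph.one_le_vol hpR (Finset.mem_singleton_self _) (Or.inl rfl)
    have h6 : 1 ≤ R.vol (R.verts \ {p.1}) := Multigraph.one_le_vol hpR
      (x := p.2) (by simpa using ⟨(hRv p hpR).2, (hl.ne hp).symm⟩) (Or.inr rfl)
    have h7 : R.cut {p.1} ≤ min (R.vol {p.1}) (R.vol (R.verts \ {p.1})) := le_min h4.1 h4.2
    have h8 : 1 ≤ min (R.vol {p.1}) (R.vol (R.verts \ {p.1})) := le_min h5 h6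
    have h9 : 1 < ε / φ := (one_lt_div hφ).2 h1
    generalize min (R.vol {p.1}) (R.vol (R.verts \ {p.1})) = z at *
    have h7' : (R.cut {p.1} : ℝ) ≤ z := by exact_mod_cast h7
    have h8' : (1 : ℝ) ≤ z := by exact_mod_cast h8
    nlinarith
  rw [hlen] at hcut
  have : (0 : ℝ) < Q.edges.length := by exact_mod_cast hm
  nlinarith

end EdgeBound

/-! ### One round does not split small, nearly friendly cuts -/

section Preservation

variable {n : ℕ} {G : SimpleGraph (Fin n)}

/-- Not much more than a `1 - α` fraction of the degrees in a vertex set crosses the cut `S`. -/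
def NearlyFriendly (α s : ℝ) (G : SimpleGraph (Fin n)) (S : Set (Fin n)) : Prop :=
  ∀ X : Finset (Fin n), ((∑ v ∈ X, cross G S v : ℕ) : ℝ) ≤
    (1 - α) * ((∑ v ∈ X, deg G v : ℕ) : ℝ) + 2 * s

theorem cross_compl (S : Set (Fin n)) (v : Fin n) : cross G Sᶜ v = cross G S v := by
  unfold cross
  congr 1
  ext u
  simp only [Set.mem_compl_iff, Set.mem_ofPred_eq]
  tauto

theorem NearlyFriendly.compl {α s : ℝ} {S : Set (Fin n)} (h : NearlyFriendly α s G S) :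
    NearlyFriendly α s G Sᶜ := by
  intro X
  simpa only [cross_compl] using h X

theorem crosses_mk {V : Type*} {S : Set V} {u v : V} : Crosses S s(u, v) ↔ ¬ (u ∈ S ↔ v ∈ S) := by
  constructor
  · rintro ⟨a, ha, b, hb, e⟩
    rcases Sym2.eq_iff.1 e with ⟨rfl, rfl⟩ | ⟨rfl, rfl⟩ <;> tauto
  · intro h
    by_cases hu : u ∈ S
    · exact ⟨u, hu, v, by tauto, rfl⟩
    · exact ⟨v, by tauto, u, hu, Sym2.eq_swap⟩

/-- The super-vertices of a cluster that lie in `T` have few vertices in total if their volume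
is bounded by the cut. -/
theorem size_of_side_le {Q : Multigraph} {c : ℕ → ℕ} {f : Fin n → ℕ} {ψ s : ℝ} (hψ : 0 < ψ)
    (hs : 0 < s)
    (hloop : ∀ x ∈ Q.verts, (Q.edges.countP fun p => p.1 = x ∧ p.2 = x) =
      ⌈ψ⁻¹ * s * (size f x : ℝ)⌉₊) (i : ℕ) (B : Finset ℕ)
    (hB : B ⊆ Q.verts.filter fun x => c x = i)
    (hvol : ψ * ((Q.induce (Q.verts.filter fun x => c x = i)).vol B : ℝ) ≤ 2 * s ^ 2) :
    ((∑ x ∈ B, size f x : ℕ) : ℝ) ≤ 2 * s := by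
  -- The self-loops survive in the induced cluster, so they alone bound the degree from below.
  have h1 : ∀ x ∈ B, ψ⁻¹ * s * (size f x : ℝ) ≤
      ((Q.induce (Q.verts.filter fun x => c x = i)).degree x : ℝ) := by
    intro x hx
    have hxW := hB hx
    refine (Nat.le_ceil _).trans ?_
    rw [← hloop x (Finset.mem_filter.1 hxW).1, Multigraph.degree, Multigraph.induce,
      List.countP_filter]
    refine Nat.cast_le.2 (List.countP_mono_left fun p _ hp => ?_)
    simp only [decide_eq_true_eq] at hp
    simp [hp.1, hp.2, Finset.mem_filter.1 hxW]
  have h2 : ψ⁻¹ * s * ((∑ x ∈ B, size f x : ℕ) : ℝ) ≤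
      ((Q.induce (Q.verts.filter fun x => c x = i)).vol B : ℝ) := by
    rw [Multigraph.vol]
    push_cast
    rw [Finset.mul_sum]
    exact Finset.sum_le_sum h1
  have h3 : s * ((∑ x ∈ B, size f x : ℕ) : ℝ) ≤ s * (2 * s) := by
    calc s * ((∑ x ∈ B, size f x : ℕ) : ℝ) = ψ * (ψ⁻¹ * s * ((∑ x ∈ B, size f x : ℕ) : ℝ)) := by
          field_simp
      _ ≤ ψ * _ := by gcongr
      _ ≤ 2 * s ^ 2 := hvol
      _ = _ := by ring
  exact le_of_mul_le_mul_left h3 hs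

/-- A neighbour of `v` that lies neither across the cut nor in another cluster is one of the
vertices of `T` in the cluster of `v`. -/
theorem deg_le_cross_add (c : ℕ → ℕ) (f : Fin n → ℕ) (T : Set (Fin n)) {v : Fin n} (hv : v ∈ T) :
    deg G v ≤ cross G T v +
      (Finset.univ.filter fun u => u ∈ T ∧ c (f u) = c (f v)).card +
      nbr G (fun u => c (f v) ≠ c (f u)) v := by
  rw [deg_eq_nbr, cross_eq_nbr, nbr, nbr, nbr]
  refine (Finset.card_le_card fun u hu => ?_).trans
    ((Finset.card_union_le _ _).trans (Nat.add_le_add_right (Finset.card_union_le _ _) _))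
  simp only [Finset.mem_union, Finset.mem_filter, Finset.mem_univ, true_and] at hu ⊢
  have := hu.1
  by_cases h1 : u ∈ T <;> by_cases h2 : c (f u) = c (f v)
  · simp [h1, h2]
  · exact Or.inr ⟨this, fun h => h2 h.symm⟩
  · simp [h1, hv, this]
  · simp [h1, hv, this]

/-- If `f v` reached its threshold, both the edges inside the small side and those leaving the
cluster would be a small part of the `α`-fraction of its degree that near friendliness keeps from
crossing. -/
theorem not_kept_of_small_side {Q : Multigraph} {c : ℕ → ℕ} {f : Fin n → ℕ} {α s : ℝ}
    (hα : 0 < α) (hs : 0 < s) (hQ : Q.IsContractionBy G f) {T : Set (Fin n)}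
    (hT : ∀ u v, f u = f v → (u ∈ T ↔ v ∈ T)) (hfr : NearlyFriendly α s G T)
    {v : Fin n} (hv : v ∈ T)
    (hside : ((Finset.univ.filter fun u => u ∈ T ∧ c (f u) = c (f v)).card : ℝ) ≤ 2 * s) :
    (Q.properDegree (f v) : ℝ) < threshold α s f Q c (f v) := by
  by_contra! hcon
  rw [threshold, max_le_iff, ncard_fiber] at hcon
  obtain ⟨hd1, hd2⟩ := hcon
  set x := f v with hx
  set X := Finset.univ.filter fun u => f u = x
  set k := (Finset.univ.filter fun u => u ∈ T ∧ c (f u) = c x).card with hk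
  have hsz : X.card = size f x := rfl
  have hsz1 : 1 ≤ size f x := Finset.card_pos.2 ⟨v, by simp [hx]⟩
  -- As `G` is simple, each of the `|x|` vertices has at most `k` neighbours in its own side and
  -- cluster.
  have hdeg : ∑ u ∈ X, deg G u ≤ (∑ u ∈ X, cross G T u) + size f x * k + Q.outDegree c x := by
    rw [hQ.outDegree_eq, ← hsz, ← smul_eq_mul, ← Finset.sum_const, ← Finset.sum_add_distrib,
      ← Finset.sum_add_distrib]
    refine Finset.sum_le_sum fun u hu => ?_
    have hu : f u = x := (Finset.mem_filter.1 hu).2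
    have := deg_le_cross_add (G := G) c f T ((hT u v hu).2 hv)
    rw [hu] at this
    simpa only [hu] using this
  have hd : Q.properDegree x ≤ ∑ u ∈ X, deg G u := by
    rw [hQ.properDegree_eq]
    exact Finset.sum_le_sum fun u _ => nbr_le_deg _ _
  have hc := hfr X
  have hdeg' : ((∑ u ∈ X, deg G u : ℕ) : ℝ) ≤ ((∑ u ∈ X, cross G T u : ℕ) : ℝ) + size f x * k +
      Q.outDegree c x := by exact_mod_cast hdeg
  have hd' : (Q.properDegree x : ℝ) ≤ ((∑ u ∈ X, deg G u : ℕ) : ℝ) := by exact_mod_cast hd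
  generalize ((∑ u ∈ X, deg G u : ℕ) : ℝ) = D at *
  generalize ((∑ u ∈ X, cross G T u : ℕ) : ℝ) = Cr at *
  have hsz1' : (1 : ℝ) ≤ size f x := by exact_mod_cast hsz1
  have e1 : 10 * s * size f x ≤ α * D := by
    calc 10 * s * size f x = α * (10 * α⁻¹ * s * size f x) := by field_simp
      _ ≤ α * D := by gcongr; exact hd1.trans hd'
  have e2 : 4 * (Q.outDegree c x : ℝ) ≤ α * D := by
    calc 4 * (Q.outDegree c x : ℝ) = α * (4 * α⁻¹ * (Q.outDegree c x : ℝ)) := by field_simp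
      _ ≤ α * D := by gcongr; exact hd2.trans hd'
  have e3 : (size f x : ℝ) * k ≤ size f x * (2 * s) := by gcongr
  have e4 : s ≤ s * size f x := le_mul_of_one_le_right hs.le hsz1'
  -- With `D` the sum of the degrees over the class, `αD ≤ 2s + 2s|x| + out(x) ≤ 4s|x| + out(x) ≤
  -- (4/10 + 1/4) αD`, although `αD ≥ 10 s|x| > 0`.
  nlinarith

/-- As `S` is a union of classes, an edge of `Q` crosses its image exactly when the underlying edge
of `G` crosses `S`; self-loops never cross, and passing to a cluster only loses edges. -/
theorem induce_cut_le {Q : Multigraph} {f : Fin n → ℕ} (hQ : Q.IsContractionBy G f)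
    {S : Set (Fin n)} (hS : ∀ u v, f u = f v → (u ∈ S ↔ v ∈ S)) (W : Finset ℕ) :
    (Q.induce W).cut (W.filter fun x => ∃ v ∈ S, f v = x) ≤ cut G S := by
  have h1 : ∀ u, (∃ v ∈ S, f v = f u) ↔ u ∈ S := fun u =>
    ⟨fun ⟨v, hv, e⟩ => (hS v u e).1 hv, fun h => ⟨u, h, rfl⟩⟩
  set p : Sym2 ℕ → Prop := Crosses {x | ∃ v ∈ S, f v = x} with hp
  have h2 := hQ.countP_eq p (by intro x; rw [hp, crosses_mk]; simp)
  have h3 : {e ∈ G.edgeSet | p (Sym2.map f e)}.ncard = cut G S := by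
    rw [cut]
    congr 1
    ext e
    induction e with
    | _ u v =>
      simp only [hp, Sym2.map_mk, Set.mem_ofPred_eq, crosses_mk, h1]
  rw [← h3, ← h2, Multigraph.cut, Multigraph.induce, List.countP_filter]
  refine List.countP_mono_left fun q _ hq => ?_
  simp only [Bool.and_eq_true, decide_eq_true_eq, Finset.mem_filter] at hq
  simp only [decide_eq_true_eq, hp, crosses_mk, Set.mem_ofPred_eq]
  simpa only [hq.2.1, hq.2.2, true_and] using hq.1

/-- Two kept super-vertices of a cluster on different sides of `S` are impossible: the one on the
side of smaller volume would have been shaved. -/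
theorem Round.preserves {α β φ s : ℝ} {f f' : Fin n → ℕ} (hα : 0 < α)
    (hβ : 0 < β) (hφ : 0 < φ) (hs : 0 < s) (h : Round G α β φ s f f') {S : Set (Fin n)}
    (hS : ∀ u v, f u = f v → (u ∈ S ↔ v ∈ S)) (hfr : NearlyFriendly α s G S)
    (hcut : (cut G S : ℝ) ≤ 2 * s ^ 2) :
    ∀ u v, f' u = f' v → (u ∈ S ↔ v ∈ S) := by
  obtain ⟨Q, c, kept, hQ, hloop, hdec, hkept, -, hf⟩ := h
  simp only [ncard_fiber] at hloop
  have key : ∀ u v, f u ∈ kept → f v ∈ kept → c (f u) = c (f v) → u ∈ S → v ∉ S → False := by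
    intro u v hu hv huv huS hvS
    set W := Q.verts.filter fun x => c x = c (f u) with hW
    set B := W.filter fun x => ∃ v ∈ S, f v = x with hB
    have hexp := hdec.2.2 (c (f u)) B (by
      rw [Multigraph.induce]
      intro x hx
      have := (Finset.mem_filter.1 hx).1
      exact Finset.mem_inter.2 ⟨(Finset.mem_filter.1 this).1, this⟩)
    rw [← hW] at hexp
    have hWv : (Q.induce W).verts = W := by
      rw [Multigraph.induce]; exact Finset.inter_eq_right.2 (Finset.filter_subset _ _)
    have hle : ((Q.induce W).cut B : ℝ) ≤ 2 * s ^ 2 :=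
      le_trans (by exact_mod_cast induce_cut_le hQ hS W) hcut
    have hψ : 0 < 0.01 * (α * β) / φ := by positivity
    -- Stated for an arbitrary side, as it is needed for `S` with `B` and for the complement of `S`
    -- with `W \ B`, whichever has the smaller volume.
    have hside : ∀ T : Set (Fin n), ∀ A ⊆ W, (∀ a ∈ T, c (f a) = c (f u) → f a ∈ A) →
        0.01 * (α * β) / φ * ((Q.induce W).vol A : ℝ) ≤ 2 * s ^ 2 →
        ((Finset.univ.filter fun a => a ∈ T ∧ c (f a) = c (f u)).card : ℝ) ≤ 2 * s := by
      intro T A hA hTA hvol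
      refine le_trans ?_ (size_of_side_le hψ hs hloop _ A hA hvol)
      refine Nat.cast_le.2 ?_
      have := Finset.card_eq_sum_card_fiberwise (f := f) (t := A)
        (s := Finset.univ.filter fun a => a ∈ T ∧ c (f a) = c (f u)) (fun a ha => by
          have := (Finset.mem_filter.1 ha).2
          exact hTA a this.1 this.2)
      rw [this]
      exact Finset.sum_le_sum fun x _ => Finset.card_le_card fun a ha => by
        simp only [Finset.mem_filter] at ha ⊢
        exact ⟨Finset.mem_univ _, ha.2⟩
    rcases le_total ((Q.induce W).vol B) ((Q.induce W).vol ((Q.induce W).verts \ B)) with hv1 | hv1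
    · rw [min_eq_left hv1] at hexp
      refine hkept (f u) ((hQ.1 _).2 ⟨u, rfl⟩) ?_ hu
      refine not_kept_of_small_side hα hs hQ hS hfr huS ?_
      refine hside S B (Finset.filter_subset _ _) ?_ (hexp.trans hle)
      intro a ha hc
      exact Finset.mem_filter.2 ⟨Finset.mem_filter.2 ⟨(hQ.1 _).2 ⟨a, rfl⟩, hc⟩, a, ha, rfl⟩
    · rw [min_eq_right hv1, hWv] at hexp
      have hT : ∀ u v, f u = f v → (u ∈ Sᶜ ↔ v ∈ Sᶜ) := fun a b e => not_congr (hS a b e)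
      refine hkept (f v) ((hQ.1 _).2 ⟨v, rfl⟩) ?_ hv
      refine not_kept_of_small_side hα hs hQ hT hfr.compl hvS ?_
      rw [← huv]
      refine hside Sᶜ (W \ B) Finset.sdiff_subset ?_ (hexp.trans hle)
      intro a ha hc
      refine Finset.mem_sdiff.2 ⟨Finset.mem_filter.2 ⟨(hQ.1 _).2 ⟨a, rfl⟩, hc⟩, fun hB => ?_⟩
      obtain ⟨b, hb, hba⟩ := (Finset.mem_filter.1 hB).2
      exact ha ((hS b a hba).1 hb)
  intro u v huv
  rcases (hf u v).1 huv with h | ⟨hu, hv, hc⟩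
  · exact hS u v h
  · exact ⟨fun h => by_contra fun h' => key u v hu hv hc h h',
      fun h => by_contra fun h' => key v u hv hu hc.symm h h'⟩

end Preservation

/-! ### Cuts and contractions under edge updates -/

section Update

variable {n : ℕ} {G : SimpleGraph (Fin n)}

theorem updateGraph_adj {I D : List (Sym2 (Fin n))} {u v : Fin n} :
    (updateGraph G I D).Adj u v ↔ (G.Adj u v ∨ s(u, v) ∈ I) ∧ u ≠ v ∧ s(u, v) ∉ D := by
  simp only [updateGraph, SimpleGraph.sdiff_adj, SimpleGraph.sup_adj,
    SimpleGraph.fromEdgeSet_adj, Set.mem_ofPred_eq]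
  constructor
  · rintro ⟨h | h, h'⟩
    · exact ⟨Or.inl h, h.ne, fun h'' => h' ⟨h'', h.ne⟩⟩
    · exact ⟨Or.inr h.1, h.2, fun h'' => h' ⟨h'', h.2⟩⟩
  · rintro ⟨h | h, h1, h2⟩
    · exact ⟨Or.inl h, fun h' => h2 h'.1⟩
    · exact ⟨Or.inr ⟨h, h1⟩, fun h' => h2 h'.1⟩

/-- Insertions that become self-loops are discarded on both sides. Hence the updated sparsifier is
automatically a contraction of the updated graph, and only the partition matters for robustness. -/
theorem contract_update (r : Setoid (Fin n)) (I D : List (Sym2 (Fin n))) :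
    (contract G r).update I D = contract (updateGraph G I D) r := by
  ext e
  · rfl
  · simp only [Contracted.update, contract, Set.mem_ofPred_eq, Set.mem_sdiff, Set.mem_union]
    refine and_congr_left fun hs => ?_
    induction e with
    | _ u v =>
      have hne : u ≠ v := by
        rintro rfl
        obtain ⟨a, b, e, h⟩ := hs
        rcases Sym2.eq_iff.1 e with ⟨rfl, rfl⟩ | ⟨rfl, rfl⟩ <;> exact h (r.refl _)
      rw [SimpleGraph.mem_edgeSet, SimpleGraph.mem_edgeSet, updateGraph_adj]
      tauto

theorem updateGraph_nil : updateGraph G [] [] = G := by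
  ext u v
  rw [updateGraph_adj]
  simpa using fun h => SimpleGraph.Adj.ne h

theorem card_listed_neighbors_le (L : List (Sym2 (Fin n))) (X : Finset (Fin n)) :
    ∑ v ∈ X, (Finset.univ.filter fun u => s(v, u) ∈ L).card ≤ 2 * L.length := by
  induction L with
  | nil => simp
  | cons e L ih =>
    have h1 : ∀ v, (Finset.univ.filter fun u => s(v, u) ∈ e :: L).card ≤
        (Finset.univ.filter fun u => s(v, u) = e).card +
        (Finset.univ.filter fun u => s(v, u) ∈ L).card := fun v => by
      simp only [List.mem_cons, Finset.filter_or]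
      exact Finset.card_union_le _ _
    have h2 : ∑ v ∈ X, (Finset.univ.filter fun u => s(v, u) = e).card ≤ 2 := by
      induction e with
      | _ a b =>
        rw [← Finset.card_sigma]
        refine (Finset.card_le_card (t := {⟨a, b⟩, ⟨b, a⟩}) ?_).trans Finset.card_le_two
        rintro ⟨v, u⟩ h
        simp only [Finset.mem_sigma, Finset.mem_filter, Finset.mem_univ, true_and] at h
        rcases Sym2.eq_iff.1 h.2 with ⟨rfl, rfl⟩ | ⟨rfl, rfl⟩ <;> simp
    have h3 := Finset.sum_le_sum fun v (_ : v ∈ X) => h1 v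
    rw [Finset.sum_add_distrib] at h3
    simp only [List.length_cons]
    omega

/-- The product form can be summed over vertex sets and also covers isolated vertices, where the
quotient is 0 by convention. -/
theorem cross_le_mul_deg {α : ℝ} {S : Set (Fin n)} (h : IsFriendly α G S) (v : Fin n) :
    (cross G S v : ℝ) ≤ (1 - α) * deg G v := by
  have h1 := h v
  have h2 : cross G S v ≤ deg G v := by rw [cross_eq_nbr]; exact nbr_le_deg _ _
  rcases (Nat.zero_le (deg G v)).eq_or_lt with h0 | h0
  · rw [← h0] at h2 ⊢
    simp [Nat.le_zero.1 h2]
  · have h0' : (0 : ℝ) < deg G v := by exact_mod_cast h0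
    have h3 : (cross G S v : ℝ) / deg G v ≤ 1 - α := by linarith
    exact (div_le_iff₀ h0').1 h3

/-- An update is incident to two vertices, so over any vertex set deletions hide at most `2|D|`
crossings and insertions add at most `2|I|` to the degrees. The error does not grow with the set,
which is what makes the condition usable for whole super-vertices. -/
theorem nearlyFriendly_of_updateGraph {α s : ℝ} (hα : 0 ≤ α) (hα' : α ≤ 1)
    {I D : List (Sym2 (Fin n))} (hID : ((I.length + D.length : ℕ) : ℝ) ≤ s) {S : Set (Fin n)}
    (h : IsFriendly α (updateGraph G I D) S) : NearlyFriendly α s G S := by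
  intro X
  have h1 : ∀ v, cross G S v ≤ cross (updateGraph G I D) S v +
      (Finset.univ.filter fun u => s(v, u) ∈ D).card := by
    intro v
    rw [cross_eq_nbr, cross_eq_nbr, nbr, nbr]
    refine (Finset.card_le_card fun u hu => ?_).trans (Finset.card_union_le _ _)
    simp only [Finset.mem_union, Finset.mem_filter, Finset.mem_univ, true_and,
      updateGraph_adj] at hu ⊢
    have := hu.1.ne
    tauto
  have h2 : ∀ v, deg (updateGraph G I D) v ≤ deg G v +
      (Finset.univ.filter fun u => s(v, u) ∈ I).card := by
    intro v
    rw [deg_eq_nbr, deg_eq_nbr, nbr, nbr]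
    refine (Finset.card_le_card fun u hu => ?_).trans (Finset.card_union_le _ _)
    simp only [Finset.mem_union, Finset.mem_filter, Finset.mem_univ, true_and,
      updateGraph_adj] at hu ⊢
    tauto
  have h3 := (Finset.sum_le_sum fun v (_ : v ∈ X) => h1 v).trans_eq Finset.sum_add_distrib
  have h4 := (Finset.sum_le_sum fun v (_ : v ∈ X) => h2 v).trans_eq Finset.sum_add_distrib
  have h5 := card_listed_neighbors_le I X
  have h6 := card_listed_neighbors_le D X
  have h7 : ((∑ v ∈ X, cross (updateGraph G I D) S v : ℕ) : ℝ) ≤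
      (1 - α) * ((∑ v ∈ X, deg (updateGraph G I D) v : ℕ) : ℝ) := by
    push_cast
    rw [Finset.mul_sum]
    exact Finset.sum_le_sum fun v _ => cross_le_mul_deg h v
  have h8 : ∑ v ∈ X, cross G S v ≤ ∑ v ∈ X, cross (updateGraph G I D) S v + 2 * D.length := by omega
  have h9 : ∑ v ∈ X, deg (updateGraph G I D) v ≤ ∑ v ∈ X, deg G v + 2 * I.length := by omega
  have h8' : ((∑ v ∈ X, cross G S v : ℕ) : ℝ) ≤
      ((∑ v ∈ X, cross (updateGraph G I D) S v : ℕ) : ℝ) + 2 * D.length := by exact_mod_cast h8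
  have h9' : ((∑ v ∈ X, deg (updateGraph G I D) v : ℕ) : ℝ) ≤
      ((∑ v ∈ X, deg G v : ℕ) : ℝ) + 2 * I.length := by exact_mod_cast h9
  push_cast at hID
  have h10 := mul_le_mul_of_nonneg_left h9' (sub_nonneg.2 hα')
  have h11 : (0 : ℝ) ≤ I.length := Nat.cast_nonneg _
  nlinarith

theorem cut_le_cut_updateGraph (I D : List (Sym2 (Fin n))) (S : Set (Fin n)) :
    cut G S ≤ cut (updateGraph G I D) S + D.length := by
  have h1 : ({e | e ∈ D} : Set (Sym2 (Fin n))).ncard ≤ D.length := by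
    rw [← List.coe_toFinset, Set.ncard_coe_finset]
    exact D.toFinset_card_le
  refine le_trans (Set.ncard_le_ncard (t := {e ∈ (updateGraph G I D).edgeSet | Crosses S e} ∪
    {e | e ∈ D}) ?_ (Set.toFinite _)) ((Set.ncard_union_le _ _).trans (Nat.add_le_add_left h1 _))
  rintro e ⟨he, hS⟩
  induction e with
  | _ u v =>
    by_cases hD : s(u, v) ∈ D
    · exact Or.inr hD
    · have he : G.Adj u v := he
      exact Or.inl ⟨(updateGraph G I D).mem_edgeSet.2
        (updateGraph_adj.2 ⟨Or.inl he, he.ne, hD⟩), hS⟩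

theorem contract_cut_eq {r : Setoid (Fin n)} {S : Set (Fin n)} (h : ∀ u v, r u v → (u ∈ S ↔ v ∈ S)) :
    (contract G r).cut S = (cut G S : ℕ∞) := by
  refine (if_pos h).trans ?_
  rw [cut]
  congr 2
  ext e
  simp only [contract, Set.mem_ofPred_eq]
  constructor
  · tauto
  · rintro ⟨h1, h2⟩
    refine ⟨⟨h1, ?_⟩, h2⟩
    obtain ⟨u, hu, v, hv, rfl⟩ := h2
    exact ⟨u, v, rfl, fun huv => hv ((h u v huv).1 hu)⟩

/-! ### Induction over the rounds -/

theorem Rounds.preserves {α β φ w s₀ : ℝ} (hα : 0 < α) (hα' : α ≤ 1) (hβ : 0 < β) (hφ : 0 < φ)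
    (hw : 1 ≤ w) (hs₀ : 0 ≤ s₀) {t : ℕ} {f : Fin n → ℕ} (h : Rounds G α β φ w s₀ t f)
    {I D : List (Sym2 (Fin n))} (hID : ((I.length + D.length : ℕ) : ℝ) ≤ √w) {S : Set (Fin n)}
    (hfr : IsFriendly α (updateGraph G I D) S) (hcut : (cut (updateGraph G I D) S : ℝ) ≤ w) :
    ∀ u v, f u = f v → (u ∈ S ↔ v ∈ S) := by
  induction h with
  | start => intro u v huv; rw [Fin.ext huv]
  | next _ hws hround ih =>
    rename_i t' f₁ f₂ _
    set s := s₀ / 2 ^ (t' + 1)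
    have hs0 : 0 ≤ s := by positivity
    have hsw : √w ≤ s := Real.sqrt_le_iff.2 ⟨hs0, hws⟩
    have hs1 : 1 ≤ s := by nlinarith
    refine hround.preserves hα hβ hφ (by linarith) ih
      (nearlyFriendly_of_updateGraph hα.le hα' (hID.trans hsw) hfr) ?_
    have h1 : (cut G S : ℝ) ≤ cut (updateGraph G I D) S + D.length := by
      exact_mod_cast cut_le_cut_updateGraph I D S
    push_cast at hID
    have h2 : (0 : ℝ) ≤ I.length := Nat.cast_nonneg _
    -- The deleted edges number at most `√w ≤ s`, so the cut in `G` has at most `w + √w ≤ s² + s ≤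
    -- 2s²` edges, using `s ≥ 1`.
    nlinarith

theorem IsFriendly.mono {α α' : ℝ} (h : α ≤ α') {S : Set (Fin n)} (hS : IsFriendly α' G S) :
    IsFriendly α G S := fun v => h.trans (hS v)

/-- The bound for `s₀ / 2 ^ t` is `200 φ s n` in terms of the next `s`, and `0.09 · 200 + 28 = 46 ≤
100`. The induction starts from the lower bound on `s₀`. -/
theorem Rounds.survivors_le {α β φ w s₀ : ℝ} (hα : 0 < α) (hα' : α < 1 / 4) (hβ : 0 < β)
    (hβ' : β < 1) (hφ : 1 ≤ φ) (hw : 1 ≤ w) (hs₀ : 0 ≤ s₀)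
    (hs : α * β * (G.edgeSet.ncard : ℝ) ≤ 100 * (φ * s₀ * n))
    {t : ℕ} {f : Fin n → ℕ} (h : Rounds G α β φ w s₀ t f) :
    α * β * survivors G f ≤ 100 * (φ * (s₀ / 2 ^ t) * n) := by
  induction h with
  | start =>
    rw [pow_zero, div_one]
    refine le_trans ?_ hs
    gcongr
    exact Set.ncard_le_ncard (fun e he => he.1) (Set.toFinite _)
  | next _ hws hround ih =>
    rename_i t' f₁ f₂ _
    have hs0 : 0 ≤ s₀ / 2 ^ (t' + 1) := by positivity
    have hs1 : 1 ≤ s₀ / 2 ^ (t' + 1) := by nlinarith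
    have h1 := hround.survivors_le hα hα' hβ hβ' hφ hs1
    have h2 : s₀ / 2 ^ t' = 2 * (s₀ / 2 ^ (t' + 1)) := by rw [pow_succ]; field_simp
    rw [h2] at ih
    have h3 : 0 ≤ φ * (s₀ / 2 ^ (t' + 1)) * n := by positivity
    nlinarith

/-- The last round was carried out, so its parameter is at least `√w ≥ 1`. -/
theorem Rounds.two_pow_le {α β φ w s₀ : ℝ} (hw : 1 ≤ w) (hs₀ : 0 ≤ s₀) {t : ℕ} {f : Fin n → ℕ}
    (h : Rounds G α β φ w s₀ t f) (ht : t ≠ 0) : 2 ^ t ≤ s₀ := by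
  cases h with
  | start => exact absurd rfl ht
  | next _ hws hround =>
    rename_i t' _ _
    have hs0 : 0 ≤ s₀ / 2 ^ (t' + 1) := by positivity
    have hs1 : 1 ≤ s₀ / 2 ^ (t' + 1) := by nlinarith
    exact (one_le_div (by positivity)).1 hs1

theorem ncard_edgeSet_le (G : SimpleGraph (Fin n)) : G.edgeSet.ncard ≤ n * n := by
  have h1 := G.card_edgeFinset_le_card_choose_two
  have h2 : G.edgeSet.ncard = G.edgeFinset.card := by
    rw [← Set.ncard_coe_finset]; simp
  rw [h2]
  refine h1.trans ?_
  rw [Fintype.card_fin, Nat.choose_two_right]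
  refine (Nat.div_le_self _ _).trans ?_
  gcongr
  omega

theorem half_le_log (n : ℕ) : 1 / 2 ≤ Real.log (n + 2) := by
  have h1 : (2 : ℝ) ≤ n + 2 := by have : (0 : ℝ) ≤ n := Nat.cast_nonneg n; linarith
  have := Real.log_le_log (by norm_num) h1
  have := Real.log_two_gt_d9
  linarith

theorem IsConstructed.spec {α β φ w : ℝ} (hα : 0 < α) (hα' : α < 1 / 4) (hβ : 0 < β)
    (hβ' : β < 1) (hφ : 0 < φ) (hφ' : 0 < G.edgeSet.ncard → 1 ≤ φ) (hw : 1 ≤ w) {t : ℕ}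
    {f : Fin n → ℕ} (h : IsConstructed G α β φ w t f) :
    IsFriendlyCutSparsifier α w G (contract G (Setoid.ker f)) ∧
    IsRobust (√w) α w G (contract G (Setoid.ker f)) ∧
    ((contract G (Setoid.ker f)).edges.ncard : ℝ) ≤
      400 * Real.log (n + 2) * ((β * α)⁻¹ * n * φ * √w) ∧
    (t : ℝ) ≤ 2 * Real.log (n + 2) := by
  obtain ⟨s₀, hlow, hup, hR, hend⟩ := h
  have hs₀ : 0 ≤ s₀ := le_trans (by positivity) hlow
  have hlog : 0 ≤ Real.log (n + 2) := Real.log_nonneg (by linarith [Nat.cast_nonneg (α := ℝ) n])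
  refine ⟨⟨⟨_, rfl⟩, fun S hS hc => ?_⟩, fun I D hID => ⟨⟨_, contract_update _ _ _⟩,
    fun S hS hc => ?_⟩, ?_, ?_⟩
  · refine contract_cut_eq fun u v huv => ?_
    exact hR.preserves hα (by linarith) hβ hφ hw hs₀ (I := []) (D := [])
      (by simp) (by rwa [updateGraph_nil]) (by rwa [updateGraph_nil]) u v huv
  · rw [contract_update]
    refine contract_cut_eq fun u v huv => ?_
    -- `2α`-friendliness is only used as `α`-friendliness: the damage done by the updates is the
    -- additive term in `NearlyFriendly`.
    exact hR.preserves hα (by linarith) hβ hφ hw hs₀ hID (hS.mono (by linarith)) hc u v huv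
  · change (survivors G f : ℝ) ≤ _
    -- Without edges `φ ≥ 1` is not available, but then nothing survives.
    rcases Nat.eq_zero_or_pos G.edgeSet.ncard with hm | hm
    · have : survivors G f = 0 :=
        Nat.le_zero.1 (hm ▸ Set.ncard_le_ncard (fun e he => he.1) (Set.toFinite _))
      rw [this]
      simp only [Nat.cast_zero]
      positivity
    · have hn : 0 < n := by
        rcases Nat.eq_zero_or_pos n with rfl | hn
        · have := ncard_edgeSet_le G; omega
        · exact hn
      have hn' : (0 : ℝ) < n := by exact_mod_cast hn
      have h1 := hR.survivors_le hα hα' hβ hβ' (hφ' hm) hw hs₀ (by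
        rw [div_le_iff₀ (by positivity)] at hlow; linarith)
      -- The construction stopped because the next parameter, half of this one, is below `√w`.
      have h2 : s₀ / 2 ^ t ≤ 2 * √w := by
        have h3 : s₀ / 2 ^ (t + 1) < √w := Real.lt_sqrt_of_sq_lt hend
        have h4 : s₀ / 2 ^ t = 2 * (s₀ / 2 ^ (t + 1)) := by rw [pow_succ]; field_simp
        linarith
      have h3 : α * β * survivors G f ≤ 100 * (φ * (2 * √w) * n) := h1.trans (by gcongr)
      have h4 : (survivors G f : ℝ) ≤ 200 * ((β * α)⁻¹ * n * φ * √w) := by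
        calc (survivors G f : ℝ) = (β * α)⁻¹ * (α * β * survivors G f) := by field_simp
          _ ≤ (β * α)⁻¹ * (100 * (φ * (2 * √w) * n)) := by gcongr
          _ = _ := by ring
      refine h4.trans ?_
      gcongr
      linarith [half_le_log n]
  · rcases Nat.eq_zero_or_pos t with rfl | ht
    · simp only [Nat.cast_zero]; positivity
    · have h1 := hR.two_pow_le hw hs₀ ht.ne'
      have h2 : (G.edgeSet.ncard : ℝ) / n ≤ n := by
        rcases Nat.eq_zero_or_pos n with rfl | hn
        · simp
        · rw [div_le_iff₀ (by exact_mod_cast hn)]; exact_mod_cast ncard_edgeSet_le G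
      have h3 : (2 : ℝ) ^ t ≤ n + 2 := by linarith
      have h4 := Real.log_le_log (by positivity) h3
      rw [Real.log_pow] at h4
      have := Real.log_two_gt_d9
      have : (0 : ℝ) ≤ t := Nat.cast_nonneg _
      nlinarith

end Update

/-! ### Reasoning about programs: frames, straight-line code and loops -/

section Semantics

/-- `o` does not write the integer register `r`. -/
def Op.keepsInt (r : ℕ) : Op → Bool
  | .zero r' => r' != r
  | .inc r' => r' != r
  | .dec r' => r' != r
  | .copy r' _ => r' != r
  | .load r' _ _ => r' != r
  | _ => true

/-- `o` does not write the array `a`. -/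
def Op.keepsArr (a : ℕ) : Op → Bool
  | .store a' _ _ => a' != a
  | .call _ _ _ _ _ a' => a' != a
  | _ => true

/-- `o` does not write the real register `x`. -/
def Op.keepsReal (x : ℕ) : Op → Bool
  | .rconst x' _ => x' != x
  | .rcast x' _ => x' != x
  | .radd x' _ _ => x' != x
  | .rsub x' _ _ => x' != x
  | .rmul x' _ _ => x' != x
  | .rdiv x' _ _ => x' != x
  | _ => true

/-- `o` is not a call. -/
def Op.noCall : Op → Bool
  | .call _ _ _ _ _ _ => false
  | _ => true

/-- All instructions of the program satisfy `p`. -/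
def Program.all (p : Op → Bool) : Program → Bool
  | .skip => true
  | .op o => p o
  | .seq P P' => P.all p && P'.all p
  | .ite _ P P' => P.all p && P'.all p
  | .loop _ P => P.all p

/-- `σ'` agrees with `σ` on the memory that `P` does not write. -/
structure Frame (P : Program) (σ σ' : State) : Prop where
  int : ∀ r, P.all (Op.keepsInt r) = true → σ'.int r = σ.int r
  arr : ∀ a, P.all (Op.keepsArr a) = true → σ'.arr a = σ.arr a
  real : ∀ x, P.all (Op.keepsReal x) = true → σ'.real x = σ.real x
  calls : P.all Op.noCall = true → σ'.calls = σ.calls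

/-- What a program leaves untouched is read off its text: if every instruction fixes the observation
`g`, so does every execution. Each later frame condition is thereby a decidable syntactic check. -/
theorem Exec.preserves {O : Procedure} {β : Type*} {p : Op → Bool} {g : State → β}
    (hg : ∀ o σ, p o = true → g (o.apply O σ).tick = g σ) (ht : ∀ σ : State, g σ.tick = g σ)
    {P : Program} {σ σ' : State} (h : Exec O P σ σ') (hP : P.all p = true) : g σ' = g σ := by
  induction h with
  | skip => rfl
  | op o σ => exact hg o σ hP
  | seq _ _ ih1 ih2 =>
    simp only [Program.all, Bool.and_eq_true] at hP
    rw [ih2 hP.2, ih1 hP.1]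
  | iteTrue _ _ ih =>
    simp only [Program.all, Bool.and_eq_true] at hP
    rw [ih hP.1, ht]
  | iteFalse _ _ ih =>
    simp only [Program.all, Bool.and_eq_true] at hP
    rw [ih hP.2, ht]
  | loopTrue _ _ _ ih1 ih2 => rw [ih2 hP, ih1 hP, ht]
  | loopFalse _ => exact ht _

theorem Exec.frame {O : Procedure} {P : Program} {σ σ' : State} (h : Exec O P σ σ') :
    Frame P σ σ' where
  int r hr := h.preserves (g := fun σ => σ.int r) (fun o σ ho => by
    cases o <;> simp_all [Op.apply, State.tick, Op.keepsInt, Function.update_of_ne, Ne.symm]) (fun _ => rfl) hr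
  arr a ha := h.preserves (g := fun σ => σ.arr a) (fun o σ ho => by
    cases o <;> simp_all [Op.apply, State.tick, Op.keepsArr, Function.update_of_ne, Ne.symm]) (fun _ => rfl) ha
  real x hx := h.preserves (g := fun σ => σ.real x) (fun o σ ho => by
    cases o <;> simp_all [Op.apply, State.tick, Op.keepsReal, Function.update_of_ne, Ne.symm]) (fun _ => rfl) hx
  calls hc := h.preserves (g := fun σ => σ.calls) (fun o σ ho => by
    cases o <;> simp_all [Op.apply, State.tick, Op.noCall]) (fun _ => rfl) hc

/-- The result of a program without loops. -/
def Program.denote (O : Procedure) : Program → State → State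
  | .skip, σ => σ
  | .op o, σ => (o.apply O σ).tick
  | .seq P P', σ => P'.denote O (P.denote O σ)
  | .ite b P P', σ => if b.holds σ then P.denote O σ.tick else P'.denote O σ.tick
  | .loop _ _, σ => σ

/-- The program has no loops. -/
def Program.loopFree : Program → Bool
  | .skip => true
  | .op _ => true
  | .seq P P' => P.loopFree && P'.loopFree
  | .ite _ P P' => P.loopFree && P'.loopFree
  | .loop _ _ => false

/-- A bound on the running time of a program without loops. -/
def Program.cost : Program → ℕ
  | .skip => 0
  | .op _ => 1
  | .seq P P' => P.cost + P'.cost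
  | .ite _ P P' => P.cost + P'.cost + 1
  | .loop _ _ => 0

theorem exec_denote (O : Procedure) {P : Program} (hP : P.loopFree = true) (σ : State) :
    Exec O P σ (P.denote O σ) := by
  induction P generalizing σ with
  | skip => exact .skip σ
  | op o => exact .op o σ
  | seq P P' ih ih' =>
    simp only [Program.loopFree, Bool.and_eq_true] at hP
    exact .seq (ih hP.1 _) (ih' hP.2 _)
  | ite b P P' ih ih' =>
    simp only [Program.loopFree, Bool.and_eq_true] at hP
    rw [Program.denote]
    split_ifs with h
    · exact .iteTrue h (ih hP.1 _)
    · exact .iteFalse h (ih' hP.2 _)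
  | loop => simp [Program.loopFree] at hP

theorem Op.time_apply (O : Procedure) (o : Op) (σ : State) : (o.apply O σ).time = σ.time := by
  cases o <;> rfl

theorem time_denote (O : Procedure) (P : Program) (σ : State) :
    (P.denote O σ).time ≤ σ.time + P.cost := by
  induction P generalizing σ with
  | skip => exact le_rfl
  | op o => simp [Program.denote, Program.cost, State.tick, Op.time_apply]
  | seq P P' ih ih' =>
    have := ih σ
    have := ih' (P.denote O σ)
    simp only [Program.denote, Program.cost]
    omega
  | ite b P P' ih ih' =>
    have h1 := ih σ.tick
    have h2 := ih' σ.tick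
    simp only [Program.denote, Program.cost, State.tick] at *
    split_ifs <;> omega
  | loop => simp [Program.denote, Program.cost]

/-- A sequence of basic instructions. -/
def block (l : List Op) : Program := l.foldr (fun o P => .seq (.op o) P) .skip

/-- Total correctness from an invariant indexed by the iteration and a known number `K` of
iterations; termination and running time come from the same induction. -/
theorem exec_loop {O : Procedure} {b : Test} {body : Program} (Inv : ℕ → State → Prop)
    (cost : ℕ → ℕ) (K : ℕ)
    (hstep : ∀ k < K, ∀ σ, Inv k σ → b.holds σ ∧
      ∃ σ', Exec O body σ.tick σ' ∧ Inv (k + 1) σ' ∧ σ'.time ≤ σ.time + cost k)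
    (hend : ∀ σ, Inv K σ → ¬ b.holds σ) (htick : ∀ σ, Inv K σ → Inv K σ.tick) {σ₀ : State}
    (h0 : Inv 0 σ₀) :
    ∃ σ', Exec O (.loop b body) σ₀ σ' ∧ Inv K σ' ∧
      σ'.time ≤ σ₀.time + ∑ k ∈ Finset.range K, cost k + 1 := by
  have main : ∀ d k, k + d = K → ∀ σ, Inv k σ → ∃ σ', Exec O (.loop b body) σ σ' ∧ Inv K σ' ∧
      σ'.time ≤ σ.time + ∑ k ∈ Finset.Ico k K, cost k + 1 := by
    intro d
    induction d with
    | zero =>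
      rintro k rfl σ hσ
      exact ⟨σ.tick, .loopFalse (hend σ hσ), htick σ hσ, by simp [State.tick]⟩
    | succ d ih =>
      intro k hk σ hσ
      obtain ⟨hb, σ₁, h1, h2, h3⟩ := hstep k (by omega) σ hσ
      obtain ⟨σ₂, h4, h5, h6⟩ := ih (k + 1) (by omega) σ₁ h2
      refine ⟨σ₂, .loopTrue hb h1 h4, h5, ?_⟩
      rw [Finset.sum_eq_sum_Ico_succ_bot (by omega : k < K)]
      omega
  simpa using main K 0 (by omega) σ₀ h0

/-- `for i < int N do body`. -/
def forLoop (i N : ℕ) (body : Program) : Program :=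
  .seq (.op (.zero i)) (.loop (.ilt i N) (.seq body (.op (.inc i))))

/-- Setting the register `i` and the clock. -/
def State.poke (σ : State) (i x t : ℕ) : State :=
  { σ with int := Function.update σ.int i x, time := t }

theorem Frame.poke {P : Program} {σ σ' : State} (h : Frame P σ σ') {i : ℕ}
    (hi : P.all (Op.keepsInt i) = false) (x t : ℕ) : Frame P σ (σ'.poke i x t) where
  int r hr := by
    have : r ≠ i := by rintro rfl; simp_all
    rw [State.poke, ← h.int r hr]
    exact Function.update_of_ne this _ _
  arr := h.arr
  real := h.real
  calls := h.calls

theorem Frame.refl (P : Program) (σ : State) : Frame P σ σ :=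
  ⟨fun _ _ => rfl, fun _ _ => rfl, fun _ _ => rfl, fun _ => rfl⟩

theorem Frame.trans {P : Program} {σ₁ σ₂ σ₃ : State} (h : Frame P σ₁ σ₂) (h' : Frame P σ₂ σ₃) :
    Frame P σ₁ σ₃ :=
  ⟨fun r hr => (h'.int r hr).trans (h.int r hr), fun r hr => (h'.arr r hr).trans (h.arr r hr),
    fun r hr => (h'.real r hr).trans (h.real r hr), fun hr => (h'.calls hr).trans (h.calls hr)⟩

theorem Program.all_forLoop (p : Op → Bool) (i N : ℕ) (body : Program) :
    (forLoop i N body).all p = (p (.zero i) && (body.all p && p (.inc i))) := rfl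

theorem Frame.forLoop {body : Program} {σ σ' : State} (h : Frame body σ σ') (i N : ℕ) :
    Frame (forLoop i N body) σ σ' where
  int r hr := h.int r (by simp_all [Program.all_forLoop])
  arr r hr := h.arr r (by simp_all [Program.all_forLoop])
  real r hr := h.real r (by simp_all [Program.all_forLoop])
  calls hr := h.calls (by simp_all [Program.all_forLoop])

/-- Requiring `Inv` to be insensitive to `poke` lets the loop counter and the clock be handled once
and for all. The frame supplied to each step spares the invariants from listing unchanged memory. -/
theorem exec_forLoop {O : Procedure} {i N : ℕ} {body : Program}
    (hi : body.all (Op.keepsInt i) = true) (hN : body.all (Op.keepsInt N) = true) (hne : i ≠ N)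
    (σ₀ : State) (Inv : ℕ → State → Prop) (cost : ℕ → ℕ)
    (hinv : ∀ k σ x t, Inv k σ → Inv k (σ.poke i x t)) (h0 : Inv 0 σ₀)
    (hstep : ∀ k < σ₀.int N, ∀ σ, Frame (forLoop i N body) σ₀ σ → σ.int i = k → Inv k σ →
      ∃ σ', Exec O body σ σ' ∧ Inv (k + 1) σ' ∧ σ'.time ≤ σ.time + cost k) :
    ∃ σ', Exec O (forLoop i N body) σ₀ σ' ∧ Inv (σ₀.int N) σ' ∧
      σ'.time ≤ σ₀.time + ∑ k ∈ Finset.range (σ₀.int N), (cost k + 2) + 2 := by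
  have hfor : (forLoop i N body).all (Op.keepsInt i) = false := by
    simp [Program.all_forLoop, Op.keepsInt]
  have hforN : (forLoop i N body).all (Op.keepsInt N) = true := by
    simp [Program.all_forLoop, Op.keepsInt, hN, hne]
  obtain ⟨σ', h1, h2, h3⟩ := exec_loop (O := O) (b := .ilt i N) (body := .seq body (.op (.inc i)))
    (fun k σ => Frame (forLoop i N body) σ₀ σ ∧ σ.int i = k ∧ Inv k σ) (fun k => cost k + 2)
    (σ₀.int N) (by
      rintro k hk σ ⟨hF, hik, hI⟩
      have hσN := hF.int N hforN
      refine ⟨by simp only [Test.holds]; omega, ?_⟩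
      have hI' := hinv k σ k (σ.time + 1) hI
      have htick : σ.poke i k (σ.time + 1) = σ.tick := by
        simp [State.poke, State.tick, ← hik]
      rw [htick] at hI'
      have hF' : Frame (forLoop i N body) σ₀ σ.tick := by
        rw [← htick]; exact hF.poke hfor _ _
      obtain ⟨σ₁, h1, h2, h3⟩ := hstep k hk σ.tick hF' hik hI'
      have hσ₁i : σ₁.int i = k := (h1.frame.int i hi).trans hik
      have hnew : ((Op.inc i).apply O σ₁).tick = σ₁.poke i (k + 1) (σ₁.time + 1) := by
        simp [Op.apply, State.tick, State.poke, hσ₁i]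
      refine ⟨_, .seq h1 (.op _ _), ?_, ?_⟩
      · rw [hnew]
        exact ⟨(hF'.trans (h1.frame.forLoop i N)).poke hfor _ _, by simp [State.poke],
          hinv _ _ _ _ h2⟩
      · rw [hnew]
        simp only [State.poke, State.tick] at h3 ⊢
        omega)
    (by
      rintro σ ⟨hF, hik, -⟩
      have hσN := hF.int N hforN
      simp only [Test.holds]; omega)
    (by
      rintro σ ⟨hF, hik, hI⟩
      have htick : σ.poke i (σ₀.int N) (σ.time + 1) = σ.tick := by
        simp [State.poke, State.tick, ← hik]
      rw [← htick]
      exact ⟨hF.poke hfor _ _, by simp [State.poke], hinv _ _ _ _ hI⟩)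
    (σ₀ := ((Op.zero i).apply O σ₀).tick) (by
      have : ((Op.zero i).apply O σ₀).tick = σ₀.poke i 0 (σ₀.time + 1) := by
        simp [Op.apply, State.tick, State.poke]
      rw [this]
      exact ⟨(Frame.refl _ _).poke hfor _ _, by simp [State.poke], hinv _ _ _ _ h0⟩)
  refine ⟨σ', .seq (.op _ _) h1, h2.2.2, ?_⟩
  have : (((Op.zero i).apply O σ₀).tick).time = σ₀.time + 1 := rfl
  omega

theorem exec_forLoop_denote {O : Procedure} {i N : ℕ} {body : Program}
    (hi : body.all (Op.keepsInt i) = true) (hN : body.all (Op.keepsInt N) = true) (hne : i ≠ N)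
    (hbody : body.loopFree = true)
    (σ₀ : State) (Inv : ℕ → State → Prop)
    (hinv : ∀ k σ x t, Inv k σ → Inv k (σ.poke i x t)) (h0 : Inv 0 σ₀)
    (hstep : ∀ k < σ₀.int N, ∀ σ, Frame (forLoop i N body) σ₀ σ → σ.int i = k → Inv k σ →
      Inv (k + 1) (body.denote O σ)) :
    ∃ σ', Exec O (forLoop i N body) σ₀ σ' ∧ Inv (σ₀.int N) σ' ∧
      σ'.time ≤ σ₀.time + (body.cost + 2) * σ₀.int N + 2 := by
  obtain ⟨σ', h1, h2, h3⟩ := exec_forLoop (O := O) hi hN hne σ₀ Inv (fun _ => body.cost) hinv h0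
    (fun k hk σ hF hik hI => ⟨_, exec_denote O hbody σ, hstep k hk σ hF hik hI, time_denote O _ σ⟩)
  refine ⟨σ', h1, h2, h3.trans (le_of_eq ?_)⟩
  simp [mul_comm]

end Semantics

/-! ### Linear passes of a round: counting and renaming -/

section Parts

theorem denote_ite_pos {O : Procedure} {b : Test} {P P' : Program} {σ : State} (h : b.holds σ) :
    (Program.ite b P P').denote O σ = P.denote O σ.tick := if_pos h

theorem denote_ite_neg {O : Procedure} {b : Test} {P P' : Program} {σ : State} (h : ¬ b.holds σ) :
    (Program.ite b P P').denote O σ = P'.denote O σ.tick := if_neg h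

/-- The first `p` entries of the edge arrays. -/
def edgeList (σ : State) (p : ℕ) : List (ℕ × ℕ) := (List.range p).map fun i => (σ.arr 0 i, σ.arr 1 i)

theorem edgeList_succ (σ : State) (p : ℕ) :
    edgeList σ (p + 1) = edgeList σ p ++ [(σ.arr 0 p, σ.arr 1 p)] := by
  simp [edgeList, List.range_succ]

theorem edgeList_congr {σ σ' : State} {p : ℕ}
    (h : ∀ i < p, σ'.arr 0 i = σ.arr 0 i ∧ σ'.arr 1 i = σ.arr 1 i) :
    edgeList σ' p = edgeList σ p := by
  refine List.map_congr_left fun i hi => ?_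
  rw [(h i (List.mem_range.1 hi)).1, (h i (List.mem_range.1 hi)).2]

theorem mem_edgeList {σ : State} {p i : ℕ} (h : i < p) : (σ.arr 0 i, σ.arr 1 i) ∈ edgeList σ p :=
  List.mem_map.2 ⟨i, List.mem_range.2 h, rfl⟩

/-- Zero the counters indexed by super-vertices or clusters. -/
def clearCounters : Program :=
  forLoop 3 2 (block [.store 3 3 11, .store 5 3 11, .store 6 3 11, .store 7 3 11])

/-- Arrays 3, 5, 6, 7 hold sizes, degrees, out-degrees and the label of each cluster. Integer
register 11 is never written and serves as the constant 0. -/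
theorem exec_clearCounters (O : Procedure) (σ : State) (h11 : σ.int 11 = 0) :
    ∃ σ', Exec O clearCounters σ σ' ∧
      (∀ x < σ.int 2, σ'.arr 3 x = 0 ∧ σ'.arr 5 x = 0 ∧ σ'.arr 6 x = 0 ∧ σ'.arr 7 x = 0) ∧
      σ'.time ≤ σ.time + 20 * σ.int 2 + 20 := by
  obtain ⟨σ', h1, h2, h3⟩ := exec_forLoop_denote (O := O) (i := 3) (N := 2)
    (body := block [.store 3 3 11, .store 5 3 11, .store 6 3 11, .store 7 3 11])
    (by decide) (by decide) (by decide) (by decide) σ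
    (fun k τ => ∀ x < k, τ.arr 3 x = 0 ∧ τ.arr 5 x = 0 ∧ τ.arr 6 x = 0 ∧ τ.arr 7 x = 0)
    (fun k τ x t h => h) (by simp) (by
      intro k _ τ hF hk hI x hx
      have e11 : τ.int 11 = 0 := (hF.int 11 (by decide)).trans h11
      have := hI x
      simp only [Program.denote, block, List.foldr, Op.apply, State.tick, Function.update_apply, hk, e11]
      by_cases hxk : x = k
      · simp [hxk]
      · have := hI x (by omega)
        simpa [hxk] using this)
  exact ⟨σ', h1, h2, h3.trans (by simp only [Program.cost, block, List.foldr]; omega)⟩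

/-- Count the vertices of every super-vertex. -/
def countSizes : Program :=
  forLoop 3 0 (block [.load 5 2 3, .dec 5, .load 6 3 5, .inc 6, .store 3 5 6])

theorem exec_countSizes (O : Procedure) (σ : State)
    (hlab : ∀ v < σ.int 0, 1 ≤ σ.arr 2 v ∧ σ.arr 2 v ≤ σ.int 2)
    (h0 : ∀ x < σ.int 2, σ.arr 3 x = 0) :
    ∃ σ', Exec O countSizes σ σ' ∧
      (∀ x < σ.int 2, σ'.arr 3 x =
        ((Finset.range (σ.int 0)).filter fun v => σ.arr 2 v = x + 1).card) ∧
      σ'.time ≤ σ.time + 20 * σ.int 0 + 20 := by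
  obtain ⟨σ', h1, h2, h3⟩ := exec_forLoop_denote (O := O) (i := 3) (N := 0)
    (body := block [.load 5 2 3, .dec 5, .load 6 3 5, .inc 6, .store 3 5 6])
    (by decide) (by decide) (by decide) (by decide) σ
    (fun k τ => ∀ x < σ.int 2, τ.arr 3 x =
      ((Finset.range k).filter fun v => σ.arr 2 v = x + 1).card)
    (fun k τ x t h => h) (by simpa using h0) (by
      intro k hkN τ hF hk hI x hx
      have e2 : τ.arr 2 = σ.arr 2 := hF.arr 2 (by decide)
      have hI' := hI x hx
      have hl := hlab k hkN
      have hI'' := hI (σ.arr 2 k - 1) (by omega)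
      rw [Finset.range_add_one, Finset.filter_insert]
      simp only [Program.denote, block, List.foldr, Op.apply, State.tick, Function.update_apply, hk, e2]
      by_cases hxk : σ.arr 2 k = x + 1
      · simp [hxk, hI']
      · have : x ≠ σ.arr 2 k - 1 := by omega
        simp [hxk, this, hI'])
  exact ⟨σ', h1, h2, h3.trans (by simp only [Program.cost, block, List.foldr]; omega)⟩

/-- Count the degrees and the numbers of edges to other clusters. -/
def countDegrees : Program :=
  forLoop 3 1 (.seq (block [.load 5 0 3, .load 6 1 3, .load 7 5 5, .inc 7, .store 5 5 7,
    .load 7 5 6, .inc 7, .store 5 6 7, .load 7 4 5, .load 12 4 6])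
    (.ite (.ieq 7 12) .skip
      (block [.load 7 6 5, .inc 7, .store 6 5 7, .load 7 6 6, .inc 7, .store 6 6 7])))

/-- An edge increments the counters of both ends, which would count a self-loop twice; this is why
the listed edges must be proper. The self-loops of the query lie beyond the first `σ.int 1` entries
and are not visited. -/
theorem exec_countDegrees (O : Procedure) (σ : State) (c : ℕ → ℕ)
    (hE : ∀ p ∈ edgeList σ (σ.int 1), p.1 < σ.int 2 ∧ p.2 < σ.int 2 ∧ p.1 ≠ p.2)
    (hc : ∀ x < σ.int 2, σ.arr 4 x = c x)
    (h0 : ∀ x < σ.int 2, σ.arr 5 x = 0 ∧ σ.arr 6 x = 0) :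
    ∃ σ', Exec O countDegrees σ σ' ∧
      (∀ x < σ.int 2, σ'.arr 5 x = (edgeList σ (σ.int 1)).countP (fun p => p.1 = x ∨ p.2 = x) ∧
        σ'.arr 6 x = (edgeList σ (σ.int 1)).countP
          (fun p => c p.1 ≠ c p.2 ∧ (p.1 = x ∨ p.2 = x))) ∧
      σ'.time ≤ σ.time + 30 * σ.int 1 + 20 := by
  obtain ⟨σ', h1, h2, h3⟩ := exec_forLoop_denote (O := O) (i := 3) (N := 1)
    (body := .seq (block [.load 5 0 3, .load 6 1 3, .load 7 5 5, .inc 7, .store 5 5 7,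
    .load 7 5 6, .inc 7, .store 5 6 7, .load 7 4 5, .load 12 4 6])
    (.ite (.ieq 7 12) .skip
      (block [.load 7 6 5, .inc 7, .store 6 5 7, .load 7 6 6, .inc 7, .store 6 6 7])))
    (by decide) (by decide) (by decide) (by decide) σ
    (fun k τ => ∀ x < σ.int 2, τ.arr 5 x = (edgeList σ k).countP (fun p => p.1 = x ∨ p.2 = x) ∧
        τ.arr 6 x = (edgeList σ k).countP (fun p => c p.1 ≠ c p.2 ∧ (p.1 = x ∨ p.2 = x)))
    (fun k τ x t h => h) (by simpa [edgeList] using h0) (by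
      intro k hkN τ hF hk hI x hx
      have e0 : τ.arr 0 = σ.arr 0 := hF.arr 0 (by decide)
      have e1 : τ.arr 1 = σ.arr 1 := hF.arr 1 (by decide)
      have e4 : τ.arr 4 = σ.arr 4 := hF.arr 4 (by decide)
      obtain ⟨ha, hb, hab⟩ := hE _ (mem_edgeList hkN)
      simp only at ha hb hab
      have hI' := hI x hx
      rw [edgeList_succ, List.countP_append, List.countP_append, ← hI'.1, ← hI'.2]
      simp only [List.countP_singleton]
      have hca := hc _ ha
      have hcb := hc _ hb
      by_cases hcc : c (σ.arr 0 k) = c (σ.arr 1 k)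
      · rw [Program.denote, denote_ite_pos (by
          simp [Program.denote, block, Op.apply, State.tick, Function.update_apply, Test.holds,
            hk, e0, e1, e4, hca, hcb, hcc])]
        simp only [Program.denote, block, List.foldr, Op.apply, State.tick, Function.update_apply,
          hk, e0, e1, Nat.reduceEqDiff, ↓reduceIte]
        generalize σ.arr 0 k = a at *
        generalize σ.arr 1 k = b at *
        rcases eq_or_ne x a with rfl | hxa <;> rcases eq_or_ne x b with rfl | hxb
        · exact absurd rfl hab
        · simp [hcc, hxb]
        · simp [hcc, hxa]
        · simp [hcc, hxa, hxb, hxa.symm, hxb.symm]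
      · rw [Program.denote, denote_ite_neg (by
          simp [Program.denote, block, Op.apply, State.tick, Function.update_apply, Test.holds,
            hk, e0, e1, e4, hca, hcb, hcc])]
        simp only [Program.denote, block, List.foldr, Op.apply, State.tick, Function.update_apply,
          hk, e0, e1, Nat.reduceEqDiff, ↓reduceIte]
        generalize σ.arr 0 k = a at *
        generalize σ.arr 1 k = b at *
        rcases eq_or_ne x a with rfl | hxa <;> rcases eq_or_ne x b with rfl | hxb
        · exact absurd rfl hab
        · simp [hcc, hxb]
        · simp [hcc, hxa]
        · simp [hcc, hxa, hxb, hxa.symm, hxb.symm])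
  exact ⟨σ', h1, h2, h3.trans (by simp only [Program.cost, block, List.foldr]; omega)⟩

/-- Rename the labels of the vertices. -/
def updateLabels : Program :=
  forLoop 3 0 (block [.load 5 2 3, .dec 5, .load 6 8 5, .store 2 3 6])

theorem exec_updateLabels (O : Procedure) (σ : State) :
    ∃ σ', Exec O updateLabels σ σ' ∧
      (∀ v < σ.int 0, σ'.arr 2 v = σ.arr 8 (σ.arr 2 v - 1)) ∧
      σ'.time ≤ σ.time + 20 * σ.int 0 + 20 := by
  obtain ⟨σ', h1, h2, h3⟩ := exec_forLoop_denote (O := O) (i := 3) (N := 0)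
    (body := block [.load 5 2 3, .dec 5, .load 6 8 5, .store 2 3 6])
    (by decide) (by decide) (by decide) (by decide) σ
    (fun k τ => (∀ v < k, τ.arr 2 v = σ.arr 8 (σ.arr 2 v - 1)) ∧ ∀ v ≥ k, τ.arr 2 v = σ.arr 2 v)
    (fun k τ x t h => h) (by simp) (by
      intro k hkN τ hF hk hI
      have e8 : τ.arr 8 = σ.arr 8 := hF.arr 8 (by decide)
      have e2 := hI.2 k le_rfl
      simp only [Program.denote, block, List.foldr, Op.apply, State.tick, Function.update_apply,
        hk, e8, e2]
      refine ⟨fun v hv => ?_, fun v hv => ?_⟩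
      · by_cases hvk : v = k
        · simp [hvk]
        · simpa [hvk] using hI.1 v (by omega)
      · have hvk : v ≠ k := by omega
        simpa [hvk] using hI.2 v (by omega))
  exact ⟨σ', h1, h2.1, h3.trans (by simp only [Program.cost, block, List.foldr]; omega)⟩

/-- Rename the ends of the edges and discard the self-loops. -/
def filterEdges : Program :=
  .seq (.op (.zero 9)) (forLoop 3 1 (.seq
    (block [.load 5 0 3, .load 6 1 3, .load 5 8 5, .load 6 8 6])
    (.ite (.ieq 5 6) .skip (block [.dec 5, .dec 6, .store 0 9 5, .store 1 9 6, .inc 9]))))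

/-- The arrays are compacted in place. This is safe because the write position, register 9, never
exceeds the read position, so the entries still to be read are the original ones. -/
theorem exec_filterEdges (O : Procedure) (σ : State) :
    ∃ σ', Exec O filterEdges σ σ' ∧
      edgeList σ' (σ'.int 9) = ((edgeList σ (σ.int 1)).filter
        fun p => σ.arr 8 p.1 ≠ σ.arr 8 p.2).map
        (fun p => (σ.arr 8 p.1 - 1, σ.arr 8 p.2 - 1)) ∧
      σ'.time ≤ σ.time + 20 * σ.int 1 + 20 := by
  obtain ⟨σ', h1, h2, h3⟩ := exec_forLoop_denote (O := O) (i := 3) (N := 1)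
    (body := .seq (block [.load 5 0 3, .load 6 1 3, .load 5 8 5, .load 6 8 6])
      (.ite (.ieq 5 6) .skip (block [.dec 5, .dec 6, .store 0 9 5, .store 1 9 6, .inc 9])))
    (by decide) (by decide) (by decide) (by decide) ((Op.zero 9).apply O σ).tick
    (fun k τ => edgeList τ (τ.int 9) = ((edgeList σ k).filter
        fun p => σ.arr 8 p.1 ≠ σ.arr 8 p.2).map
        (fun p => (σ.arr 8 p.1 - 1, σ.arr 8 p.2 - 1)) ∧ τ.int 9 ≤ k ∧
        ∀ i ≥ k, τ.arr 0 i = σ.arr 0 i ∧ τ.arr 1 i = σ.arr 1 i)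
    (fun k τ x t h => by simpa [State.poke, edgeList] using h)
    (by simp [edgeList, Op.apply, State.tick]) (by
      intro k hkN τ hF hk ⟨hI1, hI2, hI3⟩
      have e8 : τ.arr 8 = σ.arr 8 := hF.arr 8 (by decide)
      have e0 := (hI3 k le_rfl).1
      have e1 := (hI3 k le_rfl).2
      rw [edgeList_succ, List.filter_append, List.map_append, ← hI1]
      by_cases hab : σ.arr 8 (σ.arr 0 k) = σ.arr 8 (σ.arr 1 k)
      · rw [Program.denote, denote_ite_pos (by
          simp [Program.denote, block, Op.apply, State.tick, Test.holds, hk, e0, e1, e8, hab])]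
        simp only [List.filter_singleton, hab, ne_eq, not_true_eq_false, decide_false,
          cond_false, List.map_nil, List.append_nil]
        exact ⟨rfl, by simp [Program.denote, block, Op.apply, State.tick]; omega,
          fun i hi => hI3 i (by omega)⟩
      · rw [Program.denote, denote_ite_neg (by
          simp [Program.denote, block, Op.apply, State.tick, Test.holds, hk, e0, e1, e8, hab])]
        simp only [Program.denote, block, List.foldr, Op.apply, State.tick, Function.update_apply,
          hk, e0, e1, e8, Nat.reduceEqDiff, ↓reduceIte]
        simp only [List.filter_singleton, hab, ne_eq, not_false_eq_true, decide_true, cond_true,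
          List.map_cons, List.map_nil]
        rw [edgeList_succ]
        refine ⟨?_, by omega, fun i hi => ?_⟩
        · congr 1
          · refine edgeList_congr fun i hi => ?_
            have : i ≠ τ.int 9 := by omega
            simp [this]
          · simp
        · have : i ≠ τ.int 9 := by omega
          simpa [this] using hI3 i (by omega))
  refine ⟨σ', .seq (.op _ _) h1, h2.1, h3.trans ?_⟩
  simp only [Program.cost, block, List.foldr, Op.apply, State.tick, Function.update_apply]
  simp
  omega

end Parts

/-! ### Writing the self-loops of a query and merging super-vertices -/

section Parts

/-- List the self-loops of the query after the edges. -/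
def appendLoops : Program :=
  .seq (block [.copy 4 1, .rmul 6 15 4])
    (forLoop 3 2 (.seq (block [.load 5 3 3, .rcast 9 5, .rmul 9 6 9, .zero 12, .rcast 10 12])
      (.loop (.rlt 10 9) (block [.store 0 4 3, .store 1 4 3, .inc 4, .inc 12, .rcast 10 12]))))

/-- The machine cannot round a real. Emitting loops while the count is below the real target stops
exactly at the ceiling. The original edges stay in front, so they are still available after the
call. -/
theorem exec_appendLoops (O : Procedure) (σ : State) :
    ∃ σ', Exec O appendLoops σ σ' ∧
      (∀ i < σ.int 1, σ'.arr 0 i = σ.arr 0 i ∧ σ'.arr 1 i = σ.arr 1 i) ∧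
      edgeList σ' (σ'.int 4) = edgeList σ (σ.int 1) ++ ((List.range (σ.int 2)).flatMap fun x =>
        List.replicate ⌈σ.real 15 * σ.real 4 * (σ.arr 3 x : ℝ)⌉₊ (x, x)) ∧
      σ'.time ≤ σ.time + 20 * ∑ x ∈ Finset.range (σ.int 2),
        ⌈σ.real 15 * σ.real 4 * (σ.arr 3 x : ℝ)⌉₊ + 20 * σ.int 2 + 20 := by
  set L : ℕ → ℕ := fun x => ⌈σ.real 15 * σ.real 4 * (σ.arr 3 x : ℝ)⌉₊ with hL
  set σ₀ := (block [.copy 4 1, .rmul 6 15 4]).denote O σ with hσ₀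
  have hσ₀2 : σ₀.int 2 = σ.int 2 := by
    simp [hσ₀, Program.denote, block, Op.apply, State.tick]
  obtain ⟨σ', h1, h2, h3⟩ := exec_forLoop (O := O) (i := 3) (N := 2)
    (body := .seq (block [.load 5 3 3, .rcast 9 5, .rmul 9 6 9, .zero 12, .rcast 10 12])
      (.loop (.rlt 10 9) (block [.store 0 4 3, .store 1 4 3, .inc 4, .inc 12, .rcast 10 12])))
    (by decide) (by decide) (by decide) σ₀
    (fun k τ => σ.int 1 ≤ τ.int 4 ∧
      (∀ i < σ.int 1, τ.arr 0 i = σ.arr 0 i ∧ τ.arr 1 i = σ.arr 1 i) ∧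
      edgeList τ (τ.int 4) = edgeList σ (σ.int 1) ++ (List.range k).flatMap fun x =>
        List.replicate (L x) (x, x)) (fun x => 10 * L x + 10)
    (fun k τ x t h => by simpa [State.poke, edgeList] using h)
    (by simp [hσ₀, Program.denote, block, Op.apply, State.tick, edgeList])
    (by
      rintro k hk τ hF hτk ⟨hI1, hI2, hI3⟩
      have e3 : τ.arr 3 = σ.arr 3 := hF.arr 3 (by decide)
      have e6 : τ.real 6 = σ.real 15 * σ.real 4 := (hF.real 6 (by decide)).trans (by
        simp [hσ₀, Program.denote, block, Op.apply, State.tick])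
      set τ₀ := (block [.load 5 3 3, .rcast 9 5, .rmul 9 6 9, .zero 12, .rcast 10 12]).denote O τ
        with hτ₀
      have ht0 : τ₀.time = τ.time + 5 := by
        simp [hτ₀, Program.denote, block, Op.apply, State.tick]
      obtain ⟨τ', h1, h2, h3⟩ := exec_loop (O := O) (b := .rlt 10 9)
        (body := block [.store 0 4 3, .store 1 4 3, .inc 4, .inc 12, .rcast 10 12])
        (fun j ρ => ρ.int 3 = k ∧ ρ.real 9 = σ.real 15 * σ.real 4 * (σ.arr 3 k : ℝ) ∧
          ρ.int 12 = j ∧ ρ.real 10 = j ∧ σ.int 1 ≤ ρ.int 4 ∧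
          (∀ i < σ.int 1, ρ.arr 0 i = σ.arr 0 i ∧ ρ.arr 1 i = σ.arr 1 i) ∧
          edgeList ρ (ρ.int 4) = edgeList τ (τ.int 4) ++ List.replicate j (k, k)) (fun _ => 6) (L k)
        (by
          rintro j hj ρ ⟨g3, g9, g12, g10, g4, gA, gE⟩
          refine ⟨?_, _, exec_denote O (by decide) _, ?_,
            (time_denote O _ _).trans (by simp [Program.cost, block, State.tick])⟩
          · rw [Test.holds, g9, g10]
            exact Nat.lt_ceil.1 hj
          · simp only [Program.denote, block, List.foldr, Op.apply, State.tick,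
              Function.update_apply, g3, g9, g12, Nat.reduceEqDiff, ↓reduceIte]
            refine ⟨trivial, trivial, trivial, trivial, by omega, fun i hi => ?_, ?_⟩
            · have : i ≠ ρ.int 4 := by omega
              simpa [this] using gA i hi
            · rw [edgeList_succ, List.replicate_succ', ← List.append_assoc, ← gE]
              congr 1
              · refine edgeList_congr fun i hi => ?_
                have : i ≠ ρ.int 4 := by omega
                simp [this]
              · simp)
        (by
          rintro ρ ⟨-, g9, -, g10, -⟩
          rw [Test.holds, g9, g10, not_lt]
          exact Nat.le_ceil _)
        (fun ρ h => h) (σ₀ := τ₀) (by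
          have e : edgeList τ₀ (τ₀.int 4) = edgeList τ (τ.int 4) := by
            simp [hτ₀, Program.denote, block, Op.apply, State.tick, edgeList]
          rw [e, List.replicate_zero, List.append_nil]
          simp only [hτ₀, Program.denote, block, List.foldr, Op.apply, State.tick,
            Function.update_apply, Nat.reduceEqDiff, ↓reduceIte, e6, e3, hτk]
          exact ⟨trivial, trivial, trivial, by simp, hI1, hI2, trivial⟩)
      refine ⟨τ', .seq (exec_denote O (by decide) τ) h1,
        ⟨h2.2.2.2.2.1, h2.2.2.2.2.2.1, ?_⟩, ?_⟩
      · rw [h2.2.2.2.2.2.2, hI3, List.range_succ, List.flatMap_append, List.append_assoc]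
        simp
      · simp only [Finset.sum_const, Finset.card_range, smul_eq_mul] at h3
        omega)
  rw [hσ₀2] at h2 h3
  refine ⟨σ', .seq (exec_denote O (by decide) σ) h1, h2.2.1, h2.2.2, h3.trans ?_⟩
  have ht0 : σ₀.time = σ.time + 2 := by
    simp [hσ₀, Program.denote, block, Op.apply, State.tick]
  have hsum : ∑ k ∈ Finset.range (σ.int 2), (10 * L k + 10 + 2) =
      10 * (Finset.range (σ.int 2)).sum L + 12 * σ.int 2 := by
    simp only [Finset.sum_add_distrib, ← Finset.mul_sum, Finset.sum_const, Finset.card_range,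
      smul_eq_mul]
    ring
  rw [hsum]
  omega

/-- `new` numbers the merged super-vertices among the first `k` ones by `1, …, cnt`, and `rep i` is
the number of the merged super-vertex in cluster `i`, or `0` if there is none yet. -/
structure Relabel (kept : ℕ → Prop) (c : ℕ → ℕ) (N k cnt : ℕ) (rep new : ℕ → ℕ) : Prop where
  pos : ∀ x < k, 1 ≤ new x ∧ new x ≤ cnt
  rep_eq : ∀ x < k, kept x → rep (c x) = new x
  exists_of_rep : ∀ i < N, rep i ≠ 0 → ∃ x < k, kept x ∧ c x = i
  inj : ∀ x < k, ∀ y < k, new x = new y ↔ (x = y ∨ (kept x ∧ kept y ∧ c x = c y))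
  surj : ∀ j, 1 ≤ j → j ≤ cnt → ∃ x < k, new x = j

namespace Relabel

variable {kept : ℕ → Prop} {c : ℕ → ℕ} {N k cnt : ℕ} {rep new : ℕ → ℕ}

/-- Case of a shaved super-vertex: the unused number `cnt + 1` keeps it apart from all others. -/
theorem fresh (h : Relabel kept c N k cnt rep new) (hk : ¬ kept k) :
    Relabel kept c N (k + 1) (cnt + 1) rep (Function.update new k (cnt + 1)) where
  pos x hx := by
    rcases eq_or_ne x k with rfl | hxk
    · simp
    · rw [Function.update_of_ne hxk]
      have := h.pos x (by omega); omega
  rep_eq x hx hkx := by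
    have hxk : x ≠ k := by rintro rfl; exact hk hkx
    rw [Function.update_of_ne hxk]
    exact h.rep_eq x (by omega) hkx
  exists_of_rep i hi hr := by
    obtain ⟨x, hx, h'⟩ := h.exists_of_rep i hi hr
    exact ⟨x, by omega, h'⟩
  inj x hx y hy := by
    rcases eq_or_ne x k with rfl | hxk <;> rcases eq_or_ne y x with rfl | hyx
    · simp
    · have := h.pos y (by omega)
      simp only [Function.update_self, Function.update_of_ne hyx, hk, false_and, or_false]
      omega
    · simp
    · rw [Function.update_of_ne hxk]
      rcases eq_or_ne y k with rfl | hyk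
      · have := h.pos x (by omega)
        simp only [Function.update_self, hk, false_and, and_false, or_false]
        omega
      · rw [Function.update_of_ne hyk]
        exact h.inj x (by omega) y (by omega)
  surj j hj hj' := by
    rcases eq_or_ne j (cnt + 1) with rfl | hne
    · exact ⟨k, by omega, by simp⟩
    · obtain ⟨x, hx, h'⟩ := h.surj j hj (by omega)
      exact ⟨x, by omega, by rw [Function.update_of_ne (by omega), h']⟩

/-- An earlier kept super-vertex of the same cluster would have left its positive label in `rep (c
k)`. So `k` is the first one there, and a new number is correct. -/
theorem merge_first (h : Relabel kept c N k cnt rep new) (hk : kept k) (hr : rep (c k) = 0) :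
    Relabel kept c N (k + 1) (cnt + 1) (Function.update rep (c k) (cnt + 1))
      (Function.update new k (cnt + 1)) where
  pos x hx := by
    rcases eq_or_ne x k with rfl | hxk
    · simp
    · rw [Function.update_of_ne hxk]
      have := h.pos x (by omega); omega
  rep_eq x hx hkx := by
    rcases eq_or_ne x k with rfl | hxk
    · simp
    · have h1 := h.rep_eq x (by omega) hkx
      have h2 := h.pos x (by omega)
      rw [Function.update_of_ne hxk, Function.update_of_ne, h1]
      intro hc
      rw [hc] at h1; omega
  exists_of_rep i hi hr := by
    rcases eq_or_ne i (c k) with rfl | hne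
    · exact ⟨k, by omega, hk, rfl⟩
    · rw [Function.update_of_ne hne] at hr
      obtain ⟨x, hx, h'⟩ := h.exists_of_rep i hi hr
      exact ⟨x, by omega, h'⟩
  inj x hx y hy := by
    have key : ∀ z < k, kept z → c z ≠ c k := by
      intro z hz hkz hc
      have h1 := h.rep_eq z hz hkz
      have h2 := h.pos z hz
      rw [hc] at h1; omega
    rcases eq_or_ne x k with rfl | hxk <;> rcases eq_or_ne y x with rfl | hyx
    · simp
    · have h1 := h.pos y (by omega)
      have h2 := key y (by omega)
      simp only [Function.update_self, Function.update_of_ne hyx]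
      constructor
      · omega
      · rintro (h | ⟨-, h3, h4⟩)
        · exact absurd h.symm hyx
        · exact absurd h4.symm (h2 h3)
    · simp
    · rw [Function.update_of_ne hxk]
      rcases eq_or_ne y k with rfl | hyk
      · have h1 := h.pos x (by omega)
        have h2 := key x (by omega)
        simp only [Function.update_self]
        constructor
        · omega
        · rintro (h | ⟨h3, -, h4⟩)
          · exact absurd h hxk
          · exact absurd h4 (h2 h3)
      · rw [Function.update_of_ne hyk]
        exact h.inj x (by omega) y (by omega)
  surj j hj hj' := by
    rcases eq_or_ne j (cnt + 1) with rfl | hne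
    · exact ⟨k, by omega, by simp⟩
    · obtain ⟨x, hx, h'⟩ := h.surj j hj (by omega)
      exact ⟨x, by omega, by rw [Function.update_of_ne (by omega), h']⟩

/-- A non-zero `rep (c k)` is the label of some earlier kept `z` in the same cluster, so copying it
identifies `k` with exactly the right super-vertices. -/
theorem merge_next (h : Relabel kept c N k cnt rep new) (hk : kept k) (hck : c k < N)
    (hr : rep (c k) ≠ 0) :
    Relabel kept c N (k + 1) cnt rep (Function.update new k (rep (c k))) := by
  obtain ⟨z, hz, hkz, hcz⟩ := h.exists_of_rep _ hck hr
  have hrz : rep (c k) = new z := hcz ▸ h.rep_eq z hz hkz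
  have hpz := h.pos z hz
  rw [hrz]
  refine ⟨fun x hx => ?_, fun x hx hkx => ?_, fun i hi hr => ?_, fun x hx y hy => ?_,
    fun j hj hj' => ?_⟩
  · rcases eq_or_ne x k with rfl | hxk
    · simpa using hpz
    · rw [Function.update_of_ne hxk]
      exact h.pos x (by omega)
  · rcases eq_or_ne x k with rfl | hxk
    · simpa using hrz
    · rw [Function.update_of_ne hxk]
      exact h.rep_eq x (by omega) hkx
  · obtain ⟨x, hx, h'⟩ := h.exists_of_rep i hi hr
    exact ⟨x, by omega, h'⟩
  · have key : ∀ y < k, new z = new y ↔ (kept y ∧ c k = c y) := by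
      intro y hy
      rw [h.inj z hz y hy, hcz]
      constructor
      · rintro (rfl | ⟨-, h1, h2⟩)
        · exact ⟨hkz, hcz.symm⟩
        · exact ⟨h1, h2⟩
      · exact fun h => Or.inr ⟨hkz, h⟩
    rcases eq_or_ne x k with rfl | hxk <;> rcases eq_or_ne y x with rfl | hyx
    · simp
    · rw [Function.update_self, Function.update_of_ne hyx, key y (by omega)]
      simp [hk, hyx.symm]
    · simp
    · rw [Function.update_of_ne hxk]
      rcases eq_or_ne y k with rfl | hyk
      · rw [Function.update_self, eq_comm, key x (by omega)]
        simp [hk, hxk, eq_comm]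
      · rw [Function.update_of_ne hyk]
        exact h.inj x (by omega) y (by omega)
  · obtain ⟨x, hx, h'⟩ := h.surj j hj hj'
    exact ⟨x, by omega, by rw [Function.update_of_ne (by omega), h']⟩

end Relabel

/-- Give the super-vertex a label of its own. -/
def freshLabel : Program := block [.inc 8, .store 8 3 8]

/-- Give the super-vertex the label of the kept super-vertices of its cluster. -/
def mergedLabel : Program :=
  .seq (block [.load 5 4 3, .load 6 7 5])
    (.ite (.ieq 6 11) (block [.inc 8, .store 7 5 8, .store 8 3 8]) (block [.store 8 3 6]))

/-- Compute the degree of a super-vertex and the two parts of its threshold. -/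
def readDegrees : Program :=
  block [.load 5 5 3, .rcast 9 5, .load 5 3 3, .rcast 10 5, .rmul 10 7 10, .load 5 6 3,
    .rcast 12 5, .rmul 12 8 12]

/-- Compute the labels of the super-vertices of the next contraction. -/
def relabel : Program :=
  .seq (block [.zero 8, .rmul 7 13 4])
    (forLoop 3 2 (.seq readDegrees
      (.ite (.rlt 9 10) freshLabel (.ite (.rlt 9 12) freshLabel mergedLabel))))

/-- The super-vertex `x` reaches the threshold. -/
def KeptAt (σ : State) (x : ℕ) : Prop :=
  ¬ (σ.arr 5 x : ℝ) < σ.real 13 * σ.real 4 * (σ.arr 3 x : ℝ) ∧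
    ¬ (σ.arr 5 x : ℝ) < σ.real 8 * (σ.arr 6 x : ℝ)

theorem exec_relabel (O : Procedure) (σ : State) (c : ℕ → ℕ) (h11 : σ.int 11 = 0)
    (hc : ∀ x < σ.int 2, σ.arr 4 x = c x ∧ c x < σ.int 2) (h0 : ∀ x < σ.int 2, σ.arr 7 x = 0) :
    ∃ σ', Exec O relabel σ σ' ∧
      Relabel (KeptAt σ) c (σ.int 2) (σ.int 2) (σ'.int 8) (σ'.arr 7) (σ'.arr 8) ∧
      σ'.time ≤ σ.time + 40 * σ.int 2 + 20 := by
  set σ₀ := (block [.zero 8, .rmul 7 13 4]).denote O σ with hσ₀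
  have hσ₀2 : σ₀.int 2 = σ.int 2 := by
    simp [hσ₀, Program.denote, block, Op.apply, State.tick]
  obtain ⟨σ', h1, h2, h3⟩ := exec_forLoop_denote (O := O) (i := 3) (N := 2)
    (body := .seq readDegrees
      (.ite (.rlt 9 10) freshLabel (.ite (.rlt 9 12) freshLabel mergedLabel)))
    (by decide) (by decide) (by decide) (by decide) σ₀
    (fun k τ => Relabel (KeptAt σ) c (σ.int 2) k (τ.int 8) (τ.arr 7) (τ.arr 8))
    (fun k τ x t h => by simpa [State.poke] using h)
    (by
      have e7 : σ₀.arr 7 = σ.arr 7 := by simp [hσ₀, Program.denote, block, Op.apply, State.tick]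
      have e8 : σ₀.int 8 = 0 := by simp [hσ₀, Program.denote, block, Op.apply, State.tick]
      refine ⟨by simp, by simp, fun i hi hr => absurd (by rw [e7]; exact h0 i hi) hr, by simp, ?_⟩
      intro j hj hj'
      rw [e8] at hj'
      omega)
    (by
      intro k hkN τ hF hk hI
      rw [hσ₀2] at hkN
      have e3 : τ.arr 3 = σ.arr 3 := hF.arr 3 (by decide)
      have e4 : τ.arr 4 = σ.arr 4 := hF.arr 4 (by decide)
      have e5 : τ.arr 5 = σ.arr 5 := hF.arr 5 (by decide)
      have e6 : τ.arr 6 = σ.arr 6 := hF.arr 6 (by decide)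
      have i11 : τ.int 11 = 0 := (hF.int 11 (by decide)).trans (by
        simp [hσ₀, Program.denote, block, Op.apply, State.tick, h11])
      have r7 : τ.real 7 = σ.real 13 * σ.real 4 := (hF.real 7 (by decide)).trans (by
        simp [hσ₀, Program.denote, block, Op.apply, State.tick])
      have r8 : τ.real 8 = σ.real 8 := (hF.real 8 (by decide)).trans (by
        simp [hσ₀, Program.denote, block, Op.apply, State.tick])
      set ρ := readDegrees.denote O τ with hρ
      have g9 : ρ.real 9 = (σ.arr 5 k : ℝ) := by
        simp [hρ, readDegrees, Program.denote, block, Op.apply, State.tick, hk, e5]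
      have g10 : ρ.real 10 = σ.real 13 * σ.real 4 * (σ.arr 3 k : ℝ) := by
        simp [hρ, readDegrees, Program.denote, block, Op.apply, State.tick, hk, e3, r7]
      have g12 : ρ.real 12 = σ.real 8 * (σ.arr 6 k : ℝ) := by
        simp [hρ, readDegrees, Program.denote, block, Op.apply, State.tick, hk, e6, r8]
      have gF : Frame readDegrees τ ρ := (exec_denote O (by decide) τ).frame
      have g3 : ρ.int 3 = k := (gF.int 3 (by decide)).trans hk
      have g8 : ρ.int 8 = τ.int 8 := gF.int 8 (by decide)
      have g11 : ρ.int 11 = 0 := (gF.int 11 (by decide)).trans i11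
      have gA4 : ρ.arr 4 = σ.arr 4 := (gF.arr 4 (by decide)).trans e4
      have gA7 : ρ.arr 7 = τ.arr 7 := gF.arr 7 (by decide)
      have gA8 : ρ.arr 8 = τ.arr 8 := gF.arr 8 (by decide)
      rw [Program.denote, ← hρ]
      by_cases hb1 : ρ.real 9 < ρ.real 10
      · rw [denote_ite_pos (b := .rlt 9 10) hb1]
        have hnk : ¬ KeptAt σ k := fun h => h.1 (by rwa [g9, g10] at hb1)
        simp only [freshLabel, Program.denote, block, List.foldr, Op.apply, State.tick,
          Function.update_self, Function.update_of_ne, g3, g8, gA7, gA8, ne_eq, Nat.reduceEqDiff,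
          not_false_eq_true]
        exact hI.fresh hnk
      rw [denote_ite_neg (b := .rlt 9 10) hb1]
      by_cases hb2 : ρ.real 9 < ρ.real 12
      · rw [denote_ite_pos (b := .rlt 9 12) (σ := ρ.tick) hb2]
        have hnk : ¬ KeptAt σ k := fun h => h.2 (by rwa [g9, g12] at hb2)
        simp only [freshLabel, Program.denote, block, List.foldr, Op.apply, State.tick,
          Function.update_self, Function.update_of_ne, g3, g8, gA7, gA8, ne_eq, Nat.reduceEqDiff,
          not_false_eq_true]
        exact hI.fresh hnk
      rw [denote_ite_neg (b := .rlt 9 12) (σ := ρ.tick) hb2]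
      have hkk : KeptAt σ k := ⟨by rwa [g9, g10] at hb1, by rwa [g9, g12] at hb2⟩
      obtain ⟨hc1, hc2⟩ := hc k hkN
      by_cases hb3 : τ.arr 7 (c k) = 0
      · rw [mergedLabel, Program.denote, denote_ite_pos (by
          simp [Program.denote, block, Op.apply, State.tick, Test.holds, g3, g11, gA4, gA7, hc1,
            hb3])]
        simp only [Program.denote, block, List.foldr, Op.apply, State.tick,
          Function.update_self, Function.update_of_ne, g3, g8, gA4, gA7, gA8, hc1, ne_eq,
          Nat.reduceEqDiff, not_false_eq_true]
        exact hI.merge_first hkk hb3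
      · rw [mergedLabel, Program.denote, denote_ite_neg (by
          simp [Program.denote, block, Op.apply, State.tick, Test.holds, g3, g11, gA4, gA7, hc1,
            hb3])]
        simp only [Program.denote, block, List.foldr, Op.apply, State.tick,
          Function.update_self, Function.update_of_ne, g3, g8, gA4, gA7, gA8, hc1, ne_eq,
          Nat.reduceEqDiff, not_false_eq_true]
        exact hI.merge_next hkk hc2 hb3)
  rw [hσ₀2] at h2 h3
  refine ⟨σ', .seq (exec_denote O (by decide) σ) h1, h2, h3.trans ?_⟩
  have ht0 : σ₀.time = σ.time + 2 := by
    simp [hσ₀, Program.denote, block, Op.apply, State.tick]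
  simp only [Program.cost, block, List.foldr, readDegrees, freshLabel, mergedLabel]
  omega

end Parts

/-! ### Correctness and running time of one round of the program -/

section RoundProgram

/-- Each `x < N` occurs with `L x` self-loops. -/
def loopList (N : ℕ) (L : ℕ → ℕ) : List (ℕ × ℕ) :=
  (List.range N).flatMap fun x => List.replicate (L x) (x, x)

theorem mem_loopList {N : ℕ} {L : ℕ → ℕ} {p : ℕ × ℕ} (h : p ∈ loopList N L) :
    p.1 < N ∧ p.1 = p.2 := by
  simp only [loopList, List.mem_flatMap, List.mem_range, List.mem_replicate] at h
  obtain ⟨x, hx, -, rfl⟩ := h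
  exact ⟨hx, rfl⟩

theorem countP_loopList (N : ℕ) (L : ℕ → ℕ) (x : ℕ) :
    (loopList N L).countP (fun p => p.1 = x ∧ p.2 = x) = if x < N then L x else 0 := by
  induction N with
  | zero => simp [loopList]
  | succ N ih =>
    have : loopList (N + 1) L = loopList N L ++ List.replicate (L N) (N, N) := by
      simp [loopList, List.range_succ]
    rw [this, List.countP_append, ih, List.countP_replicate]
    rcases lt_trichotomy x N with h | rfl | h
    · simp [h, h.ne', Nat.lt_succ_of_lt h]
    · simp
    · simp [h.ne, not_lt.2 h.le, not_lt.2 (Nat.succ_le_of_lt h)]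

theorem countP_loopList_eq_zero {N : ℕ} {L : ℕ → ℕ} {r : ℕ × ℕ → Prop} [DecidablePred r]
    (hr : ∀ p, r p → p.1 ≠ p.2) : (loopList N L).countP (fun p => r p) = 0 :=
  List.countP_eq_zero.2 fun p hp h => hr p (by simpa using h) (mem_loopList hp).2

variable {n : ℕ} {G : SimpleGraph (Fin n)} {f : Fin n → ℕ} {N : ℕ} {E : List (ℕ × ℕ)}

theorem IsContractionBy.append_loopList
    (h : Multigraph.IsContractionBy ⟨Finset.range N, E⟩ G f) (L : ℕ → ℕ) :
    Multigraph.IsContractionBy ⟨Finset.range N, E ++ loopList N L⟩ G f := by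
  refine ⟨h.1, fun p hp => ?_, fun x y hxy => ?_⟩
  · rcases List.mem_append.1 hp with hp | hp
    · exact h.2.1 p hp
    · have := mem_loopList hp
      simp only [Finset.mem_range, ← this.2, and_self]
      exact this.1
  · rw [← h.2.2 x y hxy]
    change (E ++ loopList N L).countP _ = E.countP _
    rw [List.countP_append, countP_loopList_eq_zero, add_zero]
    intro p hp hpp
    rw [hpp] at hp
    rcases Sym2.eq_iff.1 hp with ⟨h1, h2⟩ | ⟨h1, h2⟩
    · exact hxy (h1.symm.trans h2)
    · exact hxy (h2.symm.trans h1)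

theorem IsContractionBy.map_filter {V : Finset ℕ}
    (h : Multigraph.IsContractionBy ⟨V, E⟩ G f) (g : ℕ → ℕ) :
    Multigraph.IsContractionBy ⟨V.image g, (E.filter fun p => g p.1 ≠ g p.2).map
      fun p => (g p.1, g p.2)⟩ G (fun v => g (f v)) := by
  refine ⟨fun x => ?_, fun p hp => ?_, fun x y hxy => ?_⟩
  · simp only [Finset.mem_image]
    constructor
    · rintro ⟨z, hz, rfl⟩
      obtain ⟨v, rfl⟩ := (h.1 z).1 hz
      exact ⟨v, rfl⟩
    · rintro ⟨v, rfl⟩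
      exact ⟨f v, (h.1 _).2 ⟨v, rfl⟩, rfl⟩
  · obtain ⟨q, hq, rfl⟩ := List.mem_map.1 hp
    have := h.2.1 q (List.mem_filter.1 hq).1
    exact ⟨Finset.mem_image_of_mem _ this.1, Finset.mem_image_of_mem _ this.2⟩
  · have h1 := h.countP_eq (fun e => Sym2.map g e = s(x, y)) (by
      intro z hz
      rw [Sym2.map_mk] at hz
      rcases Sym2.eq_iff.1 hz with ⟨h1, h2⟩ | ⟨h1, h2⟩
      · exact hxy (h1.symm.trans h2)
      · exact hxy (h2.symm.trans h1))
    have h2 : {e ∈ G.edgeSet | Sym2.map (fun v => g (f v)) e = s(x, y)} =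
        {e ∈ G.edgeSet | Sym2.map g (Sym2.map f e) = s(x, y)} := by
      ext e
      rw [Set.mem_ofPred_eq, Set.mem_ofPred_eq, Sym2.map_map]
      rfl
    rw [h2, ← h1]
    change ((E.filter fun p => g p.1 ≠ g p.2).map fun p => (g p.1, g p.2)).countP _ = E.countP _
    rw [List.countP_map, List.countP_filter]
    refine List.countP_congr fun p _ => ?_
    simp only [Function.comp, Bool.and_eq_true, decide_eq_true_eq]
    change _ ↔ s(g p.1, g p.2) = s(x, y)
    refine ⟨fun h => h.1, fun h => ⟨h, fun hg => ?_⟩⟩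
    rw [hg] at h
    rcases Sym2.eq_iff.1 h with ⟨h1, h2⟩ | ⟨h1, h2⟩
    · exact hxy (h1.symm.trans h2)
    · exact hxy (h2.symm.trans h1)

/-- One round of the construction, without slack. -/
def roundProgram : Program :=
  .seq clearCounters <| .seq countSizes <| .seq appendLoops <| .seq (.op (.call 2 4 0 1 5 4)) <|
  .seq countDegrees <| .seq relabel <| .seq updateLabels <| .seq filterEdges <|
  block [.copy 1 9, .copy 2 8]

/-- The memory describes the contraction given by `f`, and `s` is the current `√w_j`. -/
structure Head (G : SimpleGraph (Fin n)) (α β w φ s : ℝ) (f : Fin n → ℕ) (σ : State) : Prop where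
  int0 : σ.int 0 = n
  int11 : σ.int 11 = 0
  label : ∀ v : Fin n, σ.arr 2 v = f v + 1
  contraction : Multigraph.IsContractionBy ⟨Finset.range (σ.int 2), edgeList σ (σ.int 1)⟩ G f
  proper : ∀ p ∈ edgeList σ (σ.int 1), p.1 ≠ p.2
  real2 : σ.real 2 = w
  real4 : σ.real 4 = s
  real5 : σ.real 5 = 0.01 * (α * β)
  real8 : σ.real 8 = 4 * α⁻¹
  real13 : σ.real 13 = 10 * α⁻¹
  real15 : σ.real 15 = (0.01 * (α * β) / φ)⁻¹
  real16 : σ.real 16 = 2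

/-- No self-loops are stored between rounds. Thus the length of the edge list, which governs the
running time, is controlled by the edge bound. -/
theorem Head.int1 {α β w φ s : ℝ} {σ : State} (h : Head G α β w φ s f σ) :
    σ.int 1 = survivors G f := by
  rw [← h.contraction.countP_proper]
  have : (edgeList σ (σ.int 1)).length = σ.int 1 := by simp [edgeList]
  conv_lhs => rw [← this]
  symm
  rw [List.countP_eq_length]
  exact fun p hp => by simpa using h.proper p hp

theorem Head.int2 {α β w φ s : ℝ} {σ : State} (h : Head G α β w φ s f σ) : σ.int 2 ≤ n := by
  simpa using h.contraction.card_verts_le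

theorem card_filter_range_eq_size {σ : State} (h : ∀ v : Fin n, σ.arr 2 v = f v + 1) (x : ℕ) :
    ((Finset.range n).filter fun v => σ.arr 2 v = x + 1).card = size f x := by
  symm
  refine Finset.card_bij (fun v _ => v.val) ?_ ?_ ?_
  · intro v hv
    have := (Finset.mem_filter.1 hv).2
    simp [h, this]
  · exact fun _ _ _ _ e => Fin.ext e
  · intro v hv
    have hv := Finset.mem_filter.1 hv
    have hvn := Finset.mem_range.1 hv.1
    refine ⟨⟨v, hvn⟩, ?_, rfl⟩
    have := h ⟨v, hvn⟩
    simp only at this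
    simp
    omega

/-- All passes are linear in the query, self-loops included. The answer of the procedure becomes the
clustering in `Round`, and the kept set consists of all super-vertices that reach the threshold. -/
theorem exec_roundProgram {O : Procedure} {α β w φ s : ℝ} (hO : O.Decomposes G φ) (hα : 0 < α)
    (hα' : α < 1 / 4) (hβ : 0 < β) (hβ' : β < 1) {σ : State} (h : Head G α β w φ s f σ) :
    ∃ σ' f', Exec O roundProgram σ σ' ∧ Round G α β φ s f f' ∧ Head G α β w φ s f' σ' ∧
      (∃ q, σ'.calls = σ.calls ++ [q] ∧ q.1.IsContraction G ∧ 0 < q.2 ∧ q.2 < 1) ∧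
      σ'.time ≤ σ.time + 200 * (survivors G f + n + ∑ x ∈ Finset.range (σ.int 2),
        ⌈(0.01 * (α * β) / φ)⁻¹ * s * (size f x : ℝ)⌉₊ + 1) := by
  set N := σ.int 2 with hN
  set M := σ.int 1 with hM
  set ε : ℝ := 0.01 * (α * β) with hε
  set L : ℕ → ℕ := fun x => ⌈(ε / φ)⁻¹ * s * (size f x : ℝ)⌉₊ with hL
  have hε0 : 0 < ε := by positivity
  have hε1 : ε < 1 := by rw [hε]; nlinarith
  have hfN : ∀ v, f v < N := fun v => Finset.mem_range.1 ((h.contraction.1 _).2 ⟨v, rfl⟩)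
  have hEN : ∀ p ∈ edgeList σ M, p.1 < N ∧ p.2 < N := fun p hp => by
    simpa using h.contraction.2.1 p hp
  obtain ⟨σ₁, hx1, hs1, ht1⟩ := exec_clearCounters O σ h.int11
  have F1 := hx1.frame
  have l1 : σ₁.arr 2 = σ.arr 2 := F1.arr 2 (by decide)
  have n1 : σ₁.int 0 = n := (F1.int 0 (by decide)).trans h.int0
  have N1 : σ₁.int 2 = N := F1.int 2 (by decide)
  obtain ⟨σ₂, hx2, hs2, ht2⟩ := exec_countSizes O σ₁ (by
    intro v hv
    rw [n1] at hv
    rw [l1, N1, h.label ⟨v, hv⟩]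
    have := hfN ⟨v, hv⟩
    omega) (by rw [N1]; exact fun x hx => (hs1 x hx).1)
  have F2 := hx2.frame
  have N2 : σ₂.int 2 = N := (F2.int 2 (by decide)).trans N1
  have hsize2 : ∀ x < N, σ₂.arr 3 x = size f x := by
    intro x hx
    rw [hs2 x (by rwa [N1]), n1]
    exact card_filter_range_eq_size (fun v => by rw [l1]; exact h.label v) x
  obtain ⟨σ₃, hx3, hs3, hE3, ht3⟩ := exec_appendLoops O σ₂
  have F3 := hx3.frame
  have M2 : σ₂.int 1 = M := (F2.int 1 (by decide)).trans (F1.int 1 (by decide))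
  have r42 : σ₂.real 4 = s := (F2.real 4 (by decide)).trans ((F1.real 4 (by decide)).trans h.real4)
  have r152 : σ₂.real 15 = (ε / φ)⁻¹ :=
    (F2.real 15 (by decide)).trans ((F1.real 15 (by decide)).trans h.real15)
  have E2 : edgeList σ₂ M = edgeList σ M := edgeList_congr fun i _ => by
    rw [F2.arr 0 (by decide), F2.arr 1 (by decide), F1.arr 0 (by decide), F1.arr 1 (by decide)]
    exact ⟨rfl, rfl⟩
  have hLx : ∀ x < N, ⌈σ₂.real 15 * σ₂.real 4 * (σ₂.arr 3 x : ℝ)⌉₊ = L x := fun x hx => by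
    rw [r42, r152, hsize2 x hx]
  have hE3' : edgeList σ₃ (σ₃.int 4) = edgeList σ M ++ loopList N L := by
    rw [hE3, M2, N2, E2, loopList]
    congr 1
    refine List.flatMap_congr fun x hx => ?_
    rw [hLx x (List.mem_range.1 hx)]
  have hsum3 : ∑ x ∈ Finset.range (σ₂.int 2), ⌈σ₂.real 15 * σ₂.real 4 * (σ₂.arr 3 x : ℝ)⌉₊ =
      (Finset.range N).sum L := by
    rw [N2]
    exact Finset.sum_congr rfl fun x hx => hLx x (Finset.mem_range.1 hx)
  have N3 : σ₃.int 2 = N := (F3.int 2 (by decide)).trans N2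
  have M3 : σ₃.int 1 = M := (F3.int 1 (by decide)).trans M2
  set Q : Multigraph := ⟨Finset.range N, edgeList σ M ++ loopList N L⟩ with hQ
  have hQeq : Multigraph.ofArrays (σ₃.int 2) (σ₃.int 4) (σ₃.arr 0) (σ₃.arr 1) = Q := by
    rw [hQ, ← hE3', Multigraph.ofArrays, N3, edgeList]
  have hQc : Q.IsContractionBy G f := IsContractionBy.append_loopList h.contraction L
  have r53 : σ₃.real 5 = ε := (F3.real 5 (by decide)).trans
    ((F2.real 5 (by decide)).trans ((F1.real 5 (by decide)).trans h.real5))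
  set c := O σ₃.calls.length Q ε with hc
  have hdec : Q.IsExpanderDecomposition ε (ε / φ) c := hO _ Q ε ⟨f, hQc⟩ hε0 hε1
  set σ₄ := ((Op.call 2 4 0 1 5 4).apply O σ₃).tick with hσ₄
  have hx4 : Exec O (.op (.call 2 4 0 1 5 4)) σ₃ σ₄ := .op _ _
  have F4 := hx4.frame
  have ht4 : σ₄.time = σ₃.time + 1 := rfl
  have c4 : ∀ x < N, σ₄.arr 4 x = c x := by
    intro x hx
    simp only [hσ₄, Op.apply, State.tick, Function.update_self, hQeq, r53, hc]
    exact if_pos (by rwa [N3])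
  have hcalls4 : σ₄.calls = σ.calls ++ [(Q, ε)] := by
    have e1 : σ₄.calls = σ₃.calls ++ [(Q, ε)] := by
      simp only [hσ₄, Op.apply, State.tick, hQeq, r53]
    rw [e1, F3.calls (by decide), F2.calls (by decide), F1.calls (by decide)]
  have N4 : σ₄.int 2 = N := (F4.int 2 (by decide)).trans N3
  have M4 : σ₄.int 1 = M := (F4.int 1 (by decide)).trans M3
  have E4 : edgeList σ₄ M = edgeList σ M := by
    rw [← E2]
    refine edgeList_congr fun i hi => ?_
    rw [F4.arr 0 (by decide), F4.arr 1 (by decide)]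
    exact hs3 i (by rwa [M2])
  have hcN : ∀ x < N, c x < N := fun x hx => by
    simpa [hQ] using hdec.1 x (Finset.mem_range.2 hx)
  obtain ⟨σ₅, hx5, hs5, ht5⟩ := exec_countDegrees O σ₄ c (by
      rw [M4, N4, E4]
      exact fun p hp => ⟨(hEN p hp).1, (hEN p hp).2, h.proper p hp⟩)
    (by rwa [N4]) (by
      rw [N4, F4.arr 5 (by decide), F4.arr 6 (by decide), F3.arr 5 (by decide),
        F3.arr 6 (by decide), F2.arr 5 (by decide), F2.arr 6 (by decide)]
      exact fun x hx => (hs1 x hx).2.imp_right fun h => h.1)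
  have F5 := hx5.frame
  rw [N4, M4, E4] at hs5
  have N5 : σ₅.int 2 = N := (F5.int 2 (by decide)).trans N4
  have M5 : σ₅.int 1 = M := (F5.int 1 (by decide)).trans M4
  have i115 : σ₅.int 11 = 0 := by
    rw [F5.int 11 (by decide), F4.int 11 (by decide), F3.int 11 (by decide), F2.int 11 (by decide),
      F1.int 11 (by decide), h.int11]
  obtain ⟨σ₆, hx6, hs6, ht6⟩ := exec_relabel O σ₅ c i115 (by
      rw [N5, F5.arr 4 (by decide)]
      exact fun x hx => ⟨c4 x hx, hcN x hx⟩) (by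
      rw [N5, F5.arr 7 (by decide), F4.arr 7 (by decide), F3.arr 7 (by decide),
        F2.arr 7 (by decide)]
      exact fun x hx => (hs1 x hx).2.2.2)
  have F6 := hx6.frame
  rw [N5] at hs6
  obtain ⟨σ₇, hx7, hs7, ht7⟩ := exec_updateLabels O σ₆
  have F7 := hx7.frame
  obtain ⟨σ₈, hx8, hs8, ht8⟩ := exec_filterEdges O σ₇
  have F8 := hx8.frame
  set σ₉ := (block [.copy 1 9, .copy 2 8]).denote O σ₈ with hσ₉
  have hx9 : Exec O (block [.copy 1 9, .copy 2 8]) σ₈ σ₉ := exec_denote O (by decide) _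
  have F9 := hx9.frame
  have ht9 : σ₉.time = σ₈.time + 2 := by
    simp [hσ₉, Program.denote, block, Op.apply, State.tick]
  have hx : Exec O roundProgram σ σ₉ := .seq hx1 <| .seq hx2 <| .seq hx3 <| .seq hx4 <|
    .seq hx5 <| .seq hx6 <| .seq hx7 <| .seq hx8 hx9
  have F := hx.frame
  set N' := σ₆.int 8 with hN'
  set nw := σ₆.arr 8 with hnw
  -- Labels in memory start at 1, since 0 means that a cluster has no label yet, whereas the
  -- vertices of a multigraph start at 0.
  set g : ℕ → ℕ := fun x => nw x - 1 with hg
  have hpos : ∀ x < N, 1 ≤ nw x ∧ nw x ≤ N' := hs6.pos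
  have hgeq : ∀ x < N, ∀ y < N, g x = g y ↔ nw x = nw y := by
    intro x hx y hy
    have := hpos x hx
    have := hpos y hy
    simp only [hg]
    omega
  have hN9 : σ₉.int 2 = N' := by
    have : σ₉.int 2 = σ₈.int 8 := by simp [hσ₉, Program.denote, block, Op.apply, State.tick]
    rw [this, F8.int 8 (by decide), F7.int 8 (by decide)]
  have hM9 : σ₉.int 1 = σ₈.int 9 := by simp [hσ₉, Program.denote, block, Op.apply, State.tick]
  have M7 : σ₇.int 1 = M := by rw [F7.int 1 (by decide), F6.int 1 (by decide), M5]
  have n6 : σ₆.int 0 = n := by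
    rw [F6.int 0 (by decide), F5.int 0 (by decide), F4.int 0 (by decide), F3.int 0 (by decide),
      F2.int 0 (by decide), n1]
  have E7 : edgeList σ₇ M = edgeList σ M := by
    rw [← E4]
    refine edgeList_congr fun i hi => ?_
    rw [F7.arr 0 (by decide), F7.arr 1 (by decide), F6.arr 0 (by decide), F6.arr 1 (by decide),
      F5.arr 0 (by decide), F5.arr 1 (by decide)]
    exact ⟨rfl, rfl⟩
  have E9 : edgeList σ₉ (σ₉.int 1) =
      ((edgeList σ M).filter fun p => g p.1 ≠ g p.2).map fun p => (g p.1, g p.2) := by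
    have e1 : edgeList σ₉ (σ₉.int 1) = edgeList σ₈ (σ₈.int 9) := by
      rw [hM9]
      refine edgeList_congr fun i _ => ?_
      rw [F9.arr 0 (by decide), F9.arr 1 (by decide)]
      exact ⟨rfl, rfl⟩
    rw [e1, hs8, M7, E7, F7.arr 8 (by decide), ← hnw]
    congr 1
    refine List.filter_congr fun p hp => ?_
    have := hgeq _ (hEN p hp).1 _ (hEN p hp).2
    simp only [ne_eq, this]
  have l6 : ∀ v : Fin n, σ₆.arr 2 v = f v + 1 := by
    intro v
    rw [F6.arr 2 (by decide), F5.arr 2 (by decide), F4.arr 2 (by decide), F3.arr 2 (by decide),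
      F2.arr 2 (by decide), l1, h.label v]
  have hverts : (Finset.range N).image g = Finset.range N' := by
    ext y
    simp only [Finset.mem_image, Finset.mem_range]
    constructor
    · rintro ⟨x, hx, rfl⟩
      have := hpos x hx
      simp only [hg]
      omega
    · intro hy
      obtain ⟨x, hx, hxy⟩ := hs6.surj (y + 1) (by omega) (by omega)
      exact ⟨x, hx, by simp only [hg]; omega⟩
  have hloops : ∀ x < N, (Q.edges.countP fun p => p.1 = x ∧ p.2 = x) = L x := by
    intro x hx
    change (edgeList σ M ++ loopList N L).countP _ = _
    rw [List.countP_append, countP_loopList, if_pos hx, List.countP_eq_zero.2, zero_add]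
    intro p hp hpp
    simp only [decide_eq_true_eq] at hpp
    exact h.proper p hp (hpp.1.trans hpp.2.symm)
  have hdeg : ∀ x < N, σ₅.arr 5 x = Q.properDegree x := by
    intro x hx
    rw [(hs5 x hx).1, Multigraph.properDegree]
    change _ = (edgeList σ M ++ loopList N L).countP _
    rw [List.countP_append, countP_loopList_eq_zero (fun p hp => hp.1), add_zero]
    exact List.countP_congr fun p hp => by simp [h.proper p hp]
  have hout : ∀ x < N, σ₅.arr 6 x = Q.outDegree c x := by
    intro x hx
    rw [(hs5 x hx).2, Multigraph.outDegree]
    change _ = (edgeList σ M ++ loopList N L).countP _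
    rw [List.countP_append, countP_loopList_eq_zero (fun p hp hpp => hp.1 (by rw [hpp])), add_zero]
  have hkept : ∀ x < N, ¬ KeptAt σ₅ x ↔ (Q.properDegree x : ℝ) < threshold α s f Q c x := by
    intro x hx
    have e13 : σ₅.real 13 = 10 * α⁻¹ := by
      rw [F5.real 13 (by decide), F4.real 13 (by decide), F3.real 13 (by decide),
        F2.real 13 (by decide), F1.real 13 (by decide), h.real13]
    have e8 : σ₅.real 8 = 4 * α⁻¹ := by
      rw [F5.real 8 (by decide), F4.real 8 (by decide), F3.real 8 (by decide),
        F2.real 8 (by decide), F1.real 8 (by decide), h.real8]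
    have e4 : σ₅.real 4 = s := by
      rw [F5.real 4 (by decide), F4.real 4 (by decide), F3.real 4 (by decide), r42]
    have e3 : σ₅.arr 3 x = size f x := by
      rw [F5.arr 3 (by decide), F4.arr 3 (by decide), F3.arr 3 (by decide), hsize2 x hx]
    rw [KeptAt, threshold, ncard_fiber, e13, e8, e4, e3, hdeg x hx, hout x hx, lt_max_iff,
      not_and_or, not_not, not_not]
  refine ⟨σ₉, fun v => g (f v), hx, ⟨Q, c, {x | KeptAt σ₅ x}, hQc, ?_, hdec, ?_, ?_, ?_⟩, ?_,
    ⟨(Q, ε), ?_, ⟨f, hQc⟩, hε0, hε1⟩, ?_⟩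
  · intro x hx
    rw [ncard_fiber]
    exact hloops x (Finset.mem_range.1 hx)
  · exact fun x hx hlt => (hkept x (Finset.mem_range.1 hx)).2 hlt
  · intro x hx hk
    refine lt_of_le_of_lt ?_ ((hkept x (Finset.mem_range.1 hx)).1 hk)
    -- Only forced shaving takes place, and `β d(x) ≤ d(x)`, so the slack condition holds trivially.
    exact mul_le_of_le_one_left (Nat.cast_nonneg _) hβ'.le
  · intro u v
    rw [hgeq _ (hfN u) _ (hfN v)]
    exact hs6.inj _ (hfN u) _ (hfN v)
  · refine ⟨?_, ?_, ?_, ?_, ?_, ?_, ?_, ?_, ?_, ?_, ?_, ?_⟩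
    · rw [F.int 0 (by decide), h.int0]
    · rw [F.int 11 (by decide), h.int11]
    · intro v
      rw [F9.arr 2 (by decide), F8.arr 2 (by decide), hs7 v (by rw [n6]; exact v.2), l6 v]
      have := hpos _ (hfN v)
      simp only [hg, Nat.add_sub_cancel]
      omega
    · rw [hN9, E9, ← hverts]
      exact IsContractionBy.map_filter h.contraction g
    · rw [E9]
      intro p hp
      obtain ⟨q, hq, rfl⟩ := List.mem_map.1 hp
      simpa using (List.mem_filter.1 hq).2
    · rw [F.real 2 (by decide), h.real2]
    · rw [F.real 4 (by decide), h.real4]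
    · rw [F.real 5 (by decide), h.real5]
    · rw [F.real 8 (by decide), h.real8]
    · rw [F.real 13 (by decide), h.real13]
    · rw [F.real 15 (by decide), h.real15]
    · rw [F.real 16 (by decide), h.real16]
  · rw [F9.calls (by decide), F8.calls (by decide), F7.calls (by decide), F6.calls (by decide),
      F5.calls (by decide), hcalls4]
  · have hMs : M = survivors G f := h.int1
    have hNn : N ≤ n := h.int2
    rw [hsum3] at ht3
    rw [← hMs]
    omega

end RoundProgram

/-! ### The whole program and its total running time -/

section Main

variable {n : ℕ} {G : SimpleGraph (Fin n)}

/-- Compute the constants and the initial value `s₀ = α β m / (100 φ n)`. -/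
def setup : Program :=
  block [.rconst 9 1, .rconst 10 100, .rdiv 9 9 10, .rmul 10 0 1, .rmul 5 9 10,
    .rcast 11 1, .rmul 4 10 11, .rconst 11 100, .rmul 11 11 3, .rcast 12 0, .rmul 11 11 12,
    .rdiv 4 4 11, .rconst 11 1, .rdiv 11 11 0, .rconst 8 4, .rmul 8 8 11, .rconst 13 10,
    .rmul 13 13 11, .rdiv 15 5 3, .rconst 11 1, .rdiv 15 11 15, .rconst 16 2]

/-- Halve `s` and record in the register `10` whether `w ≤ s ^ 2`. -/
def advance : Program :=
  .seq (block [.rdiv 4 4 16, .rmul 14 4 4, .zero 10]) (.ite (.rlt 14 2) .skip (block [.inc 10]))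

/-- Label every vertex by itself. -/
def initLabels : Program :=
  .seq (block [.copy 2 0]) (forLoop 3 0 (block [.copy 5 3, .inc 5, .store 2 3 5]))

/-- The program that computes the sparsifier. -/
def mainProgram : Program :=
  .seq setup <| .seq advance <| .seq (.ite (.ilt 11 10) initLabels .skip) <|
  .loop (.ilt 11 10) (.seq roundProgram advance)

theorem denote_advance (O : Procedure) {σ : State} {s w : ℝ} (h2 : σ.real 2 = w)
    (h4 : σ.real 4 = s) (h16 : σ.real 16 = 2) :
    (advance.denote O σ).real 4 = s / 2 ∧
      (0 < (advance.denote O σ).int 10 ↔ w ≤ (s / 2) ^ 2) := by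
  have hb : Test.holds ((block [.rdiv 4 4 16, .rmul 14 4 4, .zero 10]).denote O σ) (.rlt 14 2) ↔
      (s / 2) ^ 2 < w := by
    simp [Program.denote, block, Op.apply, State.tick, Test.holds, h2, h4, h16, sq]
  by_cases h : (s / 2) ^ 2 < w
  · rw [advance, Program.denote, denote_ite_pos (hb.2 h)]
    simp [Program.denote, block, Op.apply, State.tick, h4, h16, h]
  · rw [advance, Program.denote, denote_ite_neg (fun h' => h (hb.1 h'))]
    simpa [Program.denote, block, Op.apply, State.tick, h4, h16] using h

theorem Head.advance {α β w φ s : ℝ} {f : Fin n → ℕ} {σ σ' : State}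
    (h : Head G α β w φ s f σ) (F : Frame advance σ σ') (h4 : σ'.real 4 = s / 2) :
    Head G α β w φ (s / 2) f σ' := by
  have hE : edgeList σ' (σ'.int 1) = edgeList σ (σ.int 1) := by
    rw [F.int 1 (by decide)]
    refine edgeList_congr fun i _ => ?_
    rw [F.arr 0 (by decide), F.arr 1 (by decide)]
    exact ⟨rfl, rfl⟩
  refine ⟨?_, ?_, ?_, ?_, ?_, ?_, h4, ?_, ?_, ?_, ?_, ?_⟩
  · rw [F.int 0 (by decide), h.int0]
  · rw [F.int 11 (by decide), h.int11]
  · rw [F.arr 2 (by decide)]; exact h.label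
  · rw [hE, F.int 2 (by decide)]; exact h.contraction
  · rw [hE]; exact h.proper
  · rw [F.real 2 (by decide), h.real2]
  · rw [F.real 5 (by decide), h.real5]
  · rw [F.real 8 (by decide), h.real8]
  · rw [F.real 13 (by decide), h.real13]
  · rw [F.real 15 (by decide), h.real15]
  · rw [F.real 16 (by decide), h.real16]

theorem exec_initLabels (O : Procedure) (σ : State) :
    ∃ σ', Exec O initLabels σ σ' ∧ σ'.int 2 = σ.int 0 ∧ (∀ v < σ.int 0, σ'.arr 2 v = v + 1) ∧
      σ'.time ≤ σ.time + 5 * σ.int 0 + 5 := by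
  set σ₀ := (block [.copy 2 0]).denote O σ with hσ₀
  have h0 : σ₀.int 0 = σ.int 0 := by simp [hσ₀, Program.denote, block, Op.apply, State.tick]
  have h2 : σ₀.int 2 = σ.int 0 := by simp [hσ₀, Program.denote, block, Op.apply, State.tick]
  have ht : σ₀.time = σ.time + 1 := by simp [hσ₀, Program.denote, block, Op.apply, State.tick]
  obtain ⟨σ', hx, hs, ht'⟩ := exec_forLoop_denote (O := O) (i := 3) (N := 0)
    (body := block [.copy 5 3, .inc 5, .store 2 3 5])
    (by decide) (by decide) (by decide) (by decide) σ₀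
    (fun k τ => ∀ v < k, τ.arr 2 v = v + 1) (fun _ _ _ _ h => h) (by simp) (by
      intro k _ τ _ hk hI v hv
      simp only [Program.denote, block, List.foldr, Op.apply, State.tick, Function.update_apply, hk,
        Nat.reduceEqDiff, ↓reduceIte]
      by_cases hvk : v = k
      · simp [hvk]
      · simpa [hvk] using hI v (by omega))
  rw [h0] at hs ht'
  refine ⟨σ', .seq (exec_denote O (by decide) σ) hx, ?_, hs, ?_⟩
  · rw [hx.frame.int 2 (by decide), h2]
  · simp only [Program.cost, block, List.foldr] at ht'
    omega

theorem edgeList_input (n : ℕ) (l : List (ℕ × ℕ)) (α β w φ : ℝ) :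
    edgeList (input n l α β w φ) l.length = l := by
  refine List.ext_getElem (by simp [edgeList]) fun i h1 h2 => ?_
  simp [edgeList, input, h2]

/-- The invariant of the main loop after `j` rounds. -/
structure LoopHead (G : SimpleGraph (Fin n)) (α β w φ s₀ T : ℝ) (j : ℕ) (f : Fin n → ℕ)
    (σ : State) : Prop where
  rounds : Rounds G α β φ w s₀ j f
  head : Head G α β w φ (s₀ / 2 ^ (j + 1)) f σ
  flag : 0 < σ.int 10 ↔ w ≤ (s₀ / 2 ^ (j + 1)) ^ 2
  length : σ.calls.length = j
  calls : ∀ q ∈ σ.calls, q.1.IsContraction G ∧ 0 < q.2 ∧ q.2 < 1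
  time : (σ.time : ℝ) ≤ T + 1600 * (G.edgeSet.ncard * (1 - 1 / 2 ^ j))

/-- With `r = m / 2^(j+1)`, a round has at most `2r` edges and at most `r + n` self-loops, and `n ≤
r` because `s ≥ 1`. It thus costs `O(r)`, which is the increment of `m (1 - 1/2^j)` in the time
invariant. -/
theorem LoopHead.step {O : Procedure} {α β w φ s₀ T : ℝ} (hO : O.Decomposes G φ) (hα : 0 < α)
    (hα' : α < 1 / 4) (hβ : 0 < β) (hβ' : β < 1) (hw : 1 ≤ w) (hφ : 1 ≤ φ) (hn : 0 < n)
    (hs₀ : s₀ = α * β * (G.edgeSet.ncard : ℝ) / (100 * φ * n)) {j : ℕ} {f : Fin n → ℕ} {σ : State}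
    (h : LoopHead G α β w φ s₀ T j f σ) (hflag : 0 < σ.int 10) :
    ∃ σ' f', Exec O (.seq roundProgram advance) σ.tick σ' ∧
      LoopHead G α β w φ s₀ T (j + 1) f' σ' := by
  have hws := h.flag.1 hflag
  set m : ℝ := (G.edgeSet.ncard : ℝ) with hm
  have hm0 : 0 ≤ m := Nat.cast_nonneg _
  have hn' : (0 : ℝ) < n := by exact_mod_cast hn
  have hs₀0 : 0 ≤ s₀ := by rw [hs₀]; positivity
  set s := s₀ / 2 ^ (j + 1) with hs
  have hs0 : 0 ≤ s := by positivity
  have hs1 : 1 ≤ s := by nlinarith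
  have hhead : Head G α β w φ s f σ.tick :=
    ⟨h.head.1, h.head.2, h.head.3, h.head.4, h.head.5, h.head.6, h.head.7, h.head.8, h.head.9,
      h.head.10, h.head.11, h.head.12⟩
  obtain ⟨σ₁, f', hx1, hround, hhead1, ⟨q, hq, hqG, hq0, hq1⟩, ht1⟩ :=
    exec_roundProgram hO hα hα' hβ hβ' hhead
  have hx2 : Exec O advance σ₁ (advance.denote O σ₁) := exec_denote O (by decide) _
  obtain ⟨h4, h10⟩ := denote_advance O hhead1.real2 hhead1.real4 hhead1.real16
  have hts : (advance.denote O σ₁).time ≤ σ₁.time + 5 := time_denote O advance σ₁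
  have hsnext : s / 2 = s₀ / 2 ^ (j + 1 + 1) := by rw [hs, pow_succ _ (j + 1), div_div]
  have hcalls : (advance.denote O σ₁).calls = σ.calls ++ [q] := by
    rw [hx2.frame.calls (by decide), hq]
    rfl
  refine ⟨_, f', .seq hx1 hx2, .next h.rounds hws hround, hsnext ▸ hhead1.advance hx2.frame h4,
    hsnext ▸ h10, ?_, ?_, ?_⟩
  · rw [hcalls, List.length_append, h.length, List.length_singleton]
  · rw [hcalls]
    intro p hp
    rcases List.mem_append.1 hp with hp | hp
    · exact h.calls p hp
    · rw [List.mem_singleton.1 hp]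
      exact ⟨hqG, hq0, hq1⟩
  · set K : ℝ := (0.01 * (α * β) / φ)⁻¹ with hK
    have hK0 : 0 ≤ K := by positivity
    set r : ℝ := m / 2 ^ (j + 1) with hr
    have hnr : (n : ℝ) ≤ r := by
      have e1 : s * n ≤ r := by
        rw [hs, hs₀, hr]
        have : α * β ≤ 100 * φ := by nlinarith
        rw [div_mul_eq_mul_div, div_le_div_iff_of_pos_right (by positivity)]
        calc α * β * m / (100 * φ * n) * n = α * β / (100 * φ) * m := by field_simp
          _ ≤ 1 * m := by
            gcongr
            exact (div_le_one (by positivity)).2 this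
          _ = m := one_mul m
      nlinarith
    -- The choice of the smallest admissible `s₀` makes the self-loops, before rounding, number
    -- exactly `r`: the factors `φ` and `αβ` cancel.
    have hKs : K * s * n = r := by
      rw [hK, hs, hs₀, hr]
      field_simp
      ring
    have hloop : ((∑ x ∈ Finset.range (σ.int 2), ⌈K * s * (size f x : ℝ)⌉₊ : ℕ) : ℝ) ≤ r + n := by
      rw [← hKs]
      exact sum_ceil_size_le h.head.contraction (mul_nonneg hK0 hs0)
    have hsurv : (survivors G f : ℝ) ≤ 2 * r := by
      have e1 := h.rounds.survivors_le hα hα' hβ hβ' hφ hw hs₀0 (by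
        rw [hs₀]
        apply le_of_eq
        field_simp
        exact hm.symm)
      have e2 : 100 * (φ * (s₀ / 2 ^ j) * n) = α * β * (2 * r) := by
        rw [hs₀, hr, pow_succ]
        field_simp
      rw [e2] at e1
      exact le_of_mul_le_mul_left e1 (by positivity)
    have hn1 : (1 : ℝ) ≤ n := by exact_mod_cast hn
    have ht : ((advance.denote O σ₁).time : ℝ) ≤ σ.time + 1 + 200 * (survivors G f + n +
        ((∑ x ∈ Finset.range (σ.int 2), ⌈K * s * (size f x : ℝ)⌉₊ : ℕ) : ℝ) + 1) + 5 := by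
      have : σ.tick.time = σ.time + 1 := rfl
      rw [this] at ht1
      exact_mod_cast hts.trans (Nat.add_le_add_right ht1 5)
    have htot : m * (1 - 1 / 2 ^ (j + 1)) = m * (1 - 1 / 2 ^ j) + r := by
      rw [hr, pow_succ]
      field_simp
      ring
    rw [htot]
    have := h.time
    -- The round takes at most `200 (2r + n + (r + n) + 1) + 6 ≤ 1206 r` steps, as `1 ≤ n ≤ r`.
    linarith

/-- The number `d` is fuel: reaching round `B + 1` would force `2 ^ (B + 1) ≤ s₀ ≤ 2 ^ B`, so the
loop ends before the fuel runs out. -/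
theorem LoopHead.exec {O : Procedure} {α β w φ s₀ T : ℝ} (hO : O.Decomposes G φ) (hα : 0 < α)
    (hα' : α < 1 / 4) (hβ : 0 < β) (hβ' : β < 1) (hw : 1 ≤ w) (hφ : 1 ≤ φ) (hn : 0 < n)
    (hs₀ : s₀ = α * β * (G.edgeSet.ncard : ℝ) / (100 * φ * n)) {B : ℕ} (hB : s₀ ≤ 2 ^ B) :
    ∀ (d j : ℕ), j + d = B + 1 → ∀ (f : Fin n → ℕ) (σ : State), LoopHead G α β w φ s₀ T j f σ →
      ∃ σ' j' f', Exec O (.loop (.ilt 11 10) (.seq roundProgram advance)) σ σ'.tick ∧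
        LoopHead G α β w φ s₀ T j' f' σ' ∧ ¬ 0 < σ'.int 10 := by
  have hs₀0 : 0 ≤ s₀ := by rw [hs₀]; positivity
  intro d
  induction d with
  | zero =>
    rintro j hj f σ h
    have h1 := h.rounds.two_pow_le hw hs₀0 (by omega)
    have h2 : (2 : ℝ) ^ B < 2 ^ j := pow_lt_pow_right₀ (by norm_num) (by omega)
    linarith
  | succ d ih =>
    intro j hj f σ h
    by_cases hflag : 0 < σ.int 10
    · obtain ⟨σ₁, f₁, hx1, h1⟩ := h.step hO hα hα' hβ hβ' hw hφ hn hs₀ hflag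
      obtain ⟨σ₂, j₂, f₂, hx2, h2, h3⟩ := ih (j + 1) (by omega) f₁ σ₁ h1
      refine ⟨σ₂, j₂, f₂, .loopTrue ?_ hx1 hx2, h2, h3⟩
      rw [Test.holds, h.head.int11]
      exact hflag
    · refine ⟨σ, j, f, .loopFalse ?_, h, hflag⟩
      rw [Test.holds, h.head.int11]
      exact hflag

theorem output_eq_ker {f : Fin n → ℕ} {σ : State} (h : ∀ v : Fin n, σ.arr 2 v = f v + 1) :
    output n σ = Setoid.ker f := by
  ext u v
  change (u = v ∨ (σ.arr 2 u ≠ 0 ∧ σ.arr 2 u = σ.arr 2 v)) ↔ f u = f v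
  rw [h, h]
  constructor
  · rintro (rfl | ⟨-, h⟩)
    · rfl
    · omega
  · intro h
    exact Or.inr ⟨by omega, by omega⟩

theorem output_eq_bot {σ : State} (h : ∀ v : Fin n, σ.arr 2 v = 0) :
    output n σ = Setoid.ker Fin.val := by
  ext u v
  change (u = v ∨ (σ.arr 2 u ≠ 0 ∧ σ.arr 2 u = σ.arr 2 v)) ↔ u.val = v.val
  rw [h, Fin.ext_iff]
  simp

theorem exec_mainProgram {O : Procedure} {α β w φ : ℝ} (hα : 0 < α) (hα' : α < 1 / 4) (hβ : 0 < β)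
    (hβ' : β < 1) (hw : 1 ≤ w) (hφ : 0 < φ) (hO : O.Decomposes G φ) {l : List (ℕ × ℕ)}
    (hl : Lists l G) :
    ∃ σ f, Exec O mainProgram (input n l α β w φ) σ ∧
      IsConstructed G α β φ w σ.calls.length f ∧ output n σ = Setoid.ker f ∧
      (∀ q ∈ σ.calls, q.1.IsContraction G ∧ 0 < q.2 ∧ q.2 < 1) ∧
      (σ.time : ℝ) ≤ 2000 * (G.edgeSet.ncard + 1) := by
  set m : ℝ := (G.edgeSet.ncard : ℝ) with hm
  have hm0 : 0 ≤ m := Nat.cast_nonneg _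
  set s₀ : ℝ := α * β * m / (100 * φ * n) with hs₀
  have hs₀0 : 0 ≤ s₀ := by positivity
  have hs₀m : s₀ ≤ m / n := by
    rcases hm0.eq_or_lt with h0 | h0
    · rw [hs₀, ← h0]; simp
    · have hφ1 := one_le_of_decomposes hφ hO ((Nat.cast_pos (α := ℝ)).1 h0)
      rw [hs₀, mul_div_mul_comm]
      -- Here `φ ≥ 1` shows that the smallest admissible `s₀` does not exceed the largest.
      have : α * β ≤ 100 * φ := by nlinarith
      exact mul_le_of_le_one_left (by positivity) ((div_le_one (by positivity)).2 this)
  set σ₀ := input n l α β w φ with hσ₀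
  have i0 : σ₀.int 0 = n := rfl
  have i1 : σ₀.int 1 = l.length := rfl
  set σ₁ := setup.denote O σ₀ with hσ₁
  have hx1 : Exec O setup σ₀ σ₁ := exec_denote O (by decide) _
  have ht1 : σ₁.time ≤ 22 := (time_denote O setup σ₀).trans (by simp [hσ₀, input, setup, Program.cost, block])
  have r5 : σ₁.real 5 = 0.01 * (α * β) := by
    simp [hσ₁, setup, Program.denote, block, Op.apply, State.tick, hσ₀, input]
    norm_num
  have r4 : σ₁.real 4 = s₀ := by
    simp [hσ₁, setup, Program.denote, block, Op.apply, State.tick, hσ₀, input, hs₀, hm,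
      ← hl.length_eq]
  have r8 : σ₁.real 8 = 4 * α⁻¹ := by
    simp [hσ₁, setup, Program.denote, block, Op.apply, State.tick, hσ₀, input]
  have r13 : σ₁.real 13 = 10 * α⁻¹ := by
    simp [hσ₁, setup, Program.denote, block, Op.apply, State.tick, hσ₀, input]
  have r15 : σ₁.real 15 = (0.01 * (α * β) / φ)⁻¹ := by
    simp [hσ₁, setup, Program.denote, block, Op.apply, State.tick, hσ₀, input]
    norm_num
  have r16 : σ₁.real 16 = 2 := by
    simp [hσ₁, setup, Program.denote, block, Op.apply, State.tick, hσ₀, input]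
  have r2 : σ₁.real 2 = w := hx1.frame.real 2 (by decide)
  set σ₂ := advance.denote O σ₁ with hσ₂
  have hx2 : Exec O advance σ₁ σ₂ := exec_denote O (by decide) _
  obtain ⟨h4, h10⟩ := denote_advance O r2 r4 r16
  rw [← hσ₂] at h4 h10
  have ht2 : σ₂.time ≤ 27 := (time_denote O advance σ₁).trans (Nat.add_le_add_right ht1 5)
  have F12 : ∀ r, setup.all (Op.keepsInt r) = true → advance.all (Op.keepsInt r) = true →
      σ₂.int r = σ₀.int r := fun r h h' => (hx2.frame.int r h').trans (hx1.frame.int r h)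
  have A12 : ∀ a, setup.all (Op.keepsArr a) = true → advance.all (Op.keepsArr a) = true →
      σ₂.arr a = σ₀.arr a := fun r h h' => (hx2.frame.arr r h').trans (hx1.frame.arr r h)
  have i11 : σ₂.int 11 = 0 := F12 11 (by decide) (by decide)
  have c2 : σ₂.calls = [] := by
    rw [hx2.frame.calls (by decide), hx1.frame.calls (by decide)]
    rfl
  -- Labelling the vertices takes time linear in `n`, which may exceed `m`. It is done only if a
  -- round follows; then `s₀ ≥ 2` and `2n ≤ m`. Otherwise the array stays zero, which the output
  -- convention reads as the uncontracted graph.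
  by_cases hflag : 0 < σ₂.int 10
  · have hws := h10.1 hflag
    have hs1 : 1 ≤ s₀ / 2 := by nlinarith
    have hmpos : 0 < m := by
      rcases hm0.eq_or_lt with h0 | h0
      · rw [← h0, zero_div] at hs₀m
        linarith
      · exact h0
    have hφ1 := one_le_of_decomposes hφ hO ((Nat.cast_pos (α := ℝ)).1 hmpos)
    have hn : 0 < n := by
      rcases Nat.eq_zero_or_pos n with h0 | h0
      · rw [h0] at hs₀m
        simp only [Nat.cast_zero, div_zero] at hs₀m
        linarith
      · exact h0
    have hn' : (0 : ℝ) < n := by exact_mod_cast hn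
    have hnm : 2 * (n : ℝ) ≤ m := by
      have : 2 ≤ m / n := by linarith
      rwa [le_div_iff₀ hn'] at this
    obtain ⟨σ₃, hx3, h32, h3l, ht3⟩ := exec_initLabels O σ₂.tick
    have F3 := hx3.frame
    have n2 : σ₂.tick.int 0 = n := F12 0 (by decide) (by decide)
    rw [n2] at h32 h3l ht3
    have hE : edgeList σ₃ (σ₃.int 1) = l := by
      have e1 : σ₃.int 1 = l.length :=
        (F3.int 1 (by decide)).trans (F12 1 (by decide) (by decide))
      rw [e1]
      refine (edgeList_congr (σ := σ₀) fun i _ => ?_).trans (edgeList_input n l α β w φ)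
      rw [F3.arr 0 (by decide), F3.arr 1 (by decide)]
      change σ₂.arr 0 i = _ ∧ σ₂.arr 1 i = _
      rw [A12 0 (by decide) (by decide), A12 1 (by decide) (by decide)]
      exact ⟨rfl, rfl⟩
    have hreal : ∀ x, initLabels.all (Op.keepsReal x) = true →
        advance.all (Op.keepsReal x) = true → σ₃.real x = σ₁.real x := fun x h h' =>
      (F3.real x h).trans (hx2.frame.real x h')
    -- The time so far is at most `5n + 33`, and `n ≤ m`.
    have hL : LoopHead G α β w φ s₀ (40 + 5 * m) 0 Fin.val σ₃ := by
      refine ⟨.start, ⟨?_, ?_, fun v => h3l v v.2, ?_, ?_, ?_, ?_, ?_, ?_, ?_, ?_, ?_⟩, ?_, ?_, ?_, ?_⟩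
      · rw [F3.int 0 (by decide), n2]
      · rw [F3.int 11 (by decide)]; exact i11
      · rw [hE, h32]; exact hl.isContractionBy
      · rw [hE]; exact fun p hp => hl.ne hp
      · rw [hreal 2 (by decide) (by decide), r2]
      · rw [F3.real 4 (by decide), zero_add, pow_one]; exact h4
      · rw [hreal 5 (by decide) (by decide), r5]
      · rw [hreal 8 (by decide) (by decide), r8]
      · rw [hreal 13 (by decide) (by decide), r13]
      · rw [hreal 15 (by decide) (by decide), r15]
      · rw [hreal 16 (by decide) (by decide), r16]
      · rw [F3.int 10 (by decide), zero_add, pow_one]; exact h10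
      · rw [F3.calls (by decide)]
        change σ₂.calls.length = 0
        rw [c2, List.length_nil]
      · rw [F3.calls (by decide)]
        change ∀ q ∈ σ₂.calls, _
        rw [c2]
        simp
      · have e1 : σ₃.time ≤ 5 * n + 33 := by
          have : σ₂.tick.time = σ₂.time + 1 := rfl
          omega
        have e2 : (σ₃.time : ℝ) ≤ 5 * n + 33 := by exact_mod_cast e1
        simp only [pow_zero, div_one, sub_self, mul_zero, add_zero]
        linarith
    obtain ⟨B, hB⟩ := pow_unbounded_of_one_lt s₀ (one_lt_two (α := ℝ))
    obtain ⟨σ₄, j, f, hx4, h5, h6⟩ := LoopHead.exec hO hα hα' hβ hβ' hw hφ1 hn rfl hB.le (B + 1) 0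
      (by omega) _ _ hL
    refine ⟨σ₄.tick, f, .seq hx1 (.seq hx2 (.seq (.iteTrue ?_ hx3) hx4)), ?_, ?_, h5.calls, ?_⟩
    · rw [Test.holds, i11]
      exact hflag
    · change IsConstructed G α β φ w σ₄.calls.length f
      rw [h5.length]
      refine ⟨s₀, le_rfl, hs₀m, h5.rounds, not_le.1 fun h => h6 (h5.flag.2 h)⟩
    · exact output_eq_ker h5.head.label
    · have e1 : ((σ₄.tick).time : ℝ) = σ₄.time + 1 := by simp [State.tick]
      have e2 := h5.time
      have e3 : m * (1 - 1 / 2 ^ j) ≤ m := by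
        have : (0 : ℝ) ≤ 1 / 2 ^ j := by positivity
        nlinarith
      rw [e1]
      linarith
  · refine ⟨σ₂.tick.tick, Fin.val, .seq hx1 (.seq hx2 (.seq (.iteFalse ?_ (.skip _))
      (.loopFalse ?_))), ?_, ?_, ?_, ?_⟩
    · rw [Test.holds, i11]
      exact hflag
    · change ¬ σ₂.int 11 < σ₂.int 10
      rw [i11]
      exact hflag
    · change IsConstructed G α β φ w σ₂.calls.length Fin.val
      rw [c2]
      refine ⟨s₀, le_rfl, hs₀m, .start, ?_⟩
      rw [List.length_nil, zero_add, pow_one]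
      exact not_le.1 fun h => hflag (h10.2 h)
    · refine output_eq_bot fun v => ?_
      change σ₂.arr 2 v = 0
      rw [A12 2 (by decide) (by decide)]
      rfl
    · change ∀ q ∈ σ₂.calls, _
      rw [c2]
      simp
    · have e1 : σ₂.tick.tick.time ≤ 29 := by
        have : σ₂.tick.tick.time = σ₂.time + 1 + 1 := rfl
        omega
      have e2 : (σ₂.tick.tick.time : ℝ) ≤ 29 := by exact_mod_cast e1
      linarith

end Main

end FriendlyCut

end
open FriendlyCut in
theorem mainTheorem9 :
    ∃ (P : Program) (C : ℝ) (k : ℕ),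
      ∀ (n : ℕ) (G : SimpleGraph (Fin n)) (α β w φ : ℝ),
        0 < α → α < 1 / 4 → 0 < β → β < 1 → 1 ≤ w → 0 < φ →
        ∀ O : Procedure, O.Decomposes G φ →
          (∀ l : List (ℕ × ℕ), Lists l G →
            ∃ σ : State, Exec O P (input n l α β w φ) σ ∧
              IsFriendlyCutSparsifier α w G (contract G (output n σ)) ∧
              IsRobust (√w) α w G (contract G (output n σ)) ∧
              ((contract G (output n σ)).edges.ncard : ℝ) ≤
                C * Real.log (n + 2) ^ k * ((β * α)⁻¹ * n * φ * √w) ∧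
              (∃ f : Fin n → ℕ, IsConstructed G α β φ w σ.calls.length f ∧
                output n σ = Setoid.ker f) ∧
              (σ.calls.length : ℝ) ≤ C * Real.log (n + 2) ^ k ∧
              (∀ q ∈ σ.calls, q.1.IsContraction G ∧ 0 < q.2 ∧ q.2 < 1) ∧
              (σ.time : ℝ) ≤ C * (G.edgeSet.ncard + 1)) ∧
          (∀ (t : ℕ) (f : Fin n → ℕ), IsConstructed G α β φ w t f →
            IsFriendlyCutSparsifier α w G (contract G (Setoid.ker f)) ∧
            IsRobust (√w) α w G (contract G (Setoid.ker f)) ∧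
            ((contract G (Setoid.ker f)).edges.ncard : ℝ) ≤
              C * Real.log (n + 2) ^ k * ((β * α)⁻¹ * n * φ * √w) ∧
            (t : ℝ) ≤ C * Real.log (n + 2) ^ k) := by
  -- The constant covers 400 for the edges, 2 for the rounds and `1605 m + 41` for the time; one
  -- logarithmic factor suffices.
  refine ⟨mainProgram, 2000, 1, fun n G α β w φ hα hα' hβ hβ' hw hφ O hO => ?_⟩
  have hφ' := one_le_of_decomposes hφ hO
  have hlog : 0 ≤ Real.log (n + 2) := Real.log_nonneg (by linarith [Nat.cast_nonneg (α := ℝ) n])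
  have hpart : ∀ (t : ℕ) (f : Fin n → ℕ), IsConstructed G α β φ w t f →
      IsFriendlyCutSparsifier α w G (contract G (Setoid.ker f)) ∧
      IsRobust (√w) α w G (contract G (Setoid.ker f)) ∧
      ((contract G (Setoid.ker f)).edges.ncard : ℝ) ≤
        2000 * Real.log (n + 2) ^ 1 * ((β * α)⁻¹ * n * φ * √w) ∧
      (t : ℝ) ≤ 2000 * Real.log (n + 2) ^ 1 := by
    intro t f hf
    obtain ⟨h1, h2, h3, h4⟩ := hf.spec hα hα' hβ hβ' hφ hφ' hw
    rw [pow_one]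
    refine ⟨h1, h2, h3.trans ?_, by linarith⟩
    gcongr
    norm_num
  refine ⟨fun l hl => ?_, hpart⟩
  obtain ⟨σ, f, hx, hf, hout, hcalls, htime⟩ := exec_mainProgram hα hα' hβ hβ' hw hφ hO hl
  obtain ⟨h1, h2, h3, h4⟩ := hpart _ _ hf
  refine ⟨σ, hx, ?_, ?_, ?_, ⟨f, hf, hout⟩, h4, hcalls, htime⟩
  all_goals rw [hout]
  exacts [h1, h2, h3]
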